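/- Let $T>0$, $Q(T)=(0,T)\times(0,1)$, $H=L^2(0,1)$, $X=H^1(0,1)$. Assume that $h\in C^2(\mathbb R)$ satisfies $C_{h,1}\le h'\le C_{h,2}$ and $|h''|\le C_{h,2}$ on $\mathbb R$, and that $b\in C^2(\mathbb R)$ satisfies $C_{b,1}\le b\le C_{b,2}$ and $|b'|,|b''|\le C_{b,2}$ on $\mathbb R$, for some positive constants $C_{h,1},C_{h,2},C_{b,1},C_{b,2}$. Let $p\in W^{1,2}(0,T;H)\cap L^\infty(0,T;L^\infty(0,1))\cap L^2(0,T;X)$ and $v_0\in X$. Let $v\in W^{1,2}(0,T;H)\cap L^\infty(0,T;X)\cap L^2(0,T;H^2(0,1))$ be the strong solution of $$\partial_t h(v)=\partial_x\big(\partial_x v+b(v)p\big)\ \text{a.e. in } Q(T),\qquad \partial_x v+b(v)p=0\ \text{ at } x=0,1 \text{ for a.e. } t\in(0,T),\qquad v(0,\cdot)=v_0 .$$ For an integer $n\ge 3$ put $\Delta x=1/n$, $x_i=i\,\Delta x$, $V_i=[x_{i-1},x_i)$ for $1\le i\le n-1$, $V_n=[x_{n-1},x_n]$, let $p_i(t)=\frac1{\Delta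 x}\int_{V_i}p(t,x)\,dx$ (a continuous function of $t\in[0,T]$), and let $(v_1,\dots,v_n)$ be the solution on $[0,T]$ of $$h'(v_i)\frac{d v_i}{dt}=\frac{F_i-F_{i-1}}{\Delta x},\quad v_i(0)=\frac1{\Delta x}\int_{V_i}v_0\,dx\quad(1\le i\le n),\qquad F_i=\frac{v_{i+1}-v_i}{\Delta x}+b\Big(\frac{v_i+v_{i+1}}2\Big)p_i\ (1\le i\le n-1),\quad F_0=F_n=0 .$$ Let $v^{(n)}(t,x)=v_i(t)$ for $x\in V_i$, and let $\widetilde v^{(n)}(t,x)=\big(v^{(n)}(t,x)-v^{(n)}(t,x-\Delta x)\big)/\Delta x$ for $\Delta x\le x\le 1$ and $\widetilde v^{(n)}(t,x)=0$ for $0\le x<\Delta x$. Then there exists a constant $C>0$, depending only on $h,b,p,v_0,T$ (in particular not on $n$), such that for all $n\ge3$ and all $t\in[0,T]$ $$\big|v-v^{(n)}\big|_{L^\infty(0,T;H)}^2+\int_0^t\big|\partial_x v(\tau,\cdot)-\widetilde v^{(n)}(\tau,\cdot)\big|_{L^2(\Delta x,1)}^2\,d\tau\le C\,(\Delta x)^{1/2}.$$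 -/

import Mathlib

namespace FVM

noncomputable section

open MeasureTheory Set
open scoped ContDiff ENNReal

/-! ### Weak derivatives and function spaces -/

/-- `g` is the weak (distributional) derivative of `u` in the direction `e` on the open set `U`:
`∫_U u ∂_e φ = - ∫_U g φ` for all test functions `φ ∈ C_c^∞(U)`. -/
def IsWeakDeriv {E : Type*} [NormedAddCommGroup E] [NormedSpace ℝ E] [MeasureSpace E]
    (U : Set E) (e : E) (u g : E → ℝ) : Prop :=
  LocallyIntegrableOn u U volume ∧ LocallyIntegrableOn g U volume ∧
    ∀ φ : E → ℝ, ContDiff ℝ ∞ φ → HasCompactSupport φ → tsupport φ ⊆ U →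
      ∫ z in U, u z * fderiv ℝ φ z e = - ∫ z in U, g z * φ z

/-- The space-time cylinder `Q(T) = (0,T) × (0,1)`; points are `(t, x)`. -/
def Q (T : ℝ) : Set (ℝ × ℝ) := Ioo 0 T ×ˢ Ioo 0 1

/-- Weak time derivative on `Q(T)`. -/
def IsWeakDt (T : ℝ) (u g : ℝ × ℝ → ℝ) : Prop := IsWeakDeriv (Q T) ((1 : ℝ), (0 : ℝ)) u g

/-- Weak space derivative on `Q(T)`. -/
def IsWeakDx (T : ℝ) (u g : ℝ × ℝ → ℝ) : Prop := IsWeakDeriv (Q T) ((0 : ℝ), (1 : ℝ)) u g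

/-- `u ∈ L²(Q(T)) = L²(0,T; H)`, where `H = L²(0,1)`. -/
def MemL2H (T : ℝ) (u : ℝ × ℝ → ℝ) : Prop := MemLp u 2 (volume.restrict (Q T))

/-- `u ∈ W^{1,2}(0,T; H)`. -/
def MemW12H (T : ℝ) (u : ℝ × ℝ → ℝ) : Prop :=
  MemL2H T u ∧ ∃ g, IsWeakDt T u g ∧ MemL2H T g

/-- `u ∈ L²(0,T; X)`, where `X = H¹(0,1)`. -/
def MemL2X (T : ℝ) (u : ℝ × ℝ → ℝ) : Prop :=
  MemL2H T u ∧ ∃ g, IsWeakDx T u g ∧ MemL2H T g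

/-- `u ∈ L²(0,T; H²(0,1))`. -/
def MemL2H2 (T : ℝ) (u : ℝ × ℝ → ℝ) : Prop :=
  MemL2H T u ∧ ∃ g, IsWeakDx T u g ∧ MemL2H T g ∧ ∃ k, IsWeakDx T g k ∧ MemL2H T k

/-- The norm of `L^∞(0,T; H)`, with values in `[0, ∞]`. -/
def normLinfH (T : ℝ) (u : ℝ × ℝ → ℝ) : ℝ≥0∞ :=
  essSup (fun t => eLpNorm (fun x => u (t, x)) 2 (volume.restrict (Ioo 0 1)))
    (volume.restrict (Ioo 0 T))

/-- `u ∈ L^∞(0,T; X)`, where `X = H¹(0,1)`. -/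
def MemLinfX (T : ℝ) (u : ℝ × ℝ → ℝ) : Prop :=
  normLinfH T u < ⊤ ∧ ∃ g, IsWeakDx T u g ∧ normLinfH T g < ⊤

/-- `u ∈ L^∞(0,T; L^∞(0,1))`, that is, `u` is essentially bounded on `Q(T)`. -/
def MemLinfLinf (T : ℝ) (u : ℝ × ℝ → ℝ) : Prop := MemLp u ⊤ (volume.restrict (Q T))

/-- `u ∈ X = H¹(0,1)`. -/
def MemX (u : ℝ → ℝ) : Prop :=
  MemLp u 2 (volume.restrict (Ioo 0 1)) ∧
    ∃ g, IsWeakDeriv (Ioo (0 : ℝ) 1) (1 : ℝ) u g ∧ MemLp g 2 (volume.restrict (Ioo 0 1))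

/-! ### Assumptions on the nonlinearities -/

/-- Assumption (A1) on `h`. -/
def A1 (h : ℝ → ℝ) : Prop :=
  ContDiff ℝ 2 h ∧ ∃ C₁ C₂ : ℝ, 0 < C₁ ∧ 0 < C₂ ∧
    ∀ r, C₁ ≤ deriv h r ∧ deriv h r ≤ C₂ ∧ |deriv (deriv h) r| ≤ C₂

/-- Assumption (A2) on `b`. -/
def A2 (b : ℝ → ℝ) : Prop :=
  ContDiff ℝ 2 b ∧ ∃ C₁ C₂ : ℝ, 0 < C₁ ∧ 0 < C₂ ∧
    ∀ r, C₁ ≤ b r ∧ b r ≤ C₂ ∧ |deriv b r| ≤ C₂ ∧ |deriv (deriv b) r| ≤ C₂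

/-! ### Strong solutions -/

/-- The function `f` on `(0,1)` (an a.e. class) has boundary values `α` at `0` and `β` at `1`:
it has a representative that is continuous on `[0,1]` and takes these values. -/
def HasBoundaryValues (f : ℝ → ℝ) (α β : ℝ) : Prop :=
  ∃ F : ℝ → ℝ, ContinuousOn F (Icc 0 1) ∧ f =ᵐ[volume.restrict (Ioo 0 1)] F ∧ F 0 = α ∧ F 1 = β

/-- The function `u` on `Q(T)` (an a.e. class) has the initial value `u₀`: it has a
representative in `C([0,T]; L²(0,1))` that equals `u₀` at `t = 0`. -/
def HasInitialValue (T : ℝ) (u : ℝ × ℝ → ℝ) (u₀ : ℝ → ℝ) : Prop :=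
  ∃ w : ℝ → Lp ℝ 2 (volume.restrict (Ioo (0 : ℝ) 1)), ContinuousOn w (Icc 0 T) ∧
    (∀ᵐ t ∂(volume.restrict (Ioo 0 T)),
      (fun x => u (t, x)) =ᵐ[volume.restrict (Ioo (0 : ℝ) 1)] w t) ∧
    w 0 =ᵐ[volume.restrict (Ioo (0 : ℝ) 1)] u₀

/-- `v` is a strong solution of
`∂ₜ h(v) = ∂ₓ(∂ₓ v + b(v) p)` a.e. in `Q(T)`, `∂ₓ v + b(v) p = 0` at `x = 0, 1`, `v(0) = v₀`. -/
structure IsStrongSolution (T : ℝ) (h b : ℝ → ℝ) (p : ℝ × ℝ → ℝ) (v₀ : ℝ → ℝ)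
    (v : ℝ × ℝ → ℝ) : Prop where
  memW12H : MemW12H T v
  memLinfX : MemLinfX T v
  memL2H2 : MemL2H2 T v
  /-- The equation and the boundary condition, for the flux `∂ₓ v + b(v) p`. The common value
  of the two sides of the equation is `G`. -/
  equation : ∃ vx, IsWeakDx T v vx ∧
    (∃ G, MemL2H T G ∧ IsWeakDt T (fun z => h (v z)) G ∧
      IsWeakDx T (fun z => vx z + b (v z) * p z) G) ∧
    ∀ᵐ t ∂(volume.restrict (Ioo 0 T)),
      HasBoundaryValues (fun x => vx (t, x) + b (v (t, x)) * p (t, x)) 0 0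
  initial : HasInitialValue T v v₀

/-! ### The finite volume scheme -/

/-- The mesh size `Δx = 1/n`. -/
def mesh (n : ℕ) : ℝ := 1 / (n : ℝ)

/-- The nodes `x_i = i Δx`. -/
def node (n i : ℕ) : ℝ := (i : ℝ) * mesh n

/-- The control volumes `V_i`, `i = 1, …, n`: half-open, except that the last one is closed. -/
def cell (n i : ℕ) : Set ℝ :=
  if i < n then Ico (node n (i - 1)) (node n i) else Icc (node n (i - 1)) (node n i)

/-- The mean value of `f` over `V_i`. -/
def cellMean (n i : ℕ) (f : ℝ → ℝ) : ℝ := (1 / mesh n) * ∫ x in cell n i, f x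

/-- The numerical flux at the node `x_i`, `1 ≤ i ≤ n - 1`, for the discrete values `V` (of `v`)
and `q` (of `p`). -/
def numFlux (n : ℕ) (b : ℝ → ℝ) (q V : ℕ → ℝ) (i : ℕ) : ℝ :=
  (V (i + 1) - V i) / mesh n + b ((V i + V (i + 1)) / 2) * q i

/-- The right-hand side of the `i`-th equation of the scheme, `i = 1, …, n`. -/
def schemeRHS (n : ℕ) (b : ℝ → ℝ) (q V : ℕ → ℝ) (i : ℕ) : ℝ :=
  if i = 1 then (1 / mesh n) * numFlux n b q V 1
  else if i < n then (1 / mesh n) * (numFlux n b q V i - numFlux n b q V (i - 1))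
  else -(1 / mesh n) * numFlux n b q V (n - 1)

/-- `V = (V_1, …, V_n)` (other indices are irrelevant) solves the Cauchy problem for the scheme
on `[0,T]`. As `p` is an a.e. class in `W^{1,2}(0,T; L²(0,1))`, its cell means `q i` are taken as
the continuous functions on `[0,T]` that they equal for a.e. `t`. -/
def IsSchemeSolution (n : ℕ) (T : ℝ) (h b : ℝ → ℝ) (p : ℝ × ℝ → ℝ) (v₀ : ℝ → ℝ)
    (V : ℕ → ℝ → ℝ) : Prop :=
  ∃ q : ℕ → ℝ → ℝ,
    (∀ i ∈ Finset.Icc 1 n, ContinuousOn (q i) (Icc 0 T) ∧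
      ∀ᵐ t ∂(volume.restrict (Ioo 0 T)), q i t = cellMean n i (fun x => p (t, x))) ∧
    (∀ i ∈ Finset.Icc 1 n, ∀ t ∈ Icc 0 T, ∃ d : ℝ,
      HasDerivWithinAt (V i) d (Icc 0 T) t ∧
        deriv h (V i t) * d = schemeRHS n b (fun j => q j t) (fun j => V j t) i) ∧
    (∀ i ∈ Finset.Icc 1 n, V i 0 = cellMean n i v₀)

/-- The piecewise constant approximate solution `v⁽ⁿ⁾(t,x) = ∑ χ_i(x) V_i(t)`. -/
def approx (n : ℕ) (V : ℕ → ℝ → ℝ) (z : ℝ × ℝ) : ℝ :=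
  ∑ i ∈ Finset.Icc 1 n, (cell n i).indicator (fun _ => V i z.1) z.2

/-- The difference quotient `ṽ⁽ⁿ⁾`: zero for `x < Δx`, and
`(v⁽ⁿ⁾(t,x) - v⁽ⁿ⁾(t,x-Δx)) / Δx` for `x ≥ Δx`. -/
def diffQuot (n : ℕ) (V : ℕ → ℝ → ℝ) (z : ℝ × ℝ) : ℝ :=
  if z.2 < mesh n then 0
  else (approx n V z - approx n V (z.1, z.2 - mesh n)) / mesh n

/-- The norm of `H_Δ = L²(Δx, 1)`, with values in `[0, ∞]`. -/
def normHΔ (n : ℕ) (f : ℝ → ℝ) : ℝ≥0∞ :=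
  eLpNorm f 2 (volume.restrict (Ioo (mesh n) 1))

end

end FVM

namespace FVM

open MeasureTheory Set
open scoped ContDiff ENNReal

/-! Let G be the time derivative of h(v). Because the flux ∂ₓv + b(v)p vanishes at x = 0, it equals
the space primitive of G. The scheme has the same form: the time derivative of h(v⁽ⁿ⁾) is a step
function in x, and its space primitive interpolates the numerical fluxes linearly and vanishes at 0
and 1. Put E = h(v) - h(v⁽ⁿ⁾), E₀ = E(0), Γ = ∂ₜE, e = v - v⁽ⁿ⁾, and let Φ be the space primitive of
Γ, that is, the flux error. Since e jumps at the nodes, a second error e' is used, in which v⁽ⁿ⁾ is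
replaced by the piecewise linear function whose derivative is the difference quotient; let η = ∂ₓe'.
`ErrorSystem` records that |e' - e| ≤ ρ and |Φ - η| ≤ K(|e| + ρ), where ρ is the consistency error
(`StrongData.errorSystem`).

The first estimate is of negative order. The time primitive W of Φ satisfies ∂ₜW = Φ and ∂ₓW = E -
E₀, and vanishes at x = 0, 1. Integration by parts in x therefore gives ½‖W(t)‖² = ∫∫ W(Φ - η) - ∫∫
(E - E₀)e' over (0,t) × (0,1). As h is strongly monotone, Ee ≥ c₁e², and Young and Grönwall bound ∫∫
e² by a multiple of ∫∫ ρ² + ‖E₀‖² (`ErrorSystem.exists_integral_sq_le`). This quantity is O(Δx).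
Most of ρ² contributes O(Δx²), but in the first cell the discrete gradient and the left flux are
zero while b(v)p need not be small: an error of order one on a strip of width Δx
(`SchemeBounds.integral_consErr_sq_le`).

The second ingredient is a bound of Γ in L², uniform in n. It follows by differentiating the
numerical fluxes in time and summing by parts (`discrete_energy`, `exists_schemeBounds`). The
identity ∂ₜE² = 2EΓ then controls ‖E(t)‖², and ∫∫ Φη = -∫∫ Γe' controls ∫∫ η². In both, a factor of
size O((Δx)^(1/2)) meets a factor that is merely bounded, whence the final rate
(`StrongData.exists_error_le`).

The constant must not depend on v, so strong solutions have to be unique; this is the first estimate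
once more, with ρ = 0 and E₀ = 0 (`StrongData.ae_eq`). All weak formulations are turned into
statements on primitives by the lemma of du Bois-Reymond in one and two variables
(`exists_const_add_primitive`, `exists_add_primT_of_tensor`). -/

/-- `F` is absolutely continuous on `[0, T]` with (almost everywhere) derivative `f`. -/
def IsPrim (T : ℝ) (F f : ℝ → ℝ) : Prop :=
  IntervalIntegrable f volume 0 T ∧ ∀ t ∈ Icc 0 T, F t = F 0 + ∫ s in (0)..t, f s

/-! ### Calculus of absolutely continuous functions. -/

namespace IsPrim

variable {T : ℝ} {F G f g : ℝ → ℝ}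

lemma intervalIntegrable_of_mem (hf : IsPrim T F f) {t : ℝ} (ht : t ∈ Icc 0 T) :
    IntervalIntegrable f volume 0 t :=
  hf.1.mono_set (by
    rw [uIcc_of_le ht.1, uIcc_of_le (ht.1.trans ht.2)]; exact Icc_subset_Icc_right ht.2)

lemma mono (hf : IsPrim T F f) {t : ℝ} (ht : t ∈ Icc 0 T) : IsPrim t F f :=
  ⟨hf.intervalIntegrable_of_mem ht, fun s hs => hf.2 s ⟨hs.1, hs.2.trans ht.2⟩⟩

lemma of_integral (hf : IntervalIntegrable f volume 0 T) (c : ℝ) :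
    IsPrim T (fun t => c + ∫ s in (0)..t, f s) f :=
  ⟨hf, fun t _ => by simp⟩

lemma continuousOn (hT : 0 ≤ T) (hf : IsPrim T F f) : ContinuousOn F (Icc 0 T) := by
  have h1 : ContinuousOn (fun t => F 0 + ∫ s in (0)..t, f s) (Icc 0 T) := by
    refine continuousOn_const.add ?_
    have := intervalIntegral.continuousOn_primitive_interval' hf.1 (a := 0) left_mem_uIcc
    rwa [uIcc_of_le hT] at this
  exact h1.congr hf.2

lemma congr (hT : 0 ≤ T) (hf : IsPrim T F f) (hF : ∀ t ∈ Icc 0 T, G t = F t) : IsPrim T G f :=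
  ⟨hf.1, fun t ht => by rw [hF t ht, hF 0 (left_mem_Icc.2 hT), hf.2 t ht]⟩

lemma congr_ae (hT : 0 ≤ T) (hf : IsPrim T F f)
    (hfg : f =ᵐ[volume.restrict (Ioo 0 T)] g) : IsPrim T F g := by
  have h1 : f =ᵐ[volume.restrict (Ioc 0 T)] g := by
    rwa [restrict_Ioo_eq_restrict_Ioc] at hfg
  refine ⟨?_, fun t ht => ?_⟩
  · rw [intervalIntegrable_iff_integrableOn_Ioc_of_le hT]
    exact ((intervalIntegrable_iff_integrableOn_Ioc_of_le hT).1 hf.1).congr h1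
  · rw [hf.2 t ht, intervalIntegral.integral_of_le ht.1, intervalIntegral.integral_of_le ht.1]
    congr 1
    exact integral_congr_ae
      (ae_restrict_of_ae_restrict_of_subset (Ioc_subset_Ioc_right ht.2) h1)

lemma add (hf : IsPrim T F f) (hg : IsPrim T G g) :
    IsPrim T (fun t => F t + G t) (fun t => f t + g t) :=
  ⟨hf.1.add hg.1, fun t ht => by
    rw [intervalIntegral.integral_add (hf.intervalIntegrable_of_mem ht)
      (hg.intervalIntegrable_of_mem ht)]
    beta_reduce
    linear_combination hf.2 t ht + hg.2 t ht⟩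

lemma const_mul (hf : IsPrim T F f) (c : ℝ) : IsPrim T (fun t => c * F t) (fun t => c * f t) :=
  ⟨hf.1.const_mul c, fun t ht => by
    rw [intervalIntegral.integral_const_mul]
    beta_reduce
    linear_combination c * hf.2 t ht⟩

lemma sub (hf : IsPrim T F f) (hg : IsPrim T G g) :
    IsPrim T (fun t => F t - G t) (fun t => f t - g t) :=
  ⟨hf.1.sub hg.1, fun t ht => by
    rw [intervalIntegral.integral_sub (hf.intervalIntegrable_of_mem ht)
      (hg.intervalIntegrable_of_mem ht)]
    beta_reduce
    linear_combination hf.2 t ht - hg.2 t ht⟩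

lemma sum {ι : Type*} (s : Finset ι) {F f : ι → ℝ → ℝ} (h : ∀ i ∈ s, IsPrim T (F i) (f i)) :
    IsPrim T (fun t => ∑ i ∈ s, F i t) (fun t => ∑ i ∈ s, f i t) := by
  classical
  induction s using Finset.induction_on with
  | empty => exact ⟨by simp, fun t _ => by simp⟩
  | insert a s ha ih =>
    simp only [Finset.sum_insert ha]
    exact (h a (by simp)).add (ih fun i hi => h i (by simp [hi]))

lemma intervalIntegrable_mul_left (hT : 0 ≤ T) (hf : IsPrim T F f)
    (hg : IntervalIntegrable g volume 0 T) :
    IntervalIntegrable (fun t => F t * g t) volume 0 T :=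
  hg.continuousOn_mul (by rw [uIcc_of_le hT]; exact hf.continuousOn hT)

lemma intervalIntegrable_mul_right (hT : 0 ≤ T) (hf : IsPrim T F f)
    (hg : IntervalIntegrable g volume 0 T) :
    IntervalIntegrable (fun t => g t * F t) volume 0 T :=
  hg.mul_continuousOn (by rw [uIcc_of_le hT]; exact hf.continuousOn hT)

/-- Integration by parts for the two indefinite integrals, with the constants `F 0` and `G 0` put
back. Treating only the end point is enough: `mul` reaches the other times by shrinking the
interval. -/
lemma integral_mul_aux (hT : 0 ≤ T) (hf : IsPrim T F f) (hg : IsPrim T G g) :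
    F T * G T = F 0 * G 0 + ∫ s in (0)..T, (f s * G s + F s * g s) := by
  have hF := (hf.1.absolutelyContinuousOnInterval_intervalIntegral (c := 0) left_mem_uIcc)
  have hG := (hg.1.absolutelyContinuousOnInterval_intervalIntegral (c := 0) left_mem_uIcc)
  have key := hF.integral_deriv_mul_eq_sub hG
  have e1 : ∫ x in (0)..T, (deriv (fun x => ∫ v in (0)..x, f v) x * (∫ v in (0)..x, g v)
      + (∫ v in (0)..x, f v) * deriv (fun x => ∫ v in (0)..x, g v) x)
      = ∫ s in (0)..T, ((f s * G s + F s * g s) - (G 0 * f s + F 0 * g s)) := by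
    apply intervalIntegral.integral_congr_ae
    filter_upwards [hf.1.ae_hasDerivAt_integral, hg.1.ae_hasDerivAt_integral] with x h1 h2 hx
    have hx' := uIoc_subset_uIcc hx
    rw [(h1 hx' 0 left_mem_uIcc).deriv, (h2 hx' 0 left_mem_uIcc).deriv]
    rw [uIcc_of_le hT] at hx'
    rw [hf.2 x hx', hg.2 x hx']; ring
  have i1 := (hg.intervalIntegrable_mul_right hT hf.1).add (hf.intervalIntegrable_mul_left hT hg.1)
  rw [e1, intervalIntegral.integral_sub i1 ((hf.1.const_mul _).add (hg.1.const_mul _)),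
    intervalIntegral.integral_add (hf.1.const_mul _) (hg.1.const_mul _),
    intervalIntegral.integral_const_mul, intervalIntegral.integral_const_mul] at key
  have hFT := hf.2 T (right_mem_Icc.2 hT)
  have hGT := hg.2 T (right_mem_Icc.2 hT)
  simp only [intervalIntegral.integral_same, mul_zero, sub_zero] at key
  have : (∫ s in (0)..T, f s) = F T - F 0 := by rw [hFT]; ring
  have h2 : (∫ s in (0)..T, g s) = G T - G 0 := by rw [hGT]; ring
  rw [this, h2] at key
  linear_combination -key

lemma mul (hT : 0 ≤ T) (hf : IsPrim T F f) (hg : IsPrim T G g) :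
    IsPrim T (fun t => F t * G t) (fun t => f t * G t + F t * g t) :=
  ⟨(hg.intervalIntegrable_mul_right hT hf.1).add (hf.intervalIntegrable_mul_left hT hg.1),
    fun _ ht => (hf.mono ht).integral_mul_aux ht.1 (hg.mono ht)⟩

lemma of_hasDerivWithinAt (hT : 0 ≤ T)
    (hd : ∀ t ∈ Icc 0 T, HasDerivWithinAt F (f t) (Icc 0 T) t) (hf : ContinuousOn f (Icc 0 T)) :
    IsPrim T F f := by
  have hi : IntervalIntegrable f volume 0 T :=
    ContinuousOn.intervalIntegrable (by rwa [uIcc_of_le hT])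
  refine ⟨hi, fun t ht => ?_⟩
  have := intervalIntegral.integral_eq_sub_of_hasDeriv_right_of_le (f := F) (f' := f) ht.1
    (fun s hs => ((hd s ⟨hs.1, hs.2.trans ht.2⟩).continuousWithinAt.mono
      (Icc_subset_Icc_right ht.2)))
    (fun s hs => ?_) (hi.mono_set (by
      rw [uIcc_of_le ht.1, uIcc_of_le hT]; exact Icc_subset_Icc_right ht.2))
  · rw [this]; ring
  · have hs' : s ∈ Ico 0 T := ⟨hs.1.le, hs.2.trans_le ht.2⟩
    exact ((hd s ⟨hs'.1, hs'.2.le⟩).hasDerivAt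
      (Icc_mem_nhds hs.1 hs'.2)).hasDerivWithinAt

end IsPrim

/-! ### Grönwall and Cauchy–Schwarz inequalities. -/

/-- Grönwall's inequality in integral form. -/
lemma integral_gronwall {T B C : ℝ} {y : ℝ → ℝ} (hB : 0 ≤ B) (hC : 0 ≤ C)
    (hy : IntervalIntegrable y volume 0 T)
    (h : ∀ t ∈ Icc 0 T, y t ≤ B + C * ∫ s in (0)..t, y s) {t : ℝ} (ht : t ∈ Icc 0 T) :
    y t ≤ B * (1 + C * T * Real.exp (C * T)) := by
  have hT : 0 ≤ T := ht.1.trans ht.2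
  set Y : ℝ → ℝ := fun t => 0 + ∫ s in (0)..t, y s with hY
  have p1 : IsPrim T Y y := IsPrim.of_integral hy 0
  have p2 : IsPrim T (fun t => Real.exp (-C * t)) (fun t => -C * Real.exp (-C * t)) := by
    refine IsPrim.of_hasDerivWithinAt hT (fun t _ => ?_) (by fun_prop)
    have := ((hasDerivAt_id t).const_mul (-C)).exp
    simpa [mul_comm] using this.hasDerivWithinAt
  have p3 := (p2.mul hT p1)
  have h1 := p3.2 t ht
  -- With Y the primitive of y, the derivative of exp(-Ct) Y is exp(-Ct)(y - CY) ≤ B almost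
  -- everywhere; continuity of y is not needed.
  have h2 : ∫ s in (0)..t, (-C * Real.exp (-C * s) * Y s + Real.exp (-C * s) * y s)
      ≤ ∫ s in (0)..t, B := by
    refine intervalIntegral.integral_mono_on ht.1 (p3.intervalIntegrable_of_mem ht) (by simp)
      fun s hs => ?_
    have h3 := h s ⟨hs.1, hs.2.trans ht.2⟩
    have h4 : Real.exp (-C * s) ≤ 1 := Real.exp_le_one_iff.2 (by nlinarith [hs.1])
    have h5 := Real.exp_pos (-C * s)
    have h6 : y s - C * Y s ≤ B := by simp only [hY, zero_add]; linarith
    nlinarith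
  simp only [hY, intervalIntegral.integral_same, mul_zero, zero_add,
    intervalIntegral.integral_const, sub_zero, smul_eq_mul] at h1 h2
  rw [← h1] at h2
  have h7 : (∫ s in (0)..t, y s) ≤ B * T * Real.exp (C * T) := by
    have e : (∫ s in (0)..t, y s)
        = Real.exp (C * t) * (Real.exp (-C * t) * ∫ s in (0)..t, y s) := by
      rw [← mul_assoc, ← Real.exp_add]; simp
    rw [e]
    have h8 : Real.exp (C * t) ≤ Real.exp (C * T) :=
      Real.exp_le_exp.2 (mul_le_mul_of_nonneg_left ht.2 hC)
    calc _ ≤ Real.exp (C * t) * (t * B) := by gcongr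
      _ ≤ Real.exp (C * T) * (T * B) :=
          mul_le_mul h8 (mul_le_mul_of_nonneg_right ht.2 hB) (mul_nonneg ht.1 hB)
            (Real.exp_pos _).le
      _ = _ := by ring
  calc y t ≤ B + C * ∫ s in (0)..t, y s := h t ht
    _ ≤ B + C * (B * T * Real.exp (C * T)) := by gcongr
    _ = _ := by ring

/-- Cauchy–Schwarz inequality for integrals, in squared form. -/
lemma sq_integral_mul_le {α : Type*} [MeasurableSpace α] {μ : Measure α} {f g : α → ℝ}
    (hf : MemLp f 2 μ) (hg : MemLp g 2 μ) :
    (∫ x, f x * g x ∂μ) ^ 2 ≤ (∫ x, f x ^ 2 ∂μ) * ∫ x, g x ^ 2 ∂μ := by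
  have i1 := hf.integrable_sq
  have i2 := hg.integrable_sq
  have i3 : Integrable (fun x => f x * g x) μ := hf.integrable_mul hg
  have key : ∀ s : ℝ, 0 ≤ (∫ x, f x ^ 2 ∂μ) * (s * s) + (2 * ∫ x, f x * g x ∂μ) * s
      + ∫ x, g x ^ 2 ∂μ := by
    intro s
    have : 0 ≤ ∫ x, (s * f x + g x) ^ 2 ∂μ := integral_nonneg fun x => sq_nonneg _
    have e : ∫ x, (s * f x + g x) ^ 2 ∂μ
        = ∫ x, ((s * s) * f x ^ 2 + (2 * s) * (f x * g x) + g x ^ 2) ∂μ :=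
      integral_congr_ae (ae_of_all _ fun x => by ring)
    rw [e, integral_add (f := fun x => (s * s) * f x ^ 2 + (2 * s) * (f x * g x))
        ((i1.const_mul _).add (i3.const_mul _)) i2,
      integral_add (i1.const_mul _) (i3.const_mul _), integral_const_mul,
      integral_const_mul] at this
    linarith
  have := discrim_le_zero key
  rw [discrim] at this
  nlinarith

lemma sq_integral_le {α : Type*} [MeasurableSpace α] {μ : Measure α} [IsFiniteMeasure μ]
    {f : α → ℝ} (hf : MemLp f 2 μ) :
    (∫ x, f x ∂μ) ^ 2 ≤ μ.real univ * ∫ x, f x ^ 2 ∂μ := by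
  have := sq_integral_mul_le (memLp_const (1 : ℝ)) hf
  simpa using this

/-! ### Test functions on an interval and the lemma of du Bois-Reymond. -/

/-- Lebesgue measure on `(0, a)`. -/
noncomputable abbrev volIoo (a : ℝ) : Measure ℝ := volume.restrict (Ioo 0 a)

lemma integral_volIoo {a : ℝ} (ha : 0 ≤ a) (f : ℝ → ℝ) :
    ∫ x, f x ∂volIoo a = ∫ x in (0)..a, f x := by
  rw [intervalIntegral.integral_of_le ha, volIoo, restrict_Ioo_eq_restrict_Ioc]

lemma intervalIntegrable_iff_volIoo {a : ℝ} (ha : 0 ≤ a) {f : ℝ → ℝ} :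
    IntervalIntegrable f volume 0 a ↔ Integrable f (volIoo a) := by
  rw [intervalIntegrable_iff_integrableOn_Ioc_of_le ha, IntegrableOn, volIoo,
    restrict_Ioo_eq_restrict_Ioc]

/-- Smooth test functions with compact support in `(0, a)`. -/
structure IsTest (a : ℝ) (θ : ℝ → ℝ) : Prop where
  contDiff : ContDiff ℝ ∞ θ
  hasCompactSupport : HasCompactSupport θ
  tsupport_subset : tsupport θ ⊆ Ioo 0 a

namespace IsTest

variable {a : ℝ} {θ : ℝ → ℝ}

lemma continuous (h : IsTest a θ) : Continuous θ := h.contDiff.continuous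

lemma eq_zero (h : IsTest a θ) {x : ℝ} (hx : x ∉ Ioo 0 a) : θ x = 0 :=
  image_eq_zero_of_notMem_tsupport fun hx' => hx (h.tsupport_subset hx')

lemma bounded (h : IsTest a θ) : ∃ C, ∀ x, ‖θ x‖ ≤ C :=
  h.hasCompactSupport.exists_bound_of_continuous h.continuous

lemma deriv_bounded (h : IsTest a θ) : ∃ C, ∀ x, ‖deriv θ x‖ ≤ C :=
  h.hasCompactSupport.deriv.exists_bound_of_continuous
    (h.contDiff.continuous_deriv (by simp))

lemma integrable_mul (h : IsTest a θ) {μ : Measure ℝ} {u : ℝ → ℝ} (hu : Integrable u μ) :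
    Integrable (fun x => u x * θ x) μ := by
  obtain ⟨C, hC⟩ := h.bounded
  exact hu.mul_bdd (c := C) h.continuous.aestronglyMeasurable (ae_of_all _ hC)

lemma integrable_mul_deriv (h : IsTest a θ) {μ : Measure ℝ} {u : ℝ → ℝ} (hu : Integrable u μ) :
    Integrable (fun x => u x * deriv θ x) μ := by
  obtain ⟨C, hC⟩ := h.deriv_bounded
  exact hu.mul_bdd (c := C) (h.contDiff.continuous_deriv (by simp)).aestronglyMeasurable
    (ae_of_all _ hC)

end IsTest

lemma exists_test {a : ℝ} (ha : 0 < a) : ∃ η, IsTest a η ∧ ∫ x, η x ∂volIoo a = 1 := by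
  let f : ContDiffBump (a / 2) := ⟨a / 8, a / 4, by positivity, by linarith⟩
  have hs : tsupport (f.normed volume) ⊆ Ioo 0 a := by
    rw [f.tsupport_normed_eq]
    intro x hx
    rw [Metric.mem_closedBall, Real.dist_eq, abs_le] at hx
    have h1 : f.rOut = a / 4 := rfl
    constructor <;> linarith [hx.1, hx.2]
  refine ⟨f.normed volume, ⟨f.contDiff_normed, f.hasCompactSupport_normed, hs⟩, ?_⟩
  rw [setIntegral_eq_integral_of_forall_compl_eq_zero, f.integral_normed]
  intro x hx
  exact image_eq_zero_of_notMem_tsupport fun hx' => hx (hs hx')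

/-- A test function of mean zero is the derivative of a test function. -/
lemma IsTest.exists_primitive {a : ℝ} {ζ : ℝ → ℝ} (hζ : IsTest a ζ)
    (h0 : ∫ x, ζ x ∂volIoo a = 0) : ∃ θ, IsTest a θ ∧ deriv θ = ζ := by
  have hd : ∀ t, HasDerivAt (fun t => ∫ s in (0)..t, ζ s) (ζ t) t := fun t =>
    hζ.continuous.integral_hasStrictDerivAt 0 t |>.hasDerivAt
  have hderiv : deriv (fun t => ∫ s in (0)..t, ζ s) = ζ := funext fun t => (hd t).deriv
  refine ⟨fun t => ∫ s in (0)..t, ζ s, ?_, hderiv⟩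
  have hc : ContDiff ℝ ∞ (fun t => ∫ s in (0)..t, ζ s) := by
    rw [contDiff_infty_iff_deriv, hderiv]
    exact ⟨fun t => (hd t).differentiableAt, hζ.contDiff⟩
  rcases (tsupport ζ).eq_empty_or_nonempty with he | hne
  · have hz : ζ = 0 := tsupport_eq_empty_iff.1 he
    have : (fun t : ℝ => ∫ s in (0)..t, ζ s) = 0 := by funext t; simp [hz]
    rw [this]
    exact ⟨contDiff_zero_fun, HasCompactSupport.zero, by simp [tsupport]⟩
  have hK : IsCompact (tsupport ζ) := hζ.hasCompactSupport
  obtain ⟨α, hα⟩ := hK.exists_isLeast hne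
  obtain ⟨β, hβ⟩ := hK.exists_isGreatest hne
  have hα' := hζ.tsupport_subset hα.1
  have hβ' := hζ.tsupport_subset hβ.1
  have hzero : ∀ x, x ∉ Icc α β → ζ x = 0 := fun x hx =>
    image_eq_zero_of_notMem_tsupport fun hx' => hx ⟨hα.2 hx', hβ.2 hx'⟩
  -- [α, β] spans the support of ζ. Left of α the primitive has collected nothing; right of β it has
  -- collected the whole integral, which is zero.
  have hsub : Function.support (fun t => ∫ s in (0)..t, ζ s) ⊆ Icc α β := by
    intro t ht
    by_contra hn
    apply ht
    rcases lt_or_ge t α with h1 | h1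
    · refine intervalIntegral.integral_zero_ae (ae_of_all _ fun s hs => hzero s fun hs' => ?_)
      have := uIoc_subset_uIcc hs
      have h2 : s ≤ max 0 t := this.2
      have h3 : max 0 t < α := max_lt hα'.1 h1
      linarith [hs'.1]
    · have h2 : β < t := by
        by_contra h3; exact hn ⟨h1, not_lt.1 h3⟩
      have ha : 0 ≤ a := (hα'.1.trans hα'.2).le
      rw [integral_volIoo ha] at h0
      have hadd := intervalIntegral.integral_add_adjacent_intervals
        (hζ.continuous.intervalIntegrable (μ := volume) 0 a)
        (hζ.continuous.intervalIntegrable (μ := volume) a t)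
      have hz : ∫ s in a..t, ζ s = 0 := by
        refine intervalIntegral.integral_zero_ae (ae_of_all _ fun s hs => hzero s fun hs' => ?_)
        have h3 : min a t < s := hs.1
        have h4 : β < min a t := lt_min hβ'.2 h2
        linarith [hs'.2]
      change ∫ s in (0)..t, ζ s = 0
      rw [← hadd, h0, hz, add_zero]
  have hts : tsupport (fun t => ∫ s in (0)..t, ζ s) ⊆ Icc α β :=
    closure_minimal hsub isClosed_Icc
  exact ⟨hc, HasCompactSupport.of_support_subset_isCompact isCompact_Icc hsub,
    hts.trans fun x hx => ⟨hα'.1.trans_le hx.1, hx.2.trans_lt hβ'.2⟩⟩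

lemma ae_eq_zero_of_forall_test {a : ℝ} {w : ℝ → ℝ} (hw : Integrable w (volIoo a))
    (h : ∀ χ, IsTest a χ → ∫ x, w x * χ x ∂volIoo a = 0) : ∀ᵐ x ∂volIoo a, w x = 0 := by
  have hi : IntegrableOn w (Ioo 0 a) := hw
  rw [ae_restrict_iff' measurableSet_Ioo]
  refine isOpen_Ioo.ae_eq_zero_of_integral_contDiff_smul_eq_zero
    hi.locallyIntegrableOn fun χ h1 h2 h3 => ?_
  rw [← h χ ⟨h1, h2, h3⟩, setIntegral_eq_integral_of_forall_compl_eq_zero]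
  · simp [mul_comm]
  · intro x hx
    rw [IsTest.eq_zero ⟨h1, h2, h3⟩ hx, mul_zero]

/-- The lemma of du Bois-Reymond: a function with a weak derivative on `(0, a)` is a primitive of
it. -/
lemma exists_const_add_primitive {a : ℝ} (ha : 0 < a) {u g : ℝ → ℝ}
    (hu : Integrable u (volIoo a)) (hg : Integrable g (volIoo a))
    (h : ∀ θ, IsTest a θ → ∫ x, u x * deriv θ x ∂volIoo a = -∫ x, g x * θ x ∂volIoo a) :
    ∃ c, ∀ᵐ x ∂volIoo a, u x = c + ∫ y in (0)..x, g y := by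
  have hg' : IntervalIntegrable g volume 0 a := (intervalIntegrable_iff_volIoo ha.le).2 hg
  have hP : IsPrim a (fun x => 0 + ∫ y in (0)..x, g y) g := IsPrim.of_integral hg' 0
  have hPi : Integrable (fun x => 0 + ∫ y in (0)..x, g y) (volIoo a) :=
    (intervalIntegrable_iff_volIoo ha.le).1 (ContinuousOn.intervalIntegrable (by
      rw [uIcc_of_le ha.le]; exact hP.continuousOn ha.le))
  set w : ℝ → ℝ := fun x => u x - (0 + ∫ y in (0)..x, g y) with hw
  have hwi : Integrable w (volIoo a) := hu.sub hPi
  have hw0 : ∀ θ, IsTest a θ → ∫ x, w x * deriv θ x ∂volIoo a = 0 := by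
    intro θ hθ
    have hp : IsPrim a θ (deriv θ) := IsPrim.of_hasDerivWithinAt ha.le
      (fun t _ => (hθ.contDiff.differentiable (by simp) t).hasDerivAt.hasDerivWithinAt)
      (hθ.contDiff.continuous_deriv (by simp)).continuousOn
    have h1 := (hP.mul ha.le hp).2 a (right_mem_Icc.2 ha.le)
    have z0 : θ 0 = 0 := hθ.eq_zero (by simp)
    have za : θ a = 0 := hθ.eq_zero (by simp)
    have i1 := hp.intervalIntegrable_mul_right ha.le hg'
    have i2 := hP.intervalIntegrable_mul_left ha.le hp.1
    rw [intervalIntegral.integral_add i1 i2, ← integral_volIoo ha.le,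
      ← integral_volIoo ha.le] at h1
    simp only [z0, za, mul_zero, zero_add] at h1
    have h2 := h θ hθ
    have : ∫ x, w x * deriv θ x ∂volIoo a = ∫ x, (u x * deriv θ x
        - (∫ y in (0)..x, g y) * deriv θ x) ∂volIoo a :=
      integral_congr_ae (ae_of_all _ fun x => by simp only [hw]; ring)
    rw [this, integral_sub (hθ.integrable_mul_deriv hu)
      (hθ.integrable_mul_deriv (by simpa using hPi)), h2]
    linarith
  obtain ⟨η, hη, hη1⟩ := exists_test ha
  refine ⟨∫ x, w x * η x ∂volIoo a, ?_⟩
  have key : ∀ᵐ x ∂volIoo a, w x - (∫ x, w x * η x ∂volIoo a) = 0 := by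
    refine ae_eq_zero_of_forall_test (hwi.sub (integrable_const _)) fun χ hχ => ?_
    set m := ∫ x, χ x ∂volIoo a with hm
    have iχ : Integrable χ (volIoo a) := by simpa using hχ.integrable_mul (integrable_const (1:ℝ))
    have iη : Integrable η (volIoo a) := by simpa using hη.integrable_mul (integrable_const (1:ℝ))
    -- Subtracting m η, where η has mass one, gives χ mean zero and so makes it the derivative of a
    -- test function, to which w is orthogonal. Hence ∫ wχ = m ∫ wη for every χ, so w is the
    -- constant ∫ wη.
    have hζ : IsTest a (fun x => χ x - m * η x) := by
      refine ⟨hχ.contDiff.sub (contDiff_const.mul hη.contDiff), ?_, ?_⟩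
      · exact hχ.hasCompactSupport.sub hη.hasCompactSupport.mul_left
      · have : tsupport (fun x => χ x - m * η x) ⊆ tsupport χ ∪ tsupport η := by
          refine closure_minimal (fun x hx => ?_)
            ((isClosed_tsupport _).union (isClosed_tsupport _))
          by_contra hn
          rw [mem_union, not_or] at hn
          apply hx
          simp [image_eq_zero_of_notMem_tsupport hn.1, image_eq_zero_of_notMem_tsupport hn.2]
        exact this.trans (union_subset hχ.tsupport_subset hη.tsupport_subset)
    obtain ⟨θ, hθ, hθ'⟩ := hζ.exists_primitive (by
      rw [integral_sub iχ (iη.const_mul m), integral_const_mul, hη1, ← hm]; ring)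
    have h1 := hw0 θ hθ
    rw [hθ'] at h1
    have h2 : ∫ x, w x * (χ x - m * η x) ∂volIoo a
        = ∫ x, (w x * χ x - m * (w x * η x)) ∂volIoo a :=
      integral_congr_ae (ae_of_all _ fun x => by ring)
    rw [h2, integral_sub (hχ.integrable_mul hwi) ((hη.integrable_mul hwi).const_mul m),
      integral_const_mul] at h1
    have h3 : ∫ x, (w x - ∫ x, w x * η x ∂volIoo a) * χ x ∂volIoo a
        = ∫ x, (w x * χ x - (∫ x, w x * η x ∂volIoo a) * χ x) ∂volIoo a :=
      integral_congr_ae (ae_of_all _ fun x => by ring)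
    rw [h3, integral_sub (hχ.integrable_mul hwi) (iχ.const_mul _), integral_const_mul, ← hm]
    linarith
  filter_upwards [key] with x hx
  simp only [hw] at hx ⊢
  linarith

/-! ### Primitives of functions of two variables -/

/-- The primitive of `g` in the first variable. -/
noncomputable def primT (g : ℝ × ℝ → ℝ) (z : ℝ × ℝ) : ℝ := ∫ s in (0)..z.1, g (s, z.2)

/-- The primitive of `g` in the second variable. -/
noncomputable def primX (g : ℝ × ℝ → ℝ) (z : ℝ × ℝ) : ℝ := ∫ y in (0)..z.2, g (z.1, y)

/-- Lebesgue measure on `(0, a) × (0, c)`. -/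
noncomputable abbrev volRect (a c : ℝ) : Measure (ℝ × ℝ) := (volIoo a).prod (volIoo c)

lemma volume_restrict_Q (T : ℝ) : volume.restrict (Q T) = volRect T 1 := by
  rw [Q, Measure.volume_eq_prod, volRect, Measure.prod_restrict]

lemma ae_volRect_swap {a c : ℝ} {P : ℝ × ℝ → Prop} (h : ∀ᵐ z ∂volRect a c, P z) :
    ∀ᵐ z ∂volRect c a, P z.swap := by
  rw [volRect, ← Measure.prod_swap] at h
  exact ae_of_ae_map measurable_swap.aemeasurable h

lemma ae_ae_fst {a c : ℝ} {P : ℝ × ℝ → Prop} (h : ∀ᵐ z ∂volRect a c, P z) :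
    ∀ᵐ t ∂volIoo a, ∀ᵐ x ∂volIoo c, P (t, x) := Measure.ae_ae_of_ae_prod h

lemma ae_ae_snd {a c : ℝ} {P : ℝ × ℝ → Prop} (h : ∀ᵐ z ∂volRect a c, P z) :
    ∀ᵐ x ∂volIoo c, ∀ᵐ t ∂volIoo a, P (t, x) :=
  Measure.ae_ae_of_ae_prod (ae_volRect_swap h)

lemma ae_of_fst {a c : ℝ} {P : ℝ → Prop} (h : ∀ᵐ t ∂volIoo a, P t) :
    ∀ᵐ z ∂volRect a c, P z.1 := Measure.quasiMeasurePreserving_fst.ae h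

lemma ae_of_snd {a c : ℝ} {P : ℝ → Prop} (h : ∀ᵐ t ∂volIoo c, P t) :
    ∀ᵐ z ∂volRect a c, P z.2 := Measure.quasiMeasurePreserving_snd.ae h

lemma ae_mem_Ioo (a : ℝ) : ∀ᵐ t ∂volIoo a, t ∈ Ioo 0 a := ae_restrict_mem measurableSet_Ioo

lemma volIoo_mono {a t : ℝ} (ht : t ≤ a) : volIoo t ≤ volIoo a :=
  Measure.restrict_mono (Ioo_subset_Ioo_right ht) le_rfl

lemma ae_volIoo_mono {a t : ℝ} (ht : t ≤ a) {P : ℝ → Prop} (h : ∀ᵐ s ∂volIoo a, P s) :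
    ∀ᵐ s ∂volIoo t, P s := ae_mono (volIoo_mono ht) h

lemma integral_primitive_congr {a : ℝ} {f g : ℝ → ℝ} (h : ∀ᵐ s ∂volIoo a, f s = g s)
    {t : ℝ} (ht : t ∈ Icc 0 a) : ∫ s in (0)..t, f s = ∫ s in (0)..t, g s := by
  rw [← integral_volIoo ht.1, ← integral_volIoo ht.1]
  exact integral_congr_ae (ae_volIoo_mono ht.2 h)

section

variable {a c : ℝ} {g : ℝ × ℝ → ℝ}

lemma primT_congr {g' : ℝ × ℝ → ℝ} (h : ∀ᵐ z ∂volRect a c, g z = g' z) :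
    ∀ᵐ x ∂volIoo c, ∀ t ∈ Icc 0 a, primT g (t, x) = primT g' (t, x) := by
  filter_upwards [ae_ae_snd h] with x hx t ht
  exact integral_primitive_congr hx ht

/-- The variable upper limit becomes the indicator of s < t under an integral over the fixed
interval (0, a), which depends measurably on the parameters. -/
lemma aestronglyMeasurable_primT (hg : AEStronglyMeasurable g (volRect a c)) :
    AEStronglyMeasurable (primT g) (volRect a c) := by
  obtain ⟨g', hg', he⟩ := hg
  have hm : StronglyMeasurable (fun z : ℝ × ℝ => ∫ s, (if s < z.1 then g' (s, z.2) else 0)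
      ∂volIoo a) := by
    refine StronglyMeasurable.integral_prod_right (f := fun (z : ℝ × ℝ) s =>
      if s < z.1 then g' (s, z.2) else 0)
      ?_
    refine StronglyMeasurable.ite (measurableSet_lt measurable_snd measurable_fst.fst) ?_
      stronglyMeasurable_const
    exact hg'.comp_measurable (measurable_snd.prodMk measurable_fst.snd)
  refine ⟨_, hm, ?_⟩
  filter_upwards [ae_of_snd (a := a) (primT_congr he), ae_of_fst (c := c) (ae_mem_Ioo a)]
    with z h1 h2
  rw [show primT g z = primT g (z.1, z.2) from rfl, h1 z.1 ⟨h2.1.le, h2.2.le⟩]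
  simp only [primT]
  rw [← integral_volIoo h2.1.le]
  have e : (fun s => if s < z.1 then g' (s, z.2) else 0)
      = (Iio z.1).indicator fun s => g' (s, z.2) := by
    funext s; simp [indicator]
  rw [e, integral_indicator measurableSet_Iio, volIoo, volIoo,
    Measure.restrict_restrict measurableSet_Iio]
  congr 2
  ext s; simp only [mem_Ioo, mem_inter_iff, mem_Iio]
  exact ⟨fun h => ⟨h.2, h.1, h.2.trans h2.2⟩, fun h => ⟨h.2.1, h.1⟩⟩

lemma integrable_slice_fst (hg : Integrable g (volRect a c)) :
    ∀ᵐ t ∂volIoo a, Integrable (fun x => g (t, x)) (volIoo c) := hg.prod_right_ae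

lemma integrable_slice_snd (hg : Integrable g (volRect a c)) :
    ∀ᵐ x ∂volIoo c, Integrable (fun t => g (t, x)) (volIoo a) := hg.prod_left_ae

lemma norm_integral_primitive_le {a : ℝ} {f : ℝ → ℝ} (hf : Integrable f (volIoo a)) {t : ℝ}
    (ht : t ∈ Icc 0 a) : |∫ s in (0)..t, f s| ≤ ∫ s, |f s| ∂volIoo a := by
  rw [← integral_volIoo ht.1]
  calc |∫ s, f s ∂volIoo t| ≤ ∫ s, |f s| ∂volIoo t := abs_integral_le_integral_abs
    _ ≤ _ := integral_mono_measure (volIoo_mono ht.2) (ae_of_all _ fun _ => abs_nonneg _) hf.abs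

lemma abs_primT_le (hg : Integrable g (volRect a c)) :
    ∀ᵐ x ∂volIoo c, ∀ t ∈ Icc 0 a, |primT g (t, x)| ≤ ∫ s, |g (s, x)| ∂volIoo a := by
  filter_upwards [integrable_slice_snd hg] with x hx t ht
  exact norm_integral_primitive_le hx ht

lemma abs_primX_le (hg : Integrable g (volRect a c)) :
    ∀ᵐ t ∂volIoo a, ∀ x ∈ Icc 0 c, |primX g (t, x)| ≤ ∫ s, |g (t, s)| ∂volIoo c := by
  filter_upwards [integrable_slice_fst hg] with x hx t ht
  exact norm_integral_primitive_le hx ht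

lemma aestronglyMeasurable_primX (hg : AEStronglyMeasurable g (volRect a c)) :
    AEStronglyMeasurable (primX g) (volRect a c) :=
  (aestronglyMeasurable_primT hg.prod_swap).prod_swap

lemma integrable_primT (hg : Integrable g (volRect a c)) :
    Integrable (primT g) (volRect a c) := by
  have h1 : Integrable (fun x => ∫ s, |g (s, x)| ∂volIoo a) (volIoo c) :=
    hg.abs.integral_prod_right
  refine Integrable.mono' (h1.comp_snd (volIoo a))
    (aestronglyMeasurable_primT hg.aestronglyMeasurable) ?_
  filter_upwards [ae_of_snd (a := a) (abs_primT_le hg), ae_of_fst (c := c) (ae_mem_Ioo a)]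
    with z h1 h2
  exact h1 z.1 ⟨h2.1.le, h2.2.le⟩

lemma integrable_primX (hg : Integrable g (volRect a c)) :
    Integrable (primX g) (volRect a c) := (integrable_primT hg.swap).swap

/-- Functions on a rectangle with vanishing integral over all measurable rectangles vanish. -/
lemma ae_eq_zero_of_forall_rect {w : ℝ × ℝ → ℝ} (hw : Integrable w (volRect a c))
    (h : ∀ A B : Set ℝ, MeasurableSet A → MeasurableSet B →
      ∫ z in A ×ˢ B, w z ∂volRect a c = 0) : ∀ᵐ z ∂volRect a c, w z = 0 := by
  refine hw.ae_eq_zero_of_forall_setIntegral_eq_zero fun s hs _ => ?_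
  induction s, hs using MeasurableSpace.induction_on_inter generateFrom_prod.symm
    isPiSystem_prod with
  | empty => simp
  | basic s hs =>
    obtain ⟨A, hA, B, hB, rfl⟩ := hs
    exact h A B hA hB
  | compl s hs ih =>
    have h1 := integral_add_compl hs hw
    have h2 := h univ univ MeasurableSet.univ MeasurableSet.univ
    rw [univ_prod_univ, Measure.restrict_univ] at h2
    rw [ih (measure_lt_top _ _), h2] at h1
    linarith
  | iUnion f hd hm ih =>
    rw [integral_iUnion hm hd hw.integrableOn]
    simp [ih _ (measure_lt_top _ _)]

/-- If `u` has the weak derivative `g` in the first variable (tested with tensor products), then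
`u` is, up to a function of the second variable, a primitive of `g`. -/
lemma exists_add_primT_of_tensor (ha : 0 < a) {u : ℝ × ℝ → ℝ}
    (hu : Integrable u (volRect a c)) (hg : Integrable g (volRect a c))
    (h : ∀ θ ψ, IsTest a θ → IsTest c ψ → ∫ z, u z * (deriv θ z.1 * ψ z.2) ∂volRect a c
      = -∫ z, g z * (θ z.1 * ψ z.2) ∂volRect a c) :
    ∃ P : ℝ → ℝ, Integrable P (volIoo c) ∧ ∀ᵐ z ∂volRect a c, u z = P z.2 + primT g z := by
  set w : ℝ × ℝ → ℝ := fun z => u z - primT g z with hw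
  have hwi : Integrable w (volRect a c) := hu.sub (integrable_primT hg)
  have bddψ : ∀ {v : ℝ × ℝ → ℝ}, Integrable v (volRect a c) → ∀ {ψ}, IsTest c ψ →
      Integrable (fun z => v z * ψ z.2) (volRect a c) := by
    intro v hv ψ hψ
    obtain ⟨C, hC⟩ := hψ.bounded
    exact hv.mul_bdd (c := C) (hψ.continuous.comp continuous_snd).aestronglyMeasurable
      (ae_of_all _ fun z => hC z.2)
  -- Pairing with ψ in the second variable leaves a function of t with a weak derivative, to which
  -- the one-dimensional lemma applies; so the pairing of w with ψ is constant in t.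
  have slice : ∀ ψ, IsTest c ψ → ∃ k, ∀ᵐ t ∂volIoo a, ∫ x, w (t, x) * ψ x ∂volIoo c = k := by
    intro ψ hψ
    have hgψ := bddψ hg hψ
    have huψ := bddψ hu hψ
    obtain ⟨k, hk⟩ := exists_const_add_primitive ha
      (u := fun t => ∫ x, u (t, x) * ψ x ∂volIoo c) (g := fun t => ∫ x, g (t, x) * ψ x ∂volIoo c)
      huψ.integral_prod_left hgψ.integral_prod_left fun θ hθ => by
        have h1 := h θ ψ hθ hψ
        obtain ⟨C, hC⟩ := hθ.deriv_bounded
        obtain ⟨C', hC'⟩ := hθ.bounded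
        have i1 : Integrable (fun z : ℝ × ℝ => (u z * ψ z.2) * deriv θ z.1) (volRect a c) :=
          huψ.mul_bdd (c := C) (((hθ.contDiff.continuous_deriv (by simp)).comp
            continuous_fst).aestronglyMeasurable) (ae_of_all _ fun z => hC z.1)
        have i2 : Integrable (fun z : ℝ × ℝ => (g z * ψ z.2) * θ z.1) (volRect a c) :=
          hgψ.mul_bdd (c := C') ((hθ.continuous.comp
            continuous_fst).aestronglyMeasurable) (ae_of_all _ fun z => hC' z.1)
        have e1 : ∫ z, u z * (deriv θ z.1 * ψ z.2) ∂volRect a c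
            = ∫ t, (∫ x, u (t, x) * ψ x ∂volIoo c) * deriv θ t ∂volIoo a := by
          simp_rw [← integral_mul_const]
          rw [← integral_prod _ i1]
          exact integral_congr_ae (ae_of_all _ fun z => by ring)
        have e2 : ∫ z, g z * (θ z.1 * ψ z.2) ∂volRect a c
            = ∫ t, (∫ x, g (t, x) * ψ x ∂volIoo c) * θ t ∂volIoo a := by
          simp_rw [← integral_mul_const]
          rw [← integral_prod _ i2]
          exact integral_congr_ae (ae_of_all _ fun z => by ring)
        rw [← e1, ← e2, h1]
    refine ⟨k, ?_⟩
    filter_upwards [hk, ae_mem_Ioo a, integrable_slice_fst huψ,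
      integrable_slice_fst (bddψ (integrable_primT hg) hψ)] with t h1 ht i1 i2
    have e : ∫ x, w (t, x) * ψ x ∂volIoo c
        = ∫ x, (u (t, x) * ψ x - primT g (t, x) * ψ x) ∂volIoo c :=
      integral_congr_ae (ae_of_all _ fun x => by simp only [hw]; ring)
    rw [e, integral_sub i1 i2, h1]
    have hle : volRect t c ≤ volRect a c := Measure.prod_mono (volIoo_mono ht.2.le) le_rfl
    have e2 : ∫ x, primT g (t, x) * ψ x ∂volIoo c
        = ∫ s in (0)..t, ∫ x, g (s, x) * ψ x ∂volIoo c := by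
      rw [← integral_volIoo ht.1.le, integral_integral_swap (hgψ.mono_measure hle)]
      refine integral_congr_ae (ae_of_all _ fun x => ?_)
      simp only [primT]
      rw [← integral_volIoo ht.1.le, integral_mul_const]
    rw [e2]; ring
  -- If w does not depend on t, it equals its time average.
  set P : ℝ → ℝ := fun x => a⁻¹ * ∫ s, w (s, x) ∂volIoo a with hP
  have hPi : Integrable P (volIoo c) := hwi.integral_prod_right.const_mul _
  refine ⟨P, hPi, ?_⟩
  have hPi2 : Integrable (fun z : ℝ × ℝ => P z.2) (volRect a c) := hPi.comp_snd _
  have key : ∀ᵐ z ∂volRect a c, w z - P z.2 = 0 := by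
    refine ae_eq_zero_of_forall_rect (hwi.sub hPi2) fun A B hA hB => ?_
    -- The null set of `slice` depends on ψ. Integrating over A before ψ is varied avoids a choice
    -- of countably many test functions.
    have hA0 : ∀ᵐ x ∂volIoo c, ∫ t in A, (w (t, x) - P x) ∂volIoo a = 0 := by
      have hiA : Integrable (fun z => w z - P z.2) (((volIoo a).restrict A).prod (volIoo c)) :=
        (hwi.sub hPi2).mono_measure (Measure.prod_mono Measure.restrict_le_self le_rfl)
      refine ae_eq_zero_of_forall_test hiA.integral_prod_right fun ψ hψ => ?_
      obtain ⟨k, hk⟩ := slice ψ hψ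
      have hwψ := bddψ hwi hψ
      have hAle : ((volIoo a).restrict A).prod (volIoo c) ≤ volRect a c :=
        Measure.prod_mono Measure.restrict_le_self le_rfl
      have e0 : ∫ x, P x * ψ x ∂volIoo c = k := by
        have : ∫ x, P x * ψ x ∂volIoo c
            = a⁻¹ * ∫ x, (∫ s, w (s, x) * ψ x ∂volIoo a) ∂volIoo c := by
          rw [← integral_const_mul]
          refine integral_congr_ae (ae_of_all _ fun x => ?_)
          simp only [hP]; rw [integral_mul_const]; ring
        rw [this, ← integral_integral_swap hwψ, integral_congr_ae hk]
        simp [ha.le, measureReal_def, ha.ne']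
      have hd := (hwψ.sub (bddψ hPi2 hψ)).mono_measure hAle
      have e1 : ∫ x, (∫ t in A, (w (t, x) - P x) ∂volIoo a) * ψ x ∂volIoo c
          = ∫ t in A, (∫ x, (w (t, x) * ψ x - P x * ψ x) ∂volIoo c) ∂volIoo a := by
        rw [integral_integral_swap hd]
        refine integral_congr_ae (ae_of_all _ fun x => ?_)
        simp only
        rw [← integral_mul_const]
        exact integral_congr_ae (ae_of_all _ fun t => by ring)
      rw [e1]
      refine integral_eq_zero_of_ae (ae_restrict_of_ae ?_)
      filter_upwards [hk, integrable_slice_fst hwψ] with t h1 h2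
      rw [integral_sub h2 (hψ.integrable_mul hPi), h1, e0]; simp
    rw [volRect, ← Measure.prod_restrict]
    have hAB : ((volIoo a).restrict A).prod ((volIoo c).restrict B) ≤ volRect a c :=
      Measure.prod_mono Measure.restrict_le_self Measure.restrict_le_self
    rw [integral_prod_symm (fun z => w z - P z.2) ((hwi.sub hPi2).mono_measure hAB)]
    refine integral_eq_zero_of_ae (ae_restrict_of_ae ?_)
    filter_upwards [hA0] with x hx
    simpa using hx
  filter_upwards [key] with z hz
  simp only [hw] at hz ⊢
  linarith

end

/-! ### Weak derivatives and primitives -/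

lemma tsupport_tensor_subset (θ ψ : ℝ → ℝ) :
    tsupport (fun z : ℝ × ℝ => θ z.1 * ψ z.2) ⊆ tsupport θ ×ˢ tsupport ψ := by
  refine closure_minimal (fun z hz => ?_) ((isClosed_tsupport _).prod (isClosed_tsupport _))
  have hz' : θ z.1 * ψ z.2 ≠ 0 := hz
  exact ⟨subset_tsupport _ (left_ne_zero_of_mul hz'), subset_tsupport _ (right_ne_zero_of_mul hz')⟩

lemma IsTest.contDiff_mul {a c : ℝ} {θ ψ : ℝ → ℝ} (hθ : IsTest a θ) (hψ : IsTest c ψ) :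
    ContDiff ℝ ∞ (fun z : ℝ × ℝ => θ z.1 * ψ z.2) :=
  (hθ.contDiff.comp contDiff_fst).mul (hψ.contDiff.comp contDiff_snd)

lemma IsTest.hasCompactSupport_mul {a c : ℝ} {θ ψ : ℝ → ℝ} (hθ : IsTest a θ) (hψ : IsTest c ψ) :
    HasCompactSupport (fun z : ℝ × ℝ => θ z.1 * ψ z.2) :=
  (hθ.hasCompactSupport.isCompact.prod hψ.hasCompactSupport.isCompact).of_isClosed_subset
    (isClosed_tsupport _) (tsupport_tensor_subset θ ψ)

lemma IsTest.hasFDerivAt_mul {a c : ℝ} {θ ψ : ℝ → ℝ} (hθ : IsTest a θ) (hψ : IsTest c ψ)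
    (z : ℝ × ℝ) : HasFDerivAt (fun z : ℝ × ℝ => θ z.1 * ψ z.2)
      (θ z.1 • (deriv ψ z.2 • ContinuousLinearMap.snd ℝ ℝ ℝ)
        + ψ z.2 • (deriv θ z.1 • ContinuousLinearMap.fst ℝ ℝ ℝ)) z := by
  have h1 : HasFDerivAt (fun z : ℝ × ℝ => θ z.1)
      (deriv θ z.1 • ContinuousLinearMap.fst ℝ ℝ ℝ) z :=
    HasDerivAt.comp_hasFDerivAt z ((hθ.contDiff.differentiable (by simp) z.1).hasDerivAt)
      hasFDerivAt_fst
  have h2 : HasFDerivAt (fun z : ℝ × ℝ => ψ z.2)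
      (deriv ψ z.2 • ContinuousLinearMap.snd ℝ ℝ ℝ) z :=
    HasDerivAt.comp_hasFDerivAt z ((hψ.contDiff.differentiable (by simp) z.2).hasDerivAt)
      hasFDerivAt_snd
  exact h1.mul h2

lemma IsWeakDt.exists_primT {T : ℝ} (hT : 0 < T) {u g : ℝ × ℝ → ℝ} (h : IsWeakDt T u g)
    (hu : MemL2H T u) (hg : MemL2H T g) :
    ∃ P : ℝ → ℝ, Integrable P (volIoo 1) ∧ ∀ᵐ z ∂volRect T 1, u z = P z.2 + primT g z := by
  rw [MemL2H, volume_restrict_Q] at hu hg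
  refine exists_add_primT_of_tensor hT (hu.integrable one_le_two) (hg.integrable one_le_two)
    fun θ ψ hθ hψ => ?_
  have := h.2.2 _ (hθ.contDiff_mul hψ) (hθ.hasCompactSupport_mul hψ)
    ((tsupport_tensor_subset θ ψ).trans (prod_mono hθ.tsupport_subset hψ.tsupport_subset))
  rw [volume_restrict_Q] at this
  rw [← this]
  refine integral_congr_ae (ae_of_all _ fun z => ?_)
  simp only [(hθ.hasFDerivAt_mul hψ z).fderiv]
  simp [mul_comm]

lemma IsWeakDx.exists_primX {T : ℝ} {u g : ℝ × ℝ → ℝ} (h : IsWeakDx T u g)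
    (hu : MemL2H T u) (hg : MemL2H T g) :
    ∃ P : ℝ → ℝ, Integrable P (volIoo T) ∧ ∀ᵐ z ∂volRect T 1, u z = P z.1 + primX g z := by
  rw [MemL2H, volume_restrict_Q] at hu hg
  obtain ⟨P, hP, hae⟩ := exists_add_primT_of_tensor (a := 1) (c := T)
    (u := fun z => u z.swap) (g := fun z => g z.swap) one_pos
    (hu.integrable one_le_two).swap (hg.integrable one_le_two).swap
    fun ψ θ hψ hθ => by
      have := h.2.2 _ (hθ.contDiff_mul hψ) (hθ.hasCompactSupport_mul hψ)
        ((tsupport_tensor_subset θ ψ).trans (prod_mono hθ.tsupport_subset hψ.tsupport_subset))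
      rw [volume_restrict_Q, volRect,
        ← integral_prod_swap (f := fun z => u z * fderiv ℝ (fun z => θ z.1 * ψ z.2) z (0, 1)),
        ← integral_prod_swap (f := fun z => g z * (θ z.1 * ψ z.2))] at this
      refine (integral_congr_ae (ae_of_all _ fun z => ?_)).trans (this.trans
        (congrArg Neg.neg (integral_congr_ae (ae_of_all _ fun z => ?_))))
      · simp only [(hθ.hasFDerivAt_mul hψ z.swap).fderiv]
        simp [mul_comm]
      · simp [mul_comm]
  exact ⟨P, hP, ae_volRect_swap hae⟩

lemma IsWeakDeriv.ae_unique {E : Type*} [NormedAddCommGroup E] [NormedSpace ℝ E]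
    [FiniteDimensional ℝ E] [MeasureSpace E] [BorelSpace E] {U : Set E} (hU : IsOpen U) {e : E}
    {u u' g g' : E → ℝ}
    (h : IsWeakDeriv U e u g) (h' : IsWeakDeriv U e u' g')
    (huu : ∀ᵐ z ∂volume.restrict U, u z = u' z) : ∀ᵐ z ∂volume.restrict U, g z = g' z := by
  have hmU : MeasurableSet U := hU.measurableSet
  have key : ∀ᵐ z, z ∈ U → g z - g' z = 0 := by
    refine hU.ae_eq_zero_of_integral_contDiff_smul_eq_zero (h.2.1.sub h'.2.1)
      fun φ h1 h2 h3 => ?_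
    have a1 := h.2.2 φ h1 h2 h3
    have a2 := h'.2.2 φ h1 h2 h3
    have hz : ∀ z, z ∉ U → φ z = 0 := fun z hz =>
      image_eq_zero_of_notMem_tsupport fun hz' => hz (h3 hz')
    -- Local integrability on U suffices here because φ lives on a compact subset of U.
    have int : ∀ {f : E → ℝ}, LocallyIntegrableOn f U volume →
        IntegrableOn (fun z => f z * φ z) U := by
      intro f hf
      have i1 : IntegrableOn f (tsupport φ) := hf.integrableOn_compact_subset h3 h2
      obtain ⟨C, hC⟩ := h2.exists_bound_of_continuous h1.continuous
      have i2 : IntegrableOn (fun z => f z * φ z) (tsupport φ) :=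
        i1.mul_bdd (c := C) h1.continuous.aestronglyMeasurable (ae_of_all _ hC)
      refine IntegrableOn.of_forall_sdiff_eq_zero i2 hmU fun z hz => ?_
      rw [image_eq_zero_of_notMem_tsupport hz.2, mul_zero]
    have eq : ∫ z, φ z • (g z - g' z) = ∫ z in U, (g z * φ z - g' z * φ z) := by
      rw [← setIntegral_eq_integral_of_forall_compl_eq_zero (s := U)]
      · exact integral_congr_ae (ae_of_all _ fun z => by simp only [smul_eq_mul]; ring)
      · intro z hz'; rw [hz z hz', zero_smul]
    change ∫ z, φ z • (g z - g' z) = 0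
    rw [eq, integral_sub (int h.2.1) (int h'.2.1)]
    have : ∫ z in U, u z * fderiv ℝ φ z e = ∫ z in U, u' z * fderiv ℝ φ z e :=
      integral_congr_ae (by filter_upwards [huu] with z hz; rw [hz])
    linarith
  rw [ae_restrict_iff' hmU]
  filter_upwards [key] with z hz hzU
  linarith [hz hzU]

lemma isOpen_Q (T : ℝ) : IsOpen (Q T) := isOpen_Ioo.prod isOpen_Ioo

lemma IsWeakDx.ae_unique {T : ℝ} {u u' g g' : ℝ × ℝ → ℝ} (h : IsWeakDx T u g)
    (h' : IsWeakDx T u' g') (huu : ∀ᵐ z ∂volRect T 1, u z = u' z) :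
    ∀ᵐ z ∂volRect T 1, g z = g' z := by
  rw [← volume_restrict_Q] at huu ⊢
  exact IsWeakDeriv.ae_unique (isOpen_Q T) h h' huu

lemma MemX.exists_primitive {u : ℝ → ℝ} (h : MemX u) :
    ∃ (c : ℝ) (g : ℝ → ℝ), MemLp g 2 (volIoo 1) ∧
      ∀ᵐ x ∂volIoo 1, u x = c + ∫ y in (0)..x, g y := by
  obtain ⟨hu, g, hw, hg⟩ := h
  obtain ⟨c, hc⟩ := exists_const_add_primitive one_pos (hu.integrable one_le_two)
    (hg.integrable one_le_two) fun θ hθ => by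
      simpa using hw.2.2 θ hθ.contDiff hθ.hasCompactSupport hθ.tsupport_subset
  exact ⟨c, g, hg, hc⟩

/-! ### Energy estimates for a flux equation with vanishing boundary flux -/

lemma volRect_mono {a c t : ℝ} (ht : t ≤ a) : volRect t c ≤ volRect a c :=
  Measure.prod_mono (volIoo_mono ht) le_rfl

lemma volRect_mono_snd {a c t : ℝ} (ht : t ≤ c) : volRect a t ≤ volRect a c :=
  Measure.prod_mono le_rfl (volIoo_mono ht)

lemma primT_primX_eq {T : ℝ} {Γ : ℝ × ℝ → ℝ} (hΓ : Integrable Γ (volRect T 1)) {s x : ℝ}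
    (hs : s ∈ Icc 0 T) (hx : x ∈ Icc (0 : ℝ) 1) :
    primT (primX Γ) (s, x) = ∫ y in (0)..x, primT Γ (s, y) := by
  simp only [primT, primX]
  simp_rw [← integral_volIoo hs.1, ← integral_volIoo hx.1]
  exact integral_integral_swap (f := fun r y => Γ (r, y))
    (hΓ.mono_measure ((volRect_mono hs.2).trans (volRect_mono_snd hx.2)))

/-- Fubini on (0, s) × (0, x) exchanges the two primitives. The result holds for every s and not
only almost every s, since the integration in time makes the slices integrable. -/
lemma isPrim_primT_primX {T : ℝ} {Γ : ℝ × ℝ → ℝ} (hΓ : Integrable Γ (volRect T 1)) {s : ℝ}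
    (hs : s ∈ Icc 0 T) :
    IsPrim 1 (fun x => primT (primX Γ) (s, x)) (fun x => primT Γ (s, x)) := by
  refine ⟨?_, fun x hx => ?_⟩
  · rw [intervalIntegrable_iff_volIoo zero_le_one]
    have := (hΓ.mono_measure (volRect_mono hs.2)).integral_prod_right
    simpa only [primT, integral_volIoo hs.1] using this
  · beta_reduce
    rw [primT_primX_eq hΓ hs hx, primT_primX_eq hΓ hs (left_mem_Icc.2 zero_le_one)]
    simp

/-- The relations satisfied by the error `e` of an approximation and its modification `e'` that is
absolutely continuous in space: `E` is the error of the conserved quantity, `Γ` its time derivative,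
`η` the space derivative of `e'` and `ρ` a consistency error. -/
structure ErrorSystem (T c₁ c₂ K : ℝ) (E Γ η e e' ρ : ℝ × ℝ → ℝ) (E₀ A : ℝ → ℝ) : Prop where
  memLp_Γ : MemLp Γ 2 (volRect T 1)
  memLp_η : MemLp η 2 (volRect T 1)
  memLp_e : MemLp e 2 (volRect T 1)
  memLp_e' : MemLp e' 2 (volRect T 1)
  memLp_ρ : MemLp ρ 2 (volRect T 1)
  memLp_E₀ : MemLp E₀ 2 (volIoo 1)
  E_eq : ∀ᵐ z ∂volRect T 1, E z = E₀ z.2 + primT Γ z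
  e'_eq : ∀ᵐ z ∂volRect T 1, e' z = A z.1 + primX η z
  flux_one : ∀ᵐ t ∂volIoo T, primX Γ (t, 1) = 0
  coercive : ∀ᵐ z ∂volRect T 1, c₁ * e z ^ 2 ≤ E z * e z
  E_le : ∀ᵐ z ∂volRect T 1, |E z| ≤ c₂ * |e z|
  e'_sub_le : ∀ᵐ z ∂volRect T 1, |e' z - e z| ≤ ρ z
  flux_sub_le : ∀ᵐ z ∂volRect T 1, |primX Γ z - η z| ≤ K * (|e z| + ρ z)

namespace ErrorSystem

variable {T c₁ c₂ K : ℝ} {E Γ η e e' ρ : ℝ × ℝ → ℝ} {E₀ A : ℝ → ℝ}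

lemma integrable_Γ (h : ErrorSystem T c₁ c₂ K E Γ η e e' ρ E₀ A) : Integrable Γ (volRect T 1) :=
  h.memLp_Γ.integrable one_le_two

lemma aestronglyMeasurable_E (h : ErrorSystem T c₁ c₂ K E Γ η e e' ρ E₀ A) :
    AEStronglyMeasurable E (volRect T 1) := by
  have h1 : Integrable (fun z : ℝ × ℝ => E₀ z.2) (volRect T 1) :=
    (h.memLp_E₀.integrable one_le_two).comp_snd _
  exact (h1.add (integrable_primT h.integrable_Γ)).aestronglyMeasurable.congr
    (h.E_eq.mono fun z hz => hz.symm)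

lemma memLp_E (h : ErrorSystem T c₁ c₂ K E Γ η e e' ρ E₀ A) : MemLp E 2 (volRect T 1) :=
  MemLp.of_le_mul h.memLp_e h.aestronglyMeasurable_E h.E_le

lemma memLp_E₀_snd (h : ErrorSystem T c₁ c₂ K E Γ η e e' ρ E₀ A) :
    MemLp (fun z : ℝ × ℝ => E₀ z.2) 2 (volRect T 1) := by
  have := h.memLp_E₀
  exact this.comp_snd _

/-- Lets the flux inherit square integrability from η, through the comparison `flux_sub_le`. -/
lemma memLp_flux_sub (h : ErrorSystem T c₁ c₂ K E Γ η e e' ρ E₀ A) :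
    MemLp (fun z => primX Γ z - η z) 2 (volRect T 1) := by
  refine MemLp.of_le_mul (g := fun z => |e z| + ρ z) (c := K) (h.memLp_e.abs.add h.memLp_ρ)
    ((integrable_primX h.integrable_Γ).aestronglyMeasurable.sub
      h.memLp_η.aestronglyMeasurable) ?_
  filter_upwards [h.flux_sub_le, h.e'_sub_le] with z h1 h2
  rw [Real.norm_eq_abs, Real.norm_eq_abs,
    abs_of_nonneg (add_nonneg (abs_nonneg _) ((abs_nonneg _).trans h2))]
  exact h1

lemma memLp_primX (h : ErrorSystem T c₁ c₂ K E Γ η e e' ρ E₀ A) :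
    MemLp (primX Γ) 2 (volRect T 1) := by
  refine (h.memLp_flux_sub.add h.memLp_η).ae_eq (ae_of_all _ fun z => ?_)
  simp

/-- The time integral of the flux is essentially bounded. -/
lemma abs_primT_primX_le (h : ErrorSystem T c₁ c₂ K E Γ η e e' ρ E₀ A) :
    ∃ M, ∀ᵐ z ∂volRect T 1, ‖primT (primX Γ) z‖ ≤ M := by
  have hi := h.integrable_Γ
  refine ⟨∫ t, ∫ x, |Γ (t, x)| ∂volIoo 1 ∂volIoo T, ?_⟩
  have h0 : ∀ᵐ z ∂volRect T 1, |primX Γ z| ≤ ∫ x, |Γ (z.1, x)| ∂volIoo 1 := by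
    filter_upwards [ae_of_fst (c := 1) (abs_primX_le hi), ae_of_snd (a := T) (ae_mem_Ioo 1)]
      with z h1 h2
    exact h1 z.2 ⟨h2.1.le, h2.2.le⟩
  filter_upwards [ae_of_snd (a := T) (abs_primT_le (integrable_primX hi)),
    ae_of_snd (a := T) (ae_ae_snd h0), ae_of_fst (c := 1) (ae_mem_Ioo T),
    ae_of_snd (a := T) (integrable_slice_snd (integrable_primX hi))] with z h1 h2 h3 h4
  refine (h1 z.1 ⟨h3.1.le, h3.2.le⟩).trans ?_
  exact integral_mono_ae h4.abs hi.abs.integral_prod_left h2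

lemma aestronglyMeasurable_W (h : ErrorSystem T c₁ c₂ K E Γ η e e' ρ E₀ A) :
    AEStronglyMeasurable (primT (primX Γ)) (volRect T 1) :=
  aestronglyMeasurable_primT (integrable_primX h.integrable_Γ).aestronglyMeasurable

lemma memLp_W (h : ErrorSystem T c₁ c₂ K E Γ η e e' ρ E₀ A) :
    MemLp (primT (primX Γ)) 2 (volRect T 1) := by
  obtain ⟨M, hM⟩ := h.abs_primT_primX_le
  exact MemLp.of_bound h.aestronglyMeasurable_W M hM

lemma isPrim_e' (h : ErrorSystem T c₁ c₂ K E Γ η e e' ρ E₀ A) :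
    ∀ᵐ s ∂volIoo T, IsPrim 1 (fun x => A s + primX η (s, x)) (fun x => η (s, x)) := by
  filter_upwards [integrable_slice_fst (h.memLp_η.integrable one_le_two)] with s hs
  exact IsPrim.of_integral ((intervalIntegrable_iff_volIoo zero_le_one).2 hs) _

/-- The integrand is ∂ₓ(W e') for the time-integrated flux W, which vanishes at x = 0 by definition
and at x = 1 by `flux_one`. -/
lemma slice_W (h : ErrorSystem T c₁ c₂ K E Γ η e e' ρ E₀ A) :
    ∀ᵐ s ∂volIoo T, ∫ x, (primT Γ (s, x) * e' (s, x) + primT (primX Γ) (s, x) * η (s, x))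
      ∂volIoo 1 = 0 := by
  filter_upwards [ae_mem_Ioo T, h.isPrim_e', ae_ae_fst h.e'_eq] with s hs h1 h2
  have hs' : s ∈ Icc 0 T := ⟨hs.1.le, hs.2.le⟩
  have h3 := ((isPrim_primT_primX h.integrable_Γ hs').mul zero_le_one h1).2 1
    (right_mem_Icc.2 zero_le_one)
  have w1 : primT (primX Γ) (s, 1) = 0 := by
    simp only [primT]
    rw [integral_primitive_congr h.flux_one hs']; simp
  have w0 : primT (primX Γ) (s, 0) = 0 := by simp [primT, primX]
  beta_reduce at h3
  rw [w1, w0, ← integral_volIoo zero_le_one] at h3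
  have : ∫ x, (primT Γ (s, x) * e' (s, x) + primT (primX Γ) (s, x) * η (s, x)) ∂volIoo 1
      = ∫ x, (primT Γ (s, x) * (A s + primX η (s, x)) + primT (primX Γ) (s, x) * η (s, x))
        ∂volIoo 1 :=
    integral_congr_ae (by filter_upwards [h2] with x hx; rw [hx])
  rw [this]; linarith

/-- The same integration by parts as in `slice_W`, for the flux itself in place of its time
integral; it is used for the gradient estimate. -/
lemma slice_flux (h : ErrorSystem T c₁ c₂ K E Γ η e e' ρ E₀ A) :
    ∀ᵐ s ∂volIoo T, ∫ x, (Γ (s, x) * e' (s, x) + primX Γ (s, x) * η (s, x)) ∂volIoo 1 = 0 := by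
  filter_upwards [h.isPrim_e', ae_ae_fst h.e'_eq, h.flux_one,
    integrable_slice_fst h.integrable_Γ] with s h1 h2 h4 h5
  have hp : IsPrim 1 (fun x => 0 + ∫ y in (0)..x, Γ (s, y)) (fun x => Γ (s, x)) :=
    IsPrim.of_integral ((intervalIntegrable_iff_volIoo zero_le_one).2 h5) _
  have h3 := (hp.mul zero_le_one h1).2 1 (right_mem_Icc.2 zero_le_one)
  have e1 : ∫ y in (0)..(1 : ℝ), Γ (s, y) = 0 := h4
  simp only [zero_add, intervalIntegral.integral_same, zero_mul, e1] at h3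
  have : ∫ x, (Γ (s, x) * e' (s, x) + primX Γ (s, x) * η (s, x)) ∂volIoo 1
      = ∫ x, (Γ (s, x) * (A s + primX η (s, x)) + (∫ y in (0)..x, Γ (s, y)) * η (s, x))
        ∂volIoo 1 :=
    integral_congr_ae (by filter_upwards [h2] with x hx; rw [hx]; rfl)
  rw [this, integral_volIoo zero_le_one, ← h3]

lemma integrable_primT_mul (h : ErrorSystem T c₁ c₂ K E Γ η e e' ρ E₀ A) :
    Integrable (fun z => primT Γ z * e' z) (volRect T 1) := by
  refine ((h.memLp_E.sub h.memLp_E₀_snd).integrable_mul h.memLp_e').congr ?_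
  filter_upwards [h.E_eq] with z hz
  simp [hz]

/-- Since ∂ₜW is the flux, ‖W(t)‖² is the integral of 2 W ∂ₜW. Subtracting twice the vanishing
integral of `slice_W` leaves the small difference between flux and η, and produces the product of E
- E₀ with e' that carries the coercivity. -/
lemma energy_identity (h : ErrorSystem T c₁ c₂ K E Γ η e e' ρ E₀ A) {t : ℝ}
    (ht : t ∈ Icc 0 T) :
    ∫ x, primT (primX Γ) (t, x) ^ 2 ∂volIoo 1
      = ∫ z, 2 * (primT (primX Γ) z * (primX Γ z - η z) - primT Γ z * e' z) ∂volRect t 1 := by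
  have hi := h.integrable_Γ
  have hle := volRect_mono (c := 1) ht.2
  have i1 : Integrable (fun z => primT (primX Γ) z * primX Γ z) (volRect T 1) :=
    h.memLp_W.integrable_mul h.memLp_primX
  have i2 : Integrable (fun z => primT (primX Γ) z * η z) (volRect T 1) :=
    h.memLp_W.integrable_mul h.memLp_η
  have e1 : ∫ x, primT (primX Γ) (t, x) ^ 2 ∂volIoo 1
      = ∫ x, ∫ s, 2 * (primT (primX Γ) (s, x) * primX Γ (s, x)) ∂volIoo t ∂volIoo 1 := by
    refine integral_congr_ae ?_
    filter_upwards [integrable_slice_snd (integrable_primX hi)] with x hx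
    have hp : IsPrim T (fun t => 0 + ∫ s in (0)..t, primX Γ (s, x)) (fun s => primX Γ (s, x)) :=
      IsPrim.of_integral ((intervalIntegrable_iff_volIoo (ht.1.trans ht.2)).2 hx) _
    have h3 := (hp.mul (ht.1.trans ht.2) hp).2 t ht
    simp only [zero_add, intervalIntegral.integral_same, zero_mul] at h3
    simp only [primT]
    rw [sq, h3, ← integral_volIoo ht.1]
    exact integral_congr_ae (ae_of_all _ fun s => by ring)
  rw [e1, ← integral_prod_symm (fun z => 2 * (primT (primX Γ) z * primX Γ z))
    ((i1.const_mul 2).mono_measure hle)]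
  have i3 := h.integrable_primT_mul
  have key : ∫ z, (primT Γ z * e' z + primT (primX Γ) z * η z) ∂volRect t 1 = 0 := by
    rw [integral_prod (fun z => primT Γ z * e' z + primT (primX Γ) z * η z)
      ((i3.add i2).mono_measure hle)]
    exact integral_eq_zero_of_ae (ae_volIoo_mono ht.2 h.slice_W)
  have i4 : Integrable (fun z => primT Γ z * e' z + primT (primX Γ) z * η z) (volRect t 1) :=
    (i3.add i2).mono_measure hle
  have e2 : ∫ z, 2 * (primT (primX Γ) z * (primX Γ z - η z) - primT Γ z * e' z) ∂volRect t 1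
      = ∫ z, (2 * (primT (primX Γ) z * primX Γ z)
        - 2 * (primT Γ z * e' z + primT (primX Γ) z * η z)) ∂volRect t 1 :=
    integral_congr_ae (ae_of_all _ fun z => by ring)
  rw [e2, integral_sub ((i1.const_mul 2).mono_measure hle) (i4.const_mul 2),
    integral_const_mul 2 (fun z => primT Γ z * e' z + primT (primX Γ) z * η z), key]
  ring

end ErrorSystem

/-- The pairing -2Ee provides -2c₁e². The error |e| occurs linearly in three products, with K|W|,
c₂r and |E₀|; Young's inequality with weight c₁/3 for each costs c₁e² in total, and -c₁e² remains.
-/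
lemma young_aux {c₁ c₂ K E e e' r W R E₀ : ℝ} (hc₁ : 0 < c₁)
    (h1 : c₁ * e ^ 2 ≤ E * e) (h2 : |E| ≤ c₂ * |e|) (h3 : |e' - e| ≤ r)
    (h4 : |R| ≤ K * (|e| + r)) :
    2 * (W * R - (E - E₀) * e') ≤ -c₁ * e ^ 2
      + (3 * (1 + K ^ 2 + c₂ ^ 2) / c₁ + 2 + K ^ 2) * (W ^ 2 + (r ^ 2 + E₀ ^ 2)) := by
  have hr : 0 ≤ r := (abs_nonneg _).trans h3
  have a1 : W * R ≤ |W| * (K * (|e| + r)) :=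
    (le_abs_self _).trans (by rw [abs_mul]; gcongr)
  have a2 : -(E * (e' - e)) ≤ c₂ * |e| * r := by
    refine (neg_le_abs _).trans ?_
    rw [abs_mul]
    exact mul_le_mul h2 h3 (abs_nonneg _) ((abs_nonneg _).trans h2)
  have a3 : E₀ * e' ≤ |E₀| * (|e| + r) := by
    refine (le_abs_self _).trans ?_
    rw [abs_mul]
    have : |e'| ≤ |e| + r := by
      have := abs_add_le (e' - e) e
      rw [sub_add_cancel] at this; linarith
    gcongr
  have young : ∀ x y : ℝ, 2 * (x * y) ≤ c₁ / 3 * x ^ 2 + 3 / c₁ * y ^ 2 := by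
    intro x y
    have h0 : 0 ≤ 3 / c₁ * (c₁ / 3 * x - y) ^ 2 := by positivity
    have : 3 / c₁ * (c₁ / 3 * x - y) ^ 2
        = c₁ / 3 * x ^ 2 - 2 * (x * y) + 3 / c₁ * y ^ 2 := by field_simp; ring
    linarith
  have b1 := young |e| (K * |W|)
  have b2 := young |e| (c₂ * r)
  have b3 := young |e| |E₀|
  have b4 := two_mul_le_add_sq (K * |W|) r
  have b5 := two_mul_le_add_sq |E₀| r
  rw [mul_pow, sq_abs, sq_abs] at b1
  rw [mul_pow, sq_abs] at b2
  rw [sq_abs, sq_abs] at b3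
  rw [mul_pow, sq_abs] at b4
  rw [sq_abs] at b5
  have c0 : 0 ≤ 3 / c₁ := by positivity
  have e1 : (3 * (1 + K ^ 2 + c₂ ^ 2) / c₁ + 2 + K ^ 2) * (W ^ 2 + (r ^ 2 + E₀ ^ 2))
      = 3 / c₁ * (K ^ 2 * W ^ 2) + 3 / c₁ * (c₂ ^ 2 * r ^ 2) + 3 / c₁ * E₀ ^ 2
        + K ^ 2 * W ^ 2 + 2 * r ^ 2 + E₀ ^ 2
        + (3 / c₁ * ((1 + c₂ ^ 2) * W ^ 2 + (1 + K ^ 2) * r ^ 2 + (K ^ 2 + c₂ ^ 2) * E₀ ^ 2)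
          + 2 * W ^ 2 + K ^ 2 * r ^ 2 + E₀ ^ 2 + K ^ 2 * E₀ ^ 2) := by ring
  have c1 : 0 ≤ 3 / c₁ * ((1 + c₂ ^ 2) * W ^ 2 + (1 + K ^ 2) * r ^ 2
      + (K ^ 2 + c₂ ^ 2) * E₀ ^ 2) + 2 * W ^ 2 + K ^ 2 * r ^ 2 + E₀ ^ 2 + K ^ 2 * E₀ ^ 2 := by
    positivity
  have e2 : 2 * (W * R - (E - E₀) * e')
      = 2 * (W * R) - 2 * (E * e) + 2 * (-(E * (e' - e))) + 2 * (E₀ * e') := by ring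
  rw [e1, e2]
  nlinarith

namespace ErrorSystem

/-- The error in `L²(Q(T))` is controlled by the consistency errors. -/
lemma exists_integral_sq_le {T c₁ : ℝ} (c₂ K : ℝ) (hT : 0 < T) (hc₁ : 0 < c₁) :
    ∃ M : ℝ, 0 ≤ M ∧ ∀ (E Γ η e e' ρ : ℝ × ℝ → ℝ) (E₀ A : ℝ → ℝ),
      ErrorSystem T c₁ c₂ K E Γ η e e' ρ E₀ A →
      ∫ z, e z ^ 2 ∂volRect T 1 ≤ M * ((∫ z, ρ z ^ 2 ∂volRect T 1) + ∫ x, E₀ x ^ 2 ∂volIoo 1) := by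
  set C := 3 * (1 + K ^ 2 + c₂ ^ 2) / c₁ + 2 + K ^ 2 with hC
  have hC0 : 0 ≤ C := by positivity
  refine ⟨c₁⁻¹ * (C * (C * (1 + C * T * Real.exp (C * T)) * T + 1)) * (1 + T), by positivity, ?_⟩
  intro E Γ η e e' ρ E₀ A h
  set B := ∫ z, (ρ z ^ 2 + E₀ z.2 ^ 2) ∂volRect T 1 with hB
  have iB : Integrable (fun z => ρ z ^ 2 + E₀ z.2 ^ 2) (volRect T 1) :=
    h.memLp_ρ.integrable_sq.add h.memLp_E₀_snd.integrable_sq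
  have hB0 : 0 ≤ B := integral_nonneg fun z => by positivity
  have iW := h.memLp_W.integrable_sq
  have ie := h.memLp_e.integrable_sq
  set y : ℝ → ℝ := fun t => ∫ x, primT (primX Γ) (t, x) ^ 2 ∂volIoo 1 with hy
  have hyi : IntervalIntegrable y volume 0 T :=
    (intervalIntegrable_iff_volIoo hT.le).2 iW.integral_prod_left
  have hpt : ∀ᵐ z ∂volRect T 1,
      2 * (primT (primX Γ) z * (primX Γ z - η z) - primT Γ z * e' z)
        ≤ -c₁ * e z ^ 2 + C * (primT (primX Γ) z ^ 2 + (ρ z ^ 2 + E₀ z.2 ^ 2)) := by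
    filter_upwards [h.E_eq, h.coercive, h.E_le, h.e'_sub_le, h.flux_sub_le] with z h0 h1 h2 h3 h4
    have e1 : primT Γ z = E z - E₀ z.2 := by rw [h0]; ring
    rw [e1]
    exact young_aux hc₁ h1 h2 h3 h4
  -- The pointwise bound is integrated up to time t. By the energy identity the left side becomes
  -- ‖W(t)‖², and the e² term is moved to the left.
  have main : ∀ t ∈ Icc 0 T, y t + c₁ * (∫ z, e z ^ 2 ∂volRect t 1)
      ≤ C * B + C * ∫ s in (0)..t, y s := by
    intro t ht
    have hle := volRect_mono (c := 1) ht.2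
    have i1 : Integrable (fun z => 2 * (primT (primX Γ) z * (primX Γ z - η z) - primT Γ z * e' z))
        (volRect t 1) :=
      (((h.memLp_W.integrable_mul h.memLp_flux_sub).sub h.integrable_primT_mul).const_mul
        2).mono_measure hle
    have j1 := ((ie.const_mul (-c₁)).mono_measure hle)
    have j2 := iW.mono_measure hle
    have j3 := iB.mono_measure hle
    have h1 := integral_mono_ae i1 (j1.add ((j2.add j3).const_mul C)) (ae_mono hle hpt)
    rw [← h.energy_identity ht, integral_add' j1 ((j2.add j3).const_mul C), integral_const_mul,
      integral_const_mul, integral_add' j2 j3] at h1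
    have h2 : ∫ z, (ρ z ^ 2 + E₀ z.2 ^ 2) ∂volRect t 1 ≤ B :=
      integral_mono_measure hle (ae_of_all _ fun z => by positivity) iB
    have h3 : ∫ z, primT (primX Γ) z ^ 2 ∂volRect t 1 = ∫ s in (0)..t, y s := by
      rw [← integral_volIoo ht.1, integral_prod _ j2]
    rw [h3] at h1
    have := mul_le_mul_of_nonneg_left h2 hC0
    simp only [hy] at h1 ⊢
    linarith
  have hgron : ∀ t ∈ Icc 0 T, y t ≤ C * B * (1 + C * T * Real.exp (C * T)) := fun t ht => by
    refine integral_gronwall (by positivity) hC0 hyi (fun s hs => ?_) ht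
    have h1 := main s hs
    have : 0 ≤ ∫ z, e z ^ 2 ∂volRect s 1 := integral_nonneg fun z => sq_nonneg _
    nlinarith
  have hT' := main T (right_mem_Icc.2 hT.le)
  have hyint : ∫ s in (0)..T, y s ≤ C * B * (1 + C * T * Real.exp (C * T)) * T := by
    have := intervalIntegral.integral_mono_on hT.le hyi
      (by simp : IntervalIntegrable (fun _ => C * B * (1 + C * T * Real.exp (C * T))) volume 0 T)
      hgron
    rw [intervalIntegral.integral_const, sub_zero, smul_eq_mul, mul_comm] at this
    exact this
  have hy0 : 0 ≤ y T := integral_nonneg fun x => sq_nonneg _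
  -- E₀ does not depend on time, so its integral over the cylinder carries a factor T; this is the
  -- origin of 1 + T in the constant.
  have hBeq : B = (∫ z, ρ z ^ 2 ∂volRect T 1) + T * ∫ x, E₀ x ^ 2 ∂volIoo 1 := by
    rw [hB, integral_add h.memLp_ρ.integrable_sq h.memLp_E₀_snd.integrable_sq]
    congr 1
    rw [integral_prod_symm _ h.memLp_E₀_snd.integrable_sq]
    simp [hT.le, integral_const_mul, measureReal_def]
  have hρ0 : 0 ≤ ∫ z, ρ z ^ 2 ∂volRect T 1 := integral_nonneg fun z => sq_nonneg _
  have hE0 : 0 ≤ ∫ x, E₀ x ^ 2 ∂volIoo 1 := integral_nonneg fun z => sq_nonneg _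
  have hB' : B ≤ (1 + T) * ((∫ z, ρ z ^ 2 ∂volRect T 1) + ∫ x, E₀ x ^ 2 ∂volIoo 1) := by
    rw [hBeq]; nlinarith
  have h5 : c₁ * (∫ z, e z ^ 2 ∂volRect T 1)
      ≤ C * (C * (1 + C * T * Real.exp (C * T)) * T + 1) * B := by
    have := mul_le_mul_of_nonneg_left hyint hC0
    nlinarith
  have h6 : ∫ z, e z ^ 2 ∂volRect T 1
      ≤ c₁⁻¹ * (C * (C * (1 + C * T * Real.exp (C * T)) * T + 1) * B) := by
    rw [inv_mul_eq_div, le_div_iff₀ hc₁]; linarith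
  refine h6.trans ?_
  calc _ = c₁⁻¹ * (C * (C * (1 + C * T * Real.exp (C * T)) * T + 1)) * B := by ring
    _ ≤ c₁⁻¹ * (C * (C * (1 + C * T * Real.exp (C * T)) * T + 1)) *
      ((1 + T) * ((∫ z, ρ z ^ 2 ∂volRect T 1) + ∫ x, E₀ x ^ 2 ∂volIoo 1)) := by gcongr
    _ = _ := by ring

end ErrorSystem

lemma abs_integral_mul_le_sqrt {α : Type*} [MeasurableSpace α] {μ : Measure α} {f g : α → ℝ}
    (hf : MemLp f 2 μ) (hg : MemLp g 2 μ) :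
    |∫ x, f x * g x ∂μ| ≤ √(∫ x, f x ^ 2 ∂μ) * √(∫ x, g x ^ 2 ∂μ) := by
  rw [← Real.sqrt_mul (integral_nonneg fun x => sq_nonneg _), ← Real.sqrt_sq_eq_abs]
  exact Real.sqrt_le_sqrt (sq_integral_mul_le hf hg)

namespace ErrorSystem

variable {T c₁ c₂ K : ℝ} {E Γ η e e' ρ : ℝ × ℝ → ℝ} {E₀ A : ℝ → ℝ}

lemma integral_e'_sq_le (h : ErrorSystem T c₁ c₂ K E Γ η e e' ρ E₀ A) :
    ∫ z, e' z ^ 2 ∂volRect T 1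
      ≤ 2 * ((∫ z, e z ^ 2 ∂volRect T 1) + ∫ z, ρ z ^ 2 ∂volRect T 1) := by
  have i1 := h.memLp_e.integrable_sq
  have i2 := h.memLp_ρ.integrable_sq
  rw [← integral_add i1 i2, ← integral_const_mul]
  refine integral_mono_ae h.memLp_e'.integrable_sq ((i1.add i2).const_mul 2) ?_
  filter_upwards [h.e'_sub_le] with z hz
  have h1 : (e' z - e z) ^ 2 ≤ ρ z ^ 2 := by
    rw [← sq_abs (e' z - e z)]; gcongr
  change e' z ^ 2 ≤ 2 * (e z ^ 2 + ρ z ^ 2)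
  nlinarith [sq_nonneg (e' z - 2 * e z)]

/-- The gradient error is controlled by the error in `L²(Q(T))`. -/
lemma integral_η_sq_le (h : ErrorSystem T c₁ c₂ K E Γ η e e' ρ E₀ A) :
    ∫ z, η z ^ 2 ∂volRect T 1
      ≤ 2 * (√(2 * ((∫ z, e z ^ 2 ∂volRect T 1) + ∫ z, ρ z ^ 2 ∂volRect T 1))
          * √(∫ z, Γ z ^ 2 ∂volRect T 1))
        + 2 * K ^ 2 * ((∫ z, e z ^ 2 ∂volRect T 1) + ∫ z, ρ z ^ 2 ∂volRect T 1) := by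
  have i1 := h.memLp_e.integrable_sq
  have i2 := h.memLp_ρ.integrable_sq
  have i3 : Integrable (fun z => Γ z * e' z) (volRect T 1) := h.memLp_Γ.integrable_mul h.memLp_e'
  have i4 : Integrable (fun z => primX Γ z * η z) (volRect T 1) :=
    h.memLp_primX.integrable_mul h.memLp_η
  have key : ∫ z, (Γ z * e' z + primX Γ z * η z) ∂volRect T 1 = 0 := by
    rw [integral_prod (fun z => Γ z * e' z + primX Γ z * η z) (i3.add i4)]
    exact integral_eq_zero_of_ae h.slice_flux
  rw [integral_add i3 i4] at key
  -- Expanding (Φ - η)² for the flux Φ and dropping Φ² gives η² ≤ 2Φη + (Φ - η)². The first term is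
  -- then converted by `key`.
  have hpt : ∫ z, η z ^ 2 ∂volRect T 1
      ≤ ∫ z, (2 * (primX Γ z * η z) + 2 * K ^ 2 * (e z ^ 2 + ρ z ^ 2)) ∂volRect T 1 := by
    refine integral_mono_ae h.memLp_η.integrable_sq
      ((i4.const_mul 2).add ((i1.add i2).const_mul _)) ?_
    filter_upwards [h.flux_sub_le] with z hz
    have h1 : (primX Γ z - η z) ^ 2 ≤ (K * (|e z| + ρ z)) ^ 2 := by
      rw [← sq_abs (primX Γ z - η z)]; gcongr
    have h2 : (|e z| + ρ z) ^ 2 ≤ 2 * (e z ^ 2 + ρ z ^ 2) := by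
      rw [← sq_abs (e z)]; nlinarith [sq_nonneg (|e z| - ρ z)]
    have h3 := mul_le_mul_of_nonneg_left h2 (sq_nonneg K)
    rw [mul_pow] at h1
    change η z ^ 2 ≤ 2 * (primX Γ z * η z) + 2 * K ^ 2 * (e z ^ 2 + ρ z ^ 2)
    nlinarith [sq_nonneg (primX Γ z)]
  have i5 : Integrable (fun z => 2 * K ^ 2 * (e z ^ 2 + ρ z ^ 2)) (volRect T 1) :=
    (i1.add i2).const_mul _
  rw [integral_add (i4.const_mul 2) i5, integral_const_mul,
    integral_const_mul, integral_add i1 i2] at hpt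
  have hcs := abs_integral_mul_le_sqrt h.memLp_e' h.memLp_Γ
  have hcomm : ∫ z, e' z * Γ z ∂volRect T 1 = ∫ z, Γ z * e' z ∂volRect T 1 := by
    simp_rw [mul_comm]
  rw [hcomm] at hcs
  have h4 : √(∫ z, e' z ^ 2 ∂volRect T 1) * √(∫ z, Γ z ^ 2 ∂volRect T 1)
      ≤ √(2 * ((∫ z, e z ^ 2 ∂volRect T 1) + ∫ z, ρ z ^ 2 ∂volRect T 1))
          * √(∫ z, Γ z ^ 2 ∂volRect T 1) :=
    mul_le_mul_of_nonneg_right (Real.sqrt_le_sqrt h.integral_e'_sq_le) (Real.sqrt_nonneg _)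
  linarith [neg_le_abs (∫ z, Γ z * e' z ∂volRect T 1)]

/-- The error of the conserved quantity at fixed times is controlled by its error in
`L²(Q(T))`. -/
lemma ae_integral_E_sq_le (h : ErrorSystem T c₁ c₂ K E Γ η e e' ρ E₀ A) :
    ∀ᵐ t ∂volIoo T, ∫ x, E (t, x) ^ 2 ∂volIoo 1 ≤ (∫ x, E₀ x ^ 2 ∂volIoo 1)
      + 2 * (√(∫ z, E z ^ 2 ∂volRect T 1) * √(∫ z, Γ z ^ 2 ∂volRect T 1)) := by
  have i1 : Integrable (fun z => |E z| * |Γ z|) (volRect T 1) :=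
    h.memLp_E.abs.integrable_mul h.memLp_Γ.abs
  -- For almost every x the map t ↦ E(t, x) has an absolutely continuous version, and the derivative
  -- of its square is 2EΓ. The bound holds for all t outside one null set of x.
  have hx : ∀ᵐ x ∂volIoo 1, ∀ t ∈ Icc 0 T, (E₀ x + primT Γ (t, x)) ^ 2
      ≤ E₀ x ^ 2 + 2 * ∫ s, |E (s, x)| * |Γ (s, x)| ∂volIoo T := by
    filter_upwards [integrable_slice_snd h.integrable_Γ, ae_ae_snd h.E_eq,
      integrable_slice_snd i1] with x h1 h2 h3 t ht
    have hT := ht.1.trans ht.2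
    have hp : IsPrim T (fun t => E₀ x + ∫ s in (0)..t, Γ (s, x)) (fun s => Γ (s, x)) :=
      IsPrim.of_integral ((intervalIntegrable_iff_volIoo hT).2 h1) _
    have h4 := (hp.mul hT hp).2 t ht
    simp only [intervalIntegral.integral_same, add_zero] at h4
    have h5 : (E₀ x + primT Γ (t, x)) ^ 2 = E₀ x * E₀ x + ∫ s in (0)..t,
        (Γ (s, x) * (E₀ x + ∫ r in (0)..s, Γ (r, x))
          + (E₀ x + ∫ r in (0)..s, Γ (r, x)) * Γ (s, x)) := by
      rw [← h4, sq]; rfl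
    have h6 : ∫ s in (0)..t, (Γ (s, x) * (E₀ x + ∫ r in (0)..s, Γ (r, x))
          + (E₀ x + ∫ r in (0)..s, Γ (r, x)) * Γ (s, x))
        = ∫ s in (0)..t, 2 * (E (s, x) * Γ (s, x)) := by
      refine integral_primitive_congr ?_ ht
      filter_upwards [h2] with s hs
      rw [hs]; simp only [primT]; ring
    have h7 : ∫ s in (0)..t, 2 * (E (s, x) * Γ (s, x))
        ≤ 2 * ∫ s, |E (s, x)| * |Γ (s, x)| ∂volIoo T := by
      rw [intervalIntegral.integral_const_mul]
      have i5 : Integrable (fun s => E (s, x) * Γ (s, x)) (volIoo T) := by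
        refine h3.mono' ?_ (ae_of_all _ fun s => by simp)
        have : AEStronglyMeasurable (fun s => E (s, x)) (volIoo T) := by
          have hc : AEStronglyMeasurable (fun t => E₀ x + ∫ s in (0)..t, Γ (s, x)) (volIoo T) :=
            ((hp.continuousOn hT).mono Ioo_subset_Icc_self).aestronglyMeasurable measurableSet_Ioo
          refine hc.congr ?_
          filter_upwards [h2] with s hs
          rw [hs]; rfl
        exact this.mul h1.aestronglyMeasurable
      have := (le_abs_self _).trans (norm_integral_primitive_le i5 ht)
      simp only [abs_mul] at this
      linarith
    rw [h5, h6, ← sq]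
    linarith
  filter_upwards [ae_mem_Ioo T, ae_ae_fst h.E_eq,
    integrable_slice_fst h.memLp_E.integrable_sq] with t ht h1 h2
  have i2 : Integrable (fun x => ∫ s, |E (s, x)| * |Γ (s, x)| ∂volIoo T) (volIoo 1) :=
    i1.integral_prod_right
  have h3 : ∫ x, E (t, x) ^ 2 ∂volIoo 1
      ≤ ∫ x, (E₀ x ^ 2 + 2 * ∫ s, |E (s, x)| * |Γ (s, x)| ∂volIoo T) ∂volIoo 1 := by
    refine integral_mono_ae h2 (h.memLp_E₀.integrable_sq.add (i2.const_mul 2)) ?_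
    filter_upwards [h1, hx] with x hx1 hx2
    have := hx2 t ⟨ht.1.le, ht.2.le⟩
    rw [hx1]; exact this
  rw [integral_add h.memLp_E₀.integrable_sq (i2.const_mul 2), integral_const_mul,
    ← integral_prod_symm (fun z => |E z| * |Γ z|) i1] at h3
  have h4 := (le_abs_self _).trans (abs_integral_mul_le_sqrt h.memLp_E.abs h.memLp_Γ.abs)
  simp only [Pi.abs_apply, sq_abs] at h4
  linarith

end ErrorSystem

/-! ### The mesh -/

section mesh

variable {n : ℕ}

lemma mesh_pos (hn : 0 < n) : 0 < mesh n := by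
  have : (0 : ℝ) < n := by exact_mod_cast hn
  exact one_div_pos.2 this

lemma mesh_le_one (hn : 0 < n) : mesh n ≤ 1 := by
  have : (1 : ℝ) ≤ n := by exact_mod_cast hn
  exact (div_le_one (by linarith)).2 this

lemma mul_mesh (hn : 0 < n) : (n : ℝ) * mesh n = 1 := by
  have : (n : ℝ) ≠ 0 := by exact_mod_cast hn.ne'
  rw [mesh]; field_simp

@[simp] lemma node_zero : node n 0 = 0 := by simp [node]

lemma node_self (hn : 0 < n) : node n n = 1 := mul_mesh hn

lemma node_succ (k : ℕ) : node n (k + 1) = node n k + mesh n := by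
  simp only [node]; push_cast; ring

lemma node_mono : Monotone (node n) := fun i j hij => by
  have h1 : (i : ℝ) ≤ j := by exact_mod_cast hij
  have h2 : 0 ≤ mesh n := by simp [mesh]
  exact mul_le_mul_of_nonneg_right h1 h2

lemma node_nonneg (k : ℕ) : 0 ≤ node n k := by
  simpa using node_mono (n := n) (Nat.zero_le k)

lemma node_le_one (hn : 0 < n) {k : ℕ} (hk : k ≤ n) : node n k ≤ 1 :=
  (node_mono hk).trans (node_self hn).le

/-- The index `k` such that `x` lies in the cell with left end point `node n k`. -/
noncomputable def cellIdx (n : ℕ) (x : ℝ) : ℕ := ⌊x * n⌋₊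

lemma measurable_cellIdx (n : ℕ) : Measurable (cellIdx n) :=
  Nat.measurable_floor.comp (measurable_id.mul_const _)

lemma cellIdx_eq_iff (hn : 0 < n) {x : ℝ} (hx : 0 ≤ x) {k : ℕ} :
    cellIdx n x = k ↔ x ∈ Ico (node n k) (node n (k + 1)) := by
  have hn' : (0 : ℝ) < n := by exact_mod_cast hn
  rw [cellIdx, Nat.floor_eq_iff (by positivity), mem_Ico, node, node, mesh]
  push_cast
  rw [mul_one_div, mul_one_div, div_le_iff₀ hn', lt_div_iff₀ hn']

lemma mem_Ico_cellIdx (hn : 0 < n) {x : ℝ} (hx : 0 ≤ x) :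
    x ∈ Ico (node n (cellIdx n x)) (node n (cellIdx n x + 1)) :=
  (cellIdx_eq_iff hn hx).1 rfl

lemma cellIdx_lt (hn : 0 < n) {x : ℝ} (hx : x ∈ Ioo (0 : ℝ) 1) : cellIdx n x < n := by
  by_contra h
  have h1 := (mem_Ico_cellIdx hn hx.1.le).1
  have h2 := node_mono (n := n) (not_lt.1 h)
  rw [node_self hn] at h2
  linarith [hx.2]

/-- The last cell is closed at 1, hence `x < 1`. The indices are shifted by one: the cell with left
end point `node n k` carries the number k + 1. -/
lemma mem_cell_iff {x : ℝ} (hx : x < 1) (hn : 0 < n) {k : ℕ} (hk : k < n) :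
    x ∈ cell n (k + 1) ↔ x ∈ Ico (node n k) (node n (k + 1)) := by
  rw [cell, Nat.add_sub_cancel]
  split_ifs with h
  · rfl
  · have : k + 1 = n := by omega
    rw [this, node_self hn]
    exact ⟨fun h => ⟨h.1, hx⟩, fun h => ⟨h.1, h.2.le⟩⟩

lemma approx_eq (hn : 0 < n) (V : ℕ → ℝ → ℝ) {z : ℝ × ℝ} (hz0 : 0 ≤ z.2) (hz1 : z.2 < 1) :
    approx n V z = V (cellIdx n z.2 + 1) z.1 := by
  have hlt : cellIdx n z.2 < n := by
    by_contra h
    have h1 := (mem_Ico_cellIdx hn hz0).1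
    have h2 := node_mono (n := n) (not_lt.1 h)
    rw [node_self hn] at h2
    linarith
  rw [approx, Finset.sum_eq_single (cellIdx n z.2 + 1)]
  · rw [indicator_of_mem]
    exact (mem_cell_iff hz1 hn hlt).2 (mem_Ico_cellIdx hn hz0)
  · intro i hi hne
    rw [Finset.mem_Icc] at hi
    obtain ⟨k, rfl⟩ : ∃ k, i = k + 1 := ⟨i - 1, by omega⟩
    refine indicator_of_notMem (fun hm => hne ?_) _
    rw [(cellIdx_eq_iff hn hz0).2 ((mem_cell_iff hz1 hn (by omega)).1 hm)]
  · intro h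
    exact absurd (Finset.mem_Icc.2 ⟨by omega, by omega⟩) h

/-- A shift by one mesh width moves a point exactly one cell to the left, and x < Δx describes the
first cell. -/
lemma diffQuot_eq (hn : 0 < n) (V : ℕ → ℝ → ℝ) {z : ℝ × ℝ} (hz : z.2 ∈ Ioo (0 : ℝ) 1) :
    diffQuot n V z = if cellIdx n z.2 = 0 then 0 else
      (V (cellIdx n z.2 + 1) z.1 - V (cellIdx n z.2) z.1) / mesh n := by
  have h0 : cellIdx n z.2 = 0 ↔ z.2 < mesh n := by
    rw [cellIdx_eq_iff hn hz.1.le, node_succ]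
    simp [hz.1.le]
  rw [diffQuot]
  by_cases h : z.2 < mesh n
  · rw [if_pos h, if_pos (h0.2 h)]
  · rw [if_neg h, if_neg (mt h0.1 h), approx_eq hn V hz.1.le hz.2,
      approx_eq hn V (z := (z.1, z.2 - mesh n)) (by simpa using h)
        (by have := mesh_pos hn; change z.2 - mesh n < 1; linarith [hz.2])]
    obtain ⟨k, hk⟩ := Nat.exists_eq_succ_of_ne_zero (mt h0.1 h)
    have h1 : cellIdx n (z.2 - mesh n) = k := by
      rw [cellIdx_eq_iff hn (by linarith)]
      have h2 := (cellIdx_eq_iff hn hz.1.le).1 hk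
      rw [Nat.succ_eq_add_one, node_succ (k + 1), node_succ k] at h2
      rw [node_succ]
      constructor <;> linarith [h2.1, h2.2]
    simp only
    rw [h1, hk]

lemma integral_eq_sum_cells (hn : 0 < n) {f : ℝ → ℝ} (hf : Integrable f (volIoo 1)) :
    ∫ x, f x ∂volIoo 1
      = ∑ k ∈ Finset.range n, ∫ x in (node n k)..(node n (k + 1)), f x := by
  have hi := (intervalIntegrable_iff_volIoo zero_le_one).2 hf
  rw [intervalIntegral.sum_integral_adjacent_intervals, node_zero, node_self hn,
    integral_volIoo zero_le_one]
  intro k hk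
  refine hi.mono_set ?_
  rw [uIcc_of_le (node_mono (Nat.le_succ k)), uIcc_of_le zero_le_one]
  exact Icc_subset_Icc (node_nonneg k) (node_le_one hn hk)

lemma integral_cells (hn : 0 < n) (F : ℕ → ℝ → ℝ)
    (hF : Integrable (fun x => F (cellIdx n x) x) (volIoo 1)) :
    ∫ x, F (cellIdx n x) x ∂volIoo 1
      = ∑ k ∈ Finset.range n, ∫ x in (node n k)..(node n (k + 1)), F k x := by
  rw [integral_eq_sum_cells hn hF]
  refine Finset.sum_congr rfl fun k _ => ?_
  rw [intervalIntegral.integral_of_le (node_mono (Nat.le_succ k)),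
    intervalIntegral.integral_of_le (node_mono (Nat.le_succ k)), ← restrict_Ioo_eq_restrict_Ioc]
  refine integral_congr_ae ?_
  filter_upwards [ae_restrict_mem measurableSet_Ioo] with x hx
  have : cellIdx n x = k :=
    (cellIdx_eq_iff hn ((node_nonneg k).trans hx.1.le)).2 ⟨hx.1.le, hx.2⟩
  rw [this]

lemma integrable_step (hn : 0 < n) (c : ℕ → ℝ) :
    Integrable (fun x => c (cellIdx n x)) (volIoo 1) := by
  refine Integrable.of_bound
    (Measurable.aestronglyMeasurable ((measurable_of_countable c).comp (measurable_cellIdx n)))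
    (∑ k ∈ Finset.range n, |c k|) ?_
  filter_upwards [ae_mem_Ioo 1] with x hx
  exact Finset.single_le_sum (f := fun k => |c k|) (fun _ _ => abs_nonneg _)
    (Finset.mem_range.2 (cellIdx_lt hn hx))

lemma integral_step (hn : 0 < n) (c : ℕ → ℝ) :
    ∫ x, c (cellIdx n x) ∂volIoo 1 = mesh n * ∑ k ∈ Finset.range n, c k := by
  rw [integral_cells hn (fun k _ => c k) (integrable_step hn c), Finset.mul_sum]
  refine Finset.sum_congr rfl fun k _ => ?_
  rw [intervalIntegral.integral_const, node_succ]
  simp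

lemma cellMean_eq {k : ℕ} (f : ℝ → ℝ) :
    cellMean n (k + 1) f = (1 / mesh n) * ∫ x in (node n k)..(node n (k + 1)), f x := by
  rw [cellMean, intervalIntegral.integral_of_le (node_mono (Nat.le_succ k))]
  congr 2
  rw [cell, Nat.add_sub_cancel]
  split_ifs
  · exact restrict_Ico_eq_restrict_Ioc
  · exact restrict_Ioc_eq_restrict_Icc.symm

lemma ae_of_volIoo_one (hn : 0 < n) {P : ℝ → Prop} (h : ∀ᵐ x ∂volIoo 1, P x) {k : ℕ}
    (hk : k < n) : ∀ᵐ x, x ∈ uIoc (node n k) (node n (k + 1)) → P x := by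
  rw [volIoo, restrict_Ioo_eq_restrict_Ioc, ae_restrict_iff' measurableSet_Ioc] at h
  filter_upwards [h] with x hx hx'
  rw [uIoc_of_le (node_mono (Nat.le_succ k))] at hx'
  exact hx ⟨(node_nonneg k).trans_lt hx'.1, hx'.2.trans (node_le_one hn hk)⟩

lemma cellMean_congr (hn : 0 < n) {f g : ℝ → ℝ} (h : ∀ᵐ x ∂volIoo 1, f x = g x) {k : ℕ}
    (hk : k < n) : cellMean n (k + 1) f = cellMean n (k + 1) g := by
  rw [cellMean_eq, cellMean_eq, intervalIntegral.integral_congr_ae (ae_of_volIoo_one hn h hk)]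

lemma abs_cellMean_le (hn : 0 < n) {f : ℝ → ℝ} {M : ℝ} (h : ∀ᵐ x ∂volIoo 1, |f x| ≤ M) {k : ℕ}
    (hk : k < n) : |cellMean n (k + 1) f| ≤ M := by
  have hm := mesh_pos hn
  have := intervalIntegral.norm_integral_le_of_norm_le_const_ae (f := f) (C := M)
    (ae_of_volIoo_one hn h hk)
  rw [Real.norm_eq_abs, node_succ, add_sub_cancel_left, abs_of_pos hm, ← node_succ] at this
  rw [cellMean_eq, abs_mul, abs_of_pos (one_div_pos.2 hm), one_div, inv_mul_le_iff₀ hm]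
  linarith

end mesh

/-! ### Cell means of absolutely continuous functions -/

section means

variable {f g : ℝ → ℝ}

lemma IsPrim.intervalIntegrable_sub (h : IsPrim 1 f g) {α β : ℝ} (hα : 0 ≤ α) (hαβ : α ≤ β)
    (hβ : β ≤ 1) : IntervalIntegrable g volume α β :=
  h.1.mono_set (by
    rw [uIcc_of_le hαβ, uIcc_of_le zero_le_one]; exact Icc_subset_Icc hα hβ)

lemma IsPrim.abs_sub_le (h : IsPrim 1 f g) {α β : ℝ} (hα : 0 ≤ α) (hαβ : α ≤ β)
    (hβ : β ≤ 1) {x y : ℝ} (hx : x ∈ Icc α β) (hy : y ∈ Icc α β) :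
    |f x - f y| ≤ ∫ s in α..β, |g s| := by
  have hx' : x ∈ Icc (0 : ℝ) 1 := ⟨hα.trans hx.1, hx.2.trans hβ⟩
  have hy' : y ∈ Icc (0 : ℝ) 1 := ⟨hα.trans hy.1, hy.2.trans hβ⟩
  have e : f x - f y = ∫ s in y..x, g s := by
    rw [h.2 x hx', h.2 y hy', ← intervalIntegral.integral_interval_sub_left
      (h.intervalIntegrable_of_mem hx') (h.intervalIntegrable_of_mem hy')]
    ring
  rw [e]
  refine (intervalIntegral.norm_integral_le_integral_norm_uIoc (f := g) (μ := volume)).trans ?_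
  rw [intervalIntegral.integral_of_le hαβ]
  refine setIntegral_mono_set ?_ (ae_of_all _ fun _ => abs_nonneg _) (LE.le.eventuallyLE ?_)
  · exact (h.intervalIntegrable_sub hα hαβ hβ).abs.1
  · intro s hs
    rw [uIoc, mem_Ioc] at hs
    exact ⟨(le_min hy.1 hx.1).trans_lt hs.1, hs.2.trans (max_le hy.2 hx.2)⟩

lemma abs_sub_cellMean_le_of {n : ℕ} (hn : 0 < n) {k : ℕ} {B m : ℝ}
    (hf : IntervalIntegrable f volume (node n k) (node n (k + 1)))
    (h : ∀ x ∈ Icc (node n k) (node n (k + 1)), |m - f x| ≤ B) :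
    |m - cellMean n (k + 1) f| ≤ B := by
  have hm := mesh_pos hn
  have e : m - cellMean n (k + 1) f
      = (1 / mesh n) * ∫ x in (node n k)..(node n (k + 1)), (m - f x) := by
    rw [cellMean_eq, intervalIntegral.integral_sub (by simp) hf, intervalIntegral.integral_const,
      node_succ, smul_eq_mul]
    field_simp
    ring
  have h1 : |∫ x in (node n k)..(node n (k + 1)), (m - f x)| ≤ B * mesh n := by
    have := intervalIntegral.norm_integral_le_of_norm_le_const (f := fun x => m - f x) (C := B)
      (a := node n k) (b := node n (k + 1)) fun x hx => by
        rw [uIoc_of_le (node_mono (Nat.le_succ k))] at hx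
        exact h x ⟨hx.1.le, hx.2⟩
    rwa [Real.norm_eq_abs, node_succ, add_sub_cancel_left, abs_of_pos hm, ← node_succ] at this
  rw [e, abs_mul, abs_of_pos (one_div_pos.2 hm), one_div, inv_mul_le_iff₀ hm]
  linarith

lemma sq_integral_abs_le {α β : ℝ} (hαβ : α ≤ β) (hg : MemLp g 2 (volume.restrict (Ioc α β))) :
    (∫ s in α..β, |g s|) ^ 2 ≤ (β - α) * ∫ s in α..β, g s ^ 2 := by
  rw [intervalIntegral.integral_of_le hαβ, intervalIntegral.integral_of_le hαβ]
  have := sq_integral_le hg.abs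
  simpa [measureReal_def, hαβ] using this

lemma MemLp.restrict_sub_one {α β : ℝ} (hg : MemLp g 2 (volIoo 1)) (hα : 0 ≤ α)
    (hβ : β ≤ 1) : MemLp g 2 (volume.restrict (Ioc α β)) := by
  rw [volIoo, restrict_Ioo_eq_restrict_Ioc] at hg
  exact hg.mono_measure (Measure.restrict_mono (Ioc_subset_Ioc hα hβ) le_rfl)

variable {n : ℕ}

/-- The integral of `g ^ 2` over the cell with left end point `node n k`. -/
noncomputable def cellSq (n : ℕ) (g : ℝ → ℝ) (k : ℕ) : ℝ :=
  ∫ s in (node n k)..(node n (k + 1)), g s ^ 2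

lemma cellSq_nonneg (k : ℕ) : 0 ≤ cellSq n g k :=
  intervalIntegral.integral_nonneg (node_mono (Nat.le_succ k)) fun _ _ => sq_nonneg _

lemma sum_cellSq (hn : 0 < n) (hg : MemLp g 2 (volIoo 1)) :
    ∑ k ∈ Finset.range n, cellSq n g k = ∫ x, g x ^ 2 ∂volIoo 1 :=
  (integral_eq_sum_cells hn hg.integrable_sq).symm

lemma sq_integral_abs_cell_le (hn : 0 < n) (hg : MemLp g 2 (volIoo 1)) {k : ℕ} (hk : k < n) :
    (∫ s in (node n k)..(node n (k + 1)), |g s|) ^ 2 ≤ mesh n * cellSq n g k := by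
  have := sq_integral_abs_le (node_mono (n := n) (Nat.le_succ k))
    (MemLp.restrict_sub_one hg (node_nonneg k) (node_le_one hn hk))
  rwa [Nat.succ_eq_add_one, node_succ, add_sub_cancel_left, ← node_succ] at this

lemma sq_integral_abs_two_cells_le (hn : 0 < n) (hg : MemLp g 2 (volIoo 1)) {k : ℕ}
    (hk : k + 1 < n) : (∫ s in (node n k)..(node n (k + 2)), |g s|) ^ 2
      ≤ 2 * mesh n * (cellSq n g k + cellSq n g (k + 1)) := by
  have h1 := sq_integral_abs_le (node_mono (n := n) (Nat.le_add_right k 2))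
    (MemLp.restrict_sub_one hg (node_nonneg k) (node_le_one hn hk))
  have h2 : node n (k + 2) - node n k = 2 * mesh n := by
    rw [node_succ (k + 1), node_succ k]; ring
  rw [h2] at h1
  have hi := (intervalIntegrable_iff_volIoo zero_le_one).2 hg.integrable_sq
  have hi' : ∀ j < n, IntervalIntegrable (fun s => g s ^ 2) volume (node n j) (node n (j + 1)) := by
    intro j hj
    refine hi.mono_set ?_
    rw [uIcc_of_le (node_mono (Nat.le_succ j)), uIcc_of_le zero_le_one]
    exact Icc_subset_Icc (node_nonneg j) (node_le_one hn hj)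
  rwa [← intervalIntegral.integral_add_adjacent_intervals (hi' k (by omega)) (hi' (k + 1) hk)]
    at h1

lemma IsPrim.intervalIntegrable_cell (h : IsPrim 1 f g) (hn : 0 < n) {k : ℕ} (hk : k < n) :
    IntervalIntegrable f volume (node n k) (node n (k + 1)) := by
  refine ContinuousOn.intervalIntegrable ((h.continuousOn zero_le_one).mono ?_)
  rw [uIcc_of_le (node_mono (Nat.le_succ k))]
  exact Icc_subset_Icc (node_nonneg k) (node_le_one hn hk)

/-- The oscillation over a cell is at most ∫|g|, whose square Cauchy–Schwarz bounds by the cell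
length times ∫g². -/
lemma IsPrim.sq_sub_cellMean_le (h : IsPrim 1 f g) (hg : MemLp g 2 (volIoo 1)) (hn : 0 < n)
    {k : ℕ} (hk : k < n) {x : ℝ} (hx : x ∈ Icc (node n k) (node n (k + 1))) :
    (f x - cellMean n (k + 1) f) ^ 2 ≤ mesh n * cellSq n g k := by
  refine le_trans ?_ (sq_integral_abs_cell_le hn hg hk)
  rw [← sq_abs]
  refine pow_le_pow_left₀ (abs_nonneg _) (abs_sub_cellMean_le_of hn
    (h.intervalIntegrable_cell hn hk) fun y hy => ?_) 2
  exact h.abs_sub_le (node_nonneg k) (node_mono (Nat.le_succ k)) (node_le_one hn hk) hx hy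

/-- The flux at a node uses the mean of p over the cell to its left, while the exact flux is
evaluated on the cell to its right; two adjacent cells are involved. -/
lemma IsPrim.sq_sub_cellMean_prev_le (h : IsPrim 1 f g) (hg : MemLp g 2 (volIoo 1)) (hn : 0 < n)
    {k : ℕ} (hk : k + 1 < n) {x : ℝ} (hx : x ∈ Icc (node n (k + 1)) (node n (k + 2))) :
    (f x - cellMean n (k + 1) f) ^ 2
      ≤ 2 * mesh n * (cellSq n g k + cellSq n g (k + 1)) := by
  refine le_trans ?_ (sq_integral_abs_two_cells_le hn hg hk)
  rw [← sq_abs]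
  refine pow_le_pow_left₀ (abs_nonneg _) (abs_sub_cellMean_le_of hn
    (h.intervalIntegrable_cell hn (by omega)) fun y hy => ?_) 2
  exact h.abs_sub_le (node_nonneg k) (node_mono (by omega)) (node_le_one hn hk)
    ⟨(node_mono (by omega)).trans hx.1, hx.2⟩ ⟨hy.1, hy.2.trans (node_mono (by omega))⟩

lemma IsPrim.sq_cellMean_sub_cellMean_le (h : IsPrim 1 f g) (hg : MemLp g 2 (volIoo 1))
    (hn : 0 < n) {k : ℕ} (hk : k + 1 < n) :
    (cellMean n (k + 2) f - cellMean n (k + 1) f) ^ 2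
      ≤ 2 * mesh n * (cellSq n g k + cellSq n g (k + 1)) := by
  refine le_trans ?_ (sq_integral_abs_two_cells_le hn hg hk)
  rw [← sq_abs, abs_sub_comm]
  refine pow_le_pow_left₀ (abs_nonneg _) (abs_sub_cellMean_le_of hn
    (h.intervalIntegrable_cell hn hk) fun x hx => ?_) 2
  rw [abs_sub_comm]
  refine abs_sub_cellMean_le_of hn (h.intervalIntegrable_cell hn (by omega)) fun y hy => ?_
  exact h.abs_sub_le (node_nonneg k) (node_mono (by omega)) (node_le_one hn hk)
    ⟨(node_mono (by omega)).trans hx.1, hx.2⟩ ⟨hy.1, hy.2.trans (node_mono (by omega))⟩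

/-- Each cell belongs to at most two pairs of neighbours. -/
lemma sum_cellSq_add_le (hn : 0 < n) (hg : MemLp g 2 (volIoo 1)) :
    ∑ k ∈ Finset.range (n - 1), (cellSq n g k + cellSq n g (k + 1))
      ≤ 2 * ∫ x, g x ^ 2 ∂volIoo 1 := by
  obtain ⟨m, rfl⟩ : ∃ m, n = m + 1 := ⟨n - 1, by omega⟩
  rw [Nat.add_sub_cancel, Finset.sum_add_distrib, ← sum_cellSq hn hg]
  have h1 := Finset.sum_range_succ (cellSq (m + 1) g) m
  have h2 := Finset.sum_range_succ' (cellSq (m + 1) g) m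
  have h3 := cellSq_nonneg (n := m + 1) (g := g) m
  have h4 := cellSq_nonneg (n := m + 1) (g := g) 0
  linarith

end means

/-! ### The discrete energy estimate -/

/-- The fluxes of the scheme at all nodes, including the vanishing boundary fluxes. -/
noncomputable def extFlux (n : ℕ) (b : ℝ → ℝ) (q V : ℕ → ℝ) (k : ℕ) : ℝ :=
  if 1 ≤ k ∧ k < n then numFlux n b q V k else 0

lemma schemeRHS_eq {n : ℕ} (hn : 2 ≤ n) (b : ℝ → ℝ) (q V : ℕ → ℝ) {k : ℕ} (hk : k < n) :
    schemeRHS n b q V (k + 1)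
      = (1 / mesh n) * (extFlux n b q V (k + 1) - extFlux n b q V k) := by
  rw [schemeRHS, extFlux, extFlux]
  rcases Nat.eq_zero_or_pos k with rfl | h0
  · have : 1 ≤ 0 + 1 ∧ 0 + 1 < n := by omega
    rw [if_pos (by omega), if_pos this, if_neg (by omega)]
    simp
  · rw [if_neg (by omega)]
    by_cases h1 : k + 1 < n
    · rw [if_pos h1, if_pos ⟨by omega, h1⟩, if_pos ⟨h0, hk⟩, Nat.add_sub_cancel]
    · rw [if_neg h1, if_neg (by omega), if_pos ⟨h0, hk⟩]
      have : n - 1 = k := by omega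
      rw [this]; ring

/-- The dissipation inequality, at a fixed time: `F` are the fluxes, `z` the time derivatives of the
unknowns and `F'` the time derivatives of the fluxes. -/
lemma flux_dissipation {n : ℕ} {Δ c₁ Cb M : ℝ} (hΔ : 0 < Δ) (hc₁ : 0 < c₁)
    {F F' z r β : ℕ → ℝ} (F0 : F 0 = 0) (Fn : F n = 0) (z0 : z 0 = 0)
    (hz : ∀ k < n, Δ * (c₁ * z (k + 1) ^ 2) ≤ (F (k + 1) - F k) * z (k + 1))
    (hF' : ∀ k < n, Δ * (F k * F' k) = F k * (z (k + 1) - z k) + Δ * (F k * β k))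
    (hβ : ∀ k < n, |F k * β k| ≤ |F k| * (Cb * M * ((|z k| + |z (k + 1)|) / 2) + Cb * |r k|)) :
    Δ * ∑ k ∈ Finset.range n, 2 * (F k * F' k)
      ≤ -(c₁ / 2) * (Δ * ∑ k ∈ Finset.range n, z (k + 1) ^ 2)
        + (2 * (Cb * M) ^ 2 / c₁ + Cb ^ 2) * (Δ * ∑ k ∈ Finset.range n, F k ^ 2)
        + Δ * ∑ k ∈ Finset.range n, r k ^ 2 := by
  set L := 2 * (Cb * M) ^ 2 / c₁ + Cb ^ 2 with hL
  -- The boundary terms of the summation by parts vanish with the boundary fluxes.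
  have htel : ∑ k ∈ Finset.range n, (F (k + 1) * z (k + 1) - F k * z k) = 0 := by
    rw [Finset.sum_range_sub (fun k => F k * z k), F0, Fn]; ring
  have hsum : ∑ k ∈ Finset.range n, z k ^ 2 ≤ ∑ k ∈ Finset.range n, z (k + 1) ^ 2 := by
    have h1 := Finset.sum_range_succ (fun k => z k ^ 2) n
    have h2 := Finset.sum_range_succ' (fun k => z k ^ 2) n
    have := sq_nonneg (z n)
    simp only [z0] at h2
    linarith
  have young : ∀ x y : ℝ, x * (Cb * M * y) ≤ c₁ / 4 * y ^ 2 + (Cb * M) ^ 2 / c₁ * x ^ 2 := by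
    intro x y
    have h0 : 0 ≤ 1 / c₁ * (c₁ / 2 * y - Cb * M * x) ^ 2 := by positivity
    have : 1 / c₁ * (c₁ / 2 * y - Cb * M * x) ^ 2
        = c₁ / 4 * y ^ 2 - x * (Cb * M * y) + (Cb * M) ^ 2 / c₁ * x ^ 2 := by field_simp; ring
    linarith
  -- Abel summation: F_k(z_{k+1} - z_k) is the telescoping difference minus (F_{k+1} - F_k)z_{k+1},
  -- and the latter dissipates by `hz`. The two Young terms use only a part of this dissipation.
  have hterm : ∀ k ∈ Finset.range n, Δ * (2 * (F k * F' k))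
      ≤ 2 * (F (k + 1) * z (k + 1) - F k * z k) + (-2 * (Δ * c₁) * z (k + 1) ^ 2
        + Δ * (c₁ / 4) * (z k ^ 2 + z (k + 1) ^ 2) + Δ * L * F k ^ 2 + Δ * r k ^ 2) := by
    intro k hk
    have hk' := Finset.mem_range.1 hk
    have h1 := hF' k hk'
    have h2 := hz k hk'
    have h3 := (le_abs_self _).trans (hβ k hk')
    have y1 := young |F k| |z k|
    have y2 := young |F k| |z (k + 1)|
    have y3 := two_mul_le_add_sq (Cb * |F k|) |r k|
    rw [mul_pow] at y3
    simp only [sq_abs] at y1 y2 y3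
    have h4 : 2 * (F k * β k) ≤ c₁ / 4 * (z k ^ 2 + z (k + 1) ^ 2) + L * F k ^ 2 + r k ^ 2 := by
      have e : L * F k ^ 2 = 2 * ((Cb * M) ^ 2 / c₁ * F k ^ 2) + Cb ^ 2 * F k ^ 2 := by
        rw [hL]; ring
      rw [e]
      nlinarith
    have h5 := mul_le_mul_of_nonneg_left h4 hΔ.le
    nlinarith
  have := Finset.sum_le_sum hterm
  simp only [Finset.sum_add_distrib, ← Finset.mul_sum, htel] at this
  simp only [← Finset.mul_sum]
  have h6 : 0 ≤ Δ * (c₁ / 4) := by positivity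
  have h7 := mul_le_mul_of_nonneg_left hsum h6
  have h8 : 0 ≤ ∑ k ∈ Finset.range n, z (k + 1) ^ 2 := Finset.sum_nonneg fun _ _ => sq_nonneg _
  have h9 : 0 ≤ Δ * c₁ * ∑ k ∈ Finset.range n, z (k + 1) ^ 2 := by positivity
  linarith

/-- Discrete energy estimate. The conclusion bounds the fluxes uniformly in time and the time
derivatives in `L²`. -/
lemma discrete_energy {n : ℕ} {T c₁ Cb M : ℝ} (hn : 2 ≤ n) (hT : 0 ≤ T) (hc₁ : 0 < c₁)
    {b h : ℝ → ℝ} (hb : ContDiff ℝ 2 b) (hbC : ∀ s, |b s| ≤ Cb) (hbC' : ∀ s, |deriv b s| ≤ Cb)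
    (hh : ∀ s, c₁ ≤ deriv h s) {q r V z : ℕ → ℝ → ℝ}
    (hq : ∀ k, 1 ≤ k → k < n → IsPrim T (q k) (r k))
    (hqM : ∀ k, 1 ≤ k → k < n → ∀ t ∈ Icc 0 T, |q k t| ≤ M)
    (hr2 : ∀ k, 1 ≤ k → k < n → IntervalIntegrable (fun t => r k t ^ 2) volume 0 T)
    (hV : ∀ k < n, ∀ t ∈ Icc 0 T, HasDerivWithinAt (V (k + 1)) (z (k + 1) t) (Icc 0 T) t)
    (hzc : ∀ k < n, ContinuousOn (z (k + 1)) (Icc 0 T))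
    (hz : ∀ k < n, ∀ t ∈ Icc 0 T, deriv h (V (k + 1) t) * z (k + 1) t
      = schemeRHS n b (fun j => q j t) (fun j => V j t) (k + 1))
    {B : ℝ} (hB : mesh n * (∑ k ∈ Finset.range n,
        extFlux n b (fun j => q j 0) (fun j => V j 0) k ^ 2)
      + ∫ t in (0)..T, mesh n * ∑ k ∈ Finset.range n, (if 1 ≤ k then r k t else 0) ^ 2 ≤ B) :
    (∀ t ∈ Icc 0 T, mesh n * (∑ k ∈ Finset.range n,
        extFlux n b (fun j => q j t) (fun j => V j t) k ^ 2)
        ≤ B * (1 + (2 * (Cb * M) ^ 2 / c₁ + Cb ^ 2) * T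
          * Real.exp ((2 * (Cb * M) ^ 2 / c₁ + Cb ^ 2) * T))) ∧
      ∫ t in (0)..T, mesh n * ∑ k ∈ Finset.range n, z (k + 1) t ^ 2
        ≤ 2 / c₁ * (B + (2 * (Cb * M) ^ 2 / c₁ + Cb ^ 2)
          * (B * (1 + (2 * (Cb * M) ^ 2 / c₁ + Cb ^ 2) * T
          * Real.exp ((2 * (Cb * M) ^ 2 / c₁ + Cb ^ 2) * T)) * T)) := by
  have hn0 : 0 < n := by omega
  have hΔ := mesh_pos hn0
  set L := 2 * (Cb * M) ^ 2 / c₁ + Cb ^ 2 with hL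
  have hL0 : 0 ≤ L := by positivity
  set F : ℕ → ℝ → ℝ := fun k t => extFlux n b (fun j => q j t) (fun j => V j t) k with hF
  -- No unknown has the index 0, so `V 0`, `z 0`, `q 0` and `r 0` are arbitrary. Setting them to
  -- zero where they would enter lets the sums start at the left boundary node.
  set R : ℕ → ℝ → ℝ := fun k t => if 1 ≤ k then r k t else 0 with hR
  set ζ : ℕ → ℝ → ℝ := fun k t => if 1 ≤ k then z k t else 0 with hζ
  set β : ℕ → ℝ → ℝ := fun k t =>
    deriv b ((V k t + V (k + 1) t) / 2) * ((z k t + z (k + 1) t) / 2) * q k t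
      + b ((V k t + V (k + 1) t) / 2) * r k t with hβ
  set F' : ℕ → ℝ → ℝ := fun k t =>
    if 1 ≤ k then (z (k + 1) t - z k t) / mesh n + β k t else 0 with hF'
  have hbd : Continuous (deriv b) := hb.continuous_deriv (by norm_num)
  have hVc : ∀ k < n, ContinuousOn (V (k + 1)) (Icc 0 T) := fun k hk t ht =>
    (hV k hk t ht).continuousWithinAt
  -- The discrete values are continuously differentiable in time, but the means of p are only
  -- absolutely continuous, and so are the fluxes.
  have hFprim : ∀ k < n, IsPrim T (F k) (F' k) := by
    intro k hk
    rcases Nat.eq_zero_or_pos k with rfl | h0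
    · have e1 : F 0 = fun _ => 0 := by funext t; simp [hF, extFlux]
      have e2 : F' 0 = fun _ => 0 := by funext t; simp [hF']
      rw [e1, e2]
      exact ⟨by simp, by simp⟩
    obtain ⟨j, rfl⟩ : ∃ j, k = j + 1 := ⟨k - 1, by omega⟩
    have hj : j < n := by omega
    have p1 : IsPrim T (V (j + 1)) (z (j + 1)) := .of_hasDerivWithinAt hT (hV j hj) (hzc j hj)
    have p2 : IsPrim T (V (j + 1 + 1)) (z (j + 1 + 1)) :=
      .of_hasDerivWithinAt hT (hV (j + 1) hk) (hzc (j + 1) hk)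
    have p3 : IsPrim T (fun t => b ((V (j + 1) t + V (j + 1 + 1) t) / 2))
        (fun t => deriv b ((V (j + 1) t + V (j + 1 + 1) t) / 2)
          * ((z (j + 1) t + z (j + 1 + 1) t) / 2)) := by
      refine IsPrim.of_hasDerivWithinAt hT (fun t ht => ?_) ?_
      · have hd := (((hV j hj t ht).add (hV (j + 1) hk t ht)).div_const 2)
        exact ((hb.differentiable (by norm_num)) _).hasDerivAt.comp_hasDerivWithinAt t hd
      · exact (hbd.comp_continuousOn (((hVc j hj).add (hVc (j + 1) hk)).div_const 2)).mul
          (((hzc j hj).add (hzc (j + 1) hk)).div_const 2)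
    have p4 := ((p2.sub p1).const_mul (1 / mesh n)).add (p3.mul hT (hq (j + 1) (by omega) hk))
    have e1 : F (j + 1) = fun t => 1 / mesh n * (V (j + 1 + 1) t - V (j + 1) t)
        + b ((V (j + 1) t + V (j + 1 + 1) t) / 2) * q (j + 1) t := by
      funext t
      simp only [hF, extFlux]
      rw [if_pos ⟨by omega, hk⟩, numFlux]
      ring
    have e2 : F' (j + 1) = fun t => 1 / mesh n * (z (j + 1 + 1) t - z (j + 1) t)
        + (deriv b ((V (j + 1) t + V (j + 1 + 1) t) / 2)
          * ((z (j + 1) t + z (j + 1 + 1) t) / 2) * q (j + 1) t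
          + b ((V (j + 1) t + V (j + 1 + 1) t) / 2) * r (j + 1) t) := by
      funext t
      simp only [hF', hβ]
      rw [if_pos (by omega)]
      ring
    rw [e1, e2]
    exact p4
  set y : ℝ → ℝ := fun t => mesh n * ∑ k ∈ Finset.range n, F k t ^ 2 with hy
  set S : ℝ → ℝ := fun t => mesh n * ∑ k ∈ Finset.range n, z (k + 1) t ^ 2 with hS
  set P : ℝ → ℝ := fun t => mesh n * ∑ k ∈ Finset.range n, R k t ^ 2 with hP
  have hyprim : IsPrim T y (fun t => mesh n * ∑ k ∈ Finset.range n, 2 * (F k t * F' k t)) := by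
    refine IsPrim.const_mul (IsPrim.sum _ fun k hk => ?_) _
    have := (hFprim k (Finset.mem_range.1 hk)).mul hT (hFprim k (Finset.mem_range.1 hk))
    have e1 : (fun t => F k t ^ 2) = fun t => F k t * F k t := by funext t; ring
    have e2 : (fun t => 2 * (F k t * F' k t)) = fun t => F' k t * F k t + F k t * F' k t := by
      funext t; ring
    rw [e1, e2]; exact this
  have hSi : IntervalIntegrable S volume 0 T := by
    refine ContinuousOn.intervalIntegrable ?_
    rw [uIcc_of_le hT]
    exact continuousOn_const.mul (continuousOn_finsetSum _ fun k hk =>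
      (hzc k (Finset.mem_range.1 hk)).pow 2)
  have hPi : IntervalIntegrable P volume 0 T := by
    refine IntervalIntegrable.const_mul ?_ _
    have := IntervalIntegrable.sum (μ := volume) (a := 0) (b := T) (Finset.range n)
      (f := fun k t => R k t ^ 2) fun k hk => ?_
    · have e : (fun t => ∑ k ∈ Finset.range n, R k t ^ 2)
          = ∑ k ∈ Finset.range n, fun t => R k t ^ 2 := by funext t; simp
      rw [e]; exact this
    · rcases Nat.eq_zero_or_pos k with rfl | h0
      · simp [hR]
      · have : (fun t => R k t ^ 2) = fun t => r k t ^ 2 := by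
          funext t; simp only [hR]; rw [if_pos (show 1 ≤ k from h0)]
        rw [this]
        exact hr2 k h0 (Finset.mem_range.1 hk)
  have hyi : IntervalIntegrable y volume 0 T := by
    refine ContinuousOn.intervalIntegrable ?_
    rw [uIcc_of_le hT]; exact hyprim.continuousOn hT
  have hdiss : ∀ t ∈ Icc 0 T, mesh n * ∑ k ∈ Finset.range n, 2 * (F k t * F' k t)
      ≤ -(c₁ / 2) * S t + L * y t + P t := by
    intro t ht
    have hζS : ∑ k ∈ Finset.range n, ζ (k + 1) t ^ 2 = ∑ k ∈ Finset.range n, z (k + 1) t ^ 2 := by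
      refine Finset.sum_congr rfl fun k _ => ?_
      simp only [hζ]; rw [if_pos (by omega)]
    simp only [hS]
    rw [← hζS]
    refine flux_dissipation (F := fun k => F k t) (F' := fun k => F' k t) (z := fun k => ζ k t)
      (r := fun k => R k t) (β := fun k => if 1 ≤ k then β k t else 0) (Cb := Cb) (M := M)
      hΔ hc₁ ?_ ?_ ?_ ?_ ?_ ?_
    · simp [hF, extFlux]
    · simp [hF, extFlux]
    · simp [hζ]
    · intro k hk
      have h1 := hz k hk t ht
      rw [schemeRHS_eq hn b _ _ hk] at h1
      have e : ζ (k + 1) t = z (k + 1) t := by simp only [hζ]; rw [if_pos (by omega)]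
      have h2 : F (k + 1) t - F k t = mesh n * (deriv h (V (k + 1) t) * z (k + 1) t) := by
        rw [h1]; simp only [hF]; field_simp
      rw [e, h2]
      have h3 := mul_le_mul_of_nonneg_right (hh (V (k + 1) t)) (sq_nonneg (z (k + 1) t))
      have h4 := mul_le_mul_of_nonneg_left h3 hΔ.le
      linarith
    · intro k hk
      rcases Nat.eq_zero_or_pos k with rfl | h0
      · simp [hF, extFlux]
      · have h0' : 1 ≤ k := h0
        simp only [hF', hζ]
        rw [if_pos h0', if_pos h0', if_pos h0', if_pos (by omega)]
        field_simp
    · intro k hk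
      rcases Nat.eq_zero_or_pos k with rfl | h0
      · simp [hF, extFlux]
      · have h0' : 1 ≤ k := h0
        simp only [hζ, hR]
        rw [if_pos h0', if_pos h0', if_pos h0', if_pos (by omega), abs_mul]
        refine mul_le_mul_of_nonneg_left ?_ (abs_nonneg _)
        refine (abs_add_le _ _).trans (add_le_add ?_ ?_)
        · rw [abs_mul, abs_mul, mul_right_comm]
          have hCb : 0 ≤ Cb := (abs_nonneg _).trans (hbC 0)
          have a1 : |(z k t + z (k + 1) t) / 2| ≤ (|z k t| + |z (k + 1) t|) / 2 := by
            rw [abs_div, abs_two]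
            exact div_le_div_of_nonneg_right (abs_add_le _ _) (by norm_num)
          exact mul_le_mul (mul_le_mul (hbC' _) (hqM k h0' hk t ht) (abs_nonneg _) hCb) a1
            (abs_nonneg _) (mul_nonneg hCb ((abs_nonneg _).trans (hqM k h0' hk t ht)))
        · rw [abs_mul]
          exact mul_le_mul_of_nonneg_right (hbC _) (abs_nonneg _)
  have hS0 : ∀ t, 0 ≤ S t := fun t =>
    mul_nonneg hΔ.le (Finset.sum_nonneg fun _ _ => sq_nonneg _)
  have hP0 : ∀ t, 0 ≤ P t := fun t =>
    mul_nonneg hΔ.le (Finset.sum_nonneg fun _ _ => sq_nonneg _)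
  have hy0 : ∀ t, 0 ≤ y t := fun t =>
    mul_nonneg hΔ.le (Finset.sum_nonneg fun _ _ => sq_nonneg _)
  have sub : ∀ {f : ℝ → ℝ}, IntervalIntegrable f volume 0 T → ∀ {t}, t ∈ Icc 0 T →
      IntervalIntegrable f volume 0 t := fun hf t ht =>
    (IsPrim.of_integral hf 0).intervalIntegrable_of_mem ht
  have main : ∀ t ∈ Icc 0 T, y t + c₁ / 2 * (∫ s in (0)..t, S s)
      ≤ B + L * ∫ s in (0)..t, y s := by
    intro t ht
    have h1 := intervalIntegral.integral_mono_on ht.1 (hyprim.intervalIntegrable_of_mem ht)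
      ((((sub hSi ht).const_mul (-(c₁ / 2))).add ((sub hyi ht).const_mul L)).add (sub hPi ht))
      fun s hs => hdiss s ⟨hs.1, hs.2.trans ht.2⟩
    rw [intervalIntegral.integral_add (((sub hSi ht).const_mul (-(c₁ / 2))).add
      ((sub hyi ht).const_mul L)) (sub hPi ht), intervalIntegral.integral_add
      ((sub hSi ht).const_mul (-(c₁ / 2))) ((sub hyi ht).const_mul L)] at h1
    have h2 := hyprim.2 t ht
    simp only [intervalIntegral.integral_const_mul] at h1 h2
    have h3 : ∫ s in (0)..t, P s ≤ ∫ s in (0)..T, P s :=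
      intervalIntegral.integral_mono_interval le_rfl ht.1 ht.2 (ae_of_all _ hP0) hPi
    linarith
  have hB0 : 0 ≤ B := by
    refine le_trans (add_nonneg (hy0 0) (intervalIntegral.integral_nonneg hT fun t _ => hP0 t)) hB
  have hgron : ∀ t ∈ Icc 0 T, y t ≤ B * (1 + L * T * Real.exp (L * T)) := fun t ht => by
    refine integral_gronwall hB0 hL0 hyi (fun s hs => ?_) ht
    have h1 := main s hs
    have h2 : 0 ≤ ∫ s in (0)..s, S s := intervalIntegral.integral_nonneg hs.1 fun t _ => hS0 t
    nlinarith
  refine ⟨hgron, ?_⟩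
  have h1 := main T (right_mem_Icc.2 hT)
  have h2 : ∫ s in (0)..T, y s ≤ B * (1 + L * T * Real.exp (L * T)) * T := by
    have := intervalIntegral.integral_mono_on hT hyi
      (by simp : IntervalIntegrable (fun _ => B * (1 + L * T * Real.exp (L * T))) volume 0 T)
      hgron
    rw [intervalIntegral.integral_const, sub_zero, smul_eq_mul, mul_comm] at this
    exact this
  have h3 := mul_le_mul_of_nonneg_left h2 hL0
  have h4 : c₁ / 2 * (∫ s in (0)..T, S s)
      ≤ B + L * (B * (1 + L * T * Real.exp (L * T)) * T) := by linarith [hy0 T]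
  rw [div_mul_eq_mul_div, le_div_iff₀ hc₁]
  linarith

/-! ### Step functions on the cylinder -/

lemma memLp_slice {a c : ℝ} {g : ℝ × ℝ → ℝ} (hg : MemLp g 2 (volRect a c)) :
    ∀ᵐ t ∂volIoo a, MemLp (fun x => g (t, x)) 2 (volIoo c) := by
  filter_upwards [integrable_slice_fst hg.integrable_sq, hg.aestronglyMeasurable.prodMk_left]
    with t h1 h2
  exact (memLp_two_iff_integrable_sq h2).2 h1

section step

variable {n : ℕ} {T : ℝ} {c : ℕ → ℝ → ℝ}

lemma aestronglyMeasurable_step (hn : 0 < n) (hc : ∀ k < n, ContinuousOn (c k) (Icc 0 T)) :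
    AEStronglyMeasurable (fun z : ℝ × ℝ => c (cellIdx n z.2) z.1) (volRect T 1) := by
  have h1 : AEStronglyMeasurable (fun z : ℝ × ℝ => ∑ k ∈ Finset.range n,
      (if cellIdx n z.2 = k then (1 : ℝ) else 0) * c k z.1) (volRect T 1) := by
    refine Finset.aestronglyMeasurable_fun_sum _ fun k hk => AEStronglyMeasurable.mul ?_ ?_
    · exact (Measurable.ite (measurableSet_eq_fun ((measurable_cellIdx n).comp measurable_snd)
        measurable_const) measurable_const measurable_const).aestronglyMeasurable
    · have := ((hc k (Finset.mem_range.1 hk)).mono Ioo_subset_Icc_self).aestronglyMeasurable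
        (μ := volume) measurableSet_Ioo
      exact AEStronglyMeasurable.comp_fst this
  refine h1.congr ?_
  filter_upwards [ae_of_snd (a := T) (ae_mem_Ioo 1)] with z hz
  rw [Finset.sum_eq_single (cellIdx n z.2)]
  · simp
  · intro k _ hk; rw [if_neg hk.symm, zero_mul]
  · intro h; exact absurd (Finset.mem_range.2 (cellIdx_lt hn hz)) h

lemma memLp_step (hn : 0 < n) (hc : ∀ k < n, ContinuousOn (c k) (Icc 0 T)) :
    MemLp (fun z : ℝ × ℝ => c (cellIdx n z.2) z.1) 2 (volRect T 1) := by
  have hb : ∀ k, ∃ C, k < n → ∀ t ∈ Icc 0 T, ‖c k t‖ ≤ C := by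
    intro k
    by_cases hk : k < n
    · obtain ⟨C, hC⟩ := isCompact_Icc.exists_bound_of_continuousOn (hc k hk)
      exact ⟨C, fun _ => hC⟩
    · exact ⟨0, fun h => absurd h hk⟩
  choose C hC using hb
  refine MemLp.of_bound (aestronglyMeasurable_step hn hc) (∑ k ∈ Finset.range n, |C k|) ?_
  filter_upwards [ae_of_snd (a := T) (ae_mem_Ioo 1), ae_of_fst (c := 1) (ae_mem_Ioo T)]
    with z h1 h2
  have hk := cellIdx_lt hn h1
  refine (hC _ hk z.1 ⟨h2.1.le, h2.2.le⟩).trans ((le_abs_self _).trans ?_)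
  exact Finset.single_le_sum (f := fun k => |C k|) (fun _ _ => abs_nonneg _)
    (Finset.mem_range.2 hk)

lemma integral_step_sq (hn : 0 < n) (hT : 0 ≤ T) (hc : ∀ k < n, ContinuousOn (c k) (Icc 0 T)) :
    ∫ z, c (cellIdx n z.2) z.1 ^ 2 ∂volRect T 1
      = ∫ t in (0)..T, mesh n * ∑ k ∈ Finset.range n, c k t ^ 2 := by
  rw [integral_prod _ (memLp_step hn hc).integrable_sq, ← integral_volIoo hT]
  exact integral_congr_ae (ae_of_all _ fun t => integral_step hn fun k => c k t ^ 2)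

end step

/-! ### Cell means of functions that are absolutely continuous in time -/

section cellMeans

variable {n : ℕ} {T : ℝ} {p pt : ℝ × ℝ → ℝ} {P : ℝ → ℝ}

lemma isPrim_primX (hT : 0 ≤ T) (hpt : Integrable pt (volRect T 1)) {x : ℝ}
    (hx : x ∈ Icc (0 : ℝ) 1) :
    IsPrim T (fun t => primT (primX pt) (t, x)) (fun t => primX pt (t, x)) := by
  refine ⟨?_, fun t _ => by simp [primT]⟩
  rw [intervalIntegrable_iff_volIoo hT]
  have := (hpt.mono_measure (volRect_mono_snd hx.2)).integral_prod_left
  simpa only [primX, integral_volIoo hx.1] using this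

/-- As a difference of primitives at the fixed nodes, the mean of a time-dependent function inherits
the time regularity of these primitives. -/
lemma cellMean_eq_primX (hn : 0 < n) {k : ℕ} (hk : k < n) {f : ℝ → ℝ}
    (hf : Integrable f (volIoo 1)) :
    cellMean n (k + 1) f = 1 / mesh n *
      ((∫ y in (0)..(node n (k + 1)), f y) - ∫ y in (0)..(node n k), f y) := by
  have hi := (intervalIntegrable_iff_volIoo zero_le_one).2 hf
  have hp := IsPrim.of_integral hi 0
  rw [cellMean_eq, intervalIntegral.integral_interval_sub_left
    (hp.intervalIntegrable_of_mem ⟨node_nonneg _, node_le_one hn hk⟩)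
    (hp.intervalIntegrable_of_mem ⟨node_nonneg _, node_le_one hn hk.le⟩)]

/-- The means of P and of the double primitive of `pt` give an absolutely continuous function that
equals q for almost every t. Both are continuous, so they agree on all of [0, T]. -/
lemma isPrim_cellMean (hT : 0 < T) (hn : 0 < n) {k : ℕ} (hk : k < n)
    (hP : Integrable P (volIoo 1)) (hpt : Integrable pt (volRect T 1))
    (hp : ∀ᵐ z ∂volRect T 1, p z = P z.2 + primT pt z) {q : ℝ → ℝ}
    (hqc : ContinuousOn q (Icc 0 T))
    (hq : ∀ᵐ t ∂volIoo T, q t = cellMean n (k + 1) (fun x => p (t, x))) :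
    IsPrim T q (fun t => cellMean n (k + 1) (fun x => pt (t, x))) := by
  have hk1 : node n (k + 1) ∈ Icc (0 : ℝ) 1 := ⟨node_nonneg _, node_le_one hn hk⟩
  have hk0 : node n k ∈ Icc (0 : ℝ) 1 := ⟨node_nonneg _, node_le_one hn hk.le⟩
  have p1 := ((isPrim_primX hT.le hpt hk1).sub (isPrim_primX hT.le hpt hk0)).const_mul (1 / mesh n)
  have p2 : IsPrim T (fun t => cellMean n (k + 1) P + 1 / mesh n *
      (primT (primX pt) (t, node n (k + 1)) - primT (primX pt) (t, node n k)))
      (fun t => cellMean n (k + 1) (fun x => pt (t, x))) := by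
    have p3 : IsPrim T (fun _ => cellMean n (k + 1) P) (fun _ => 0) :=
      ⟨by simp, fun t _ => by simp⟩
    refine (p3.add p1).congr_ae hT.le ?_
    filter_upwards [integrable_slice_fst hpt] with t ht
    rw [cellMean_eq_primX hn hk ht, zero_add]
    rfl
  refine p2.congr hT.le ?_
  have hae : q =ᵐ[volume.restrict (Icc 0 T)] fun t => cellMean n (k + 1) P + 1 / mesh n *
      (primT (primX pt) (t, node n (k + 1)) - primT (primX pt) (t, node n k)) := by
    rw [← restrict_Ioc_eq_restrict_Icc, ← restrict_Ioo_eq_restrict_Ioc]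
    filter_upwards [hq, ae_ae_fst hp, ae_mem_Ioo T] with t h1 h2 h3
    have ht : t ∈ Icc 0 T := ⟨h3.1.le, h3.2.le⟩
    have hi : Integrable (fun x => primT pt (t, x)) (volIoo 1) :=
      (intervalIntegrable_iff_volIoo zero_le_one).1 (isPrim_primT_primX hpt ht).1
    rw [h1, cellMean_congr hn h2 hk, cellMean_eq_primX (f := fun x => P x + primT pt (t, x)) hn hk
        (hP.add hi),
      cellMean_eq_primX hn hk hP, primT_primX_eq hpt ht hk1, primT_primX_eq hpt ht hk0]
    have add : ∀ {x}, x ∈ Icc (0 : ℝ) 1 → ∫ y in (0)..x, (P y + primT pt (t, y))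
        = (∫ y in (0)..x, P y) + ∫ y in (0)..x, primT pt (t, y) := by
      intro x hx
      exact intervalIntegral.integral_add
        ((IsPrim.of_integral ((intervalIntegrable_iff_volIoo zero_le_one).2 hP)
          0).intervalIntegrable_of_mem hx)
        ((isPrim_primT_primX hpt ht).intervalIntegrable_of_mem hx)
    rw [add hk1, add hk0]
    ring
  exact Measure.eqOn_Icc_of_ae_eq volume hT.ne hae hqc (p2.continuousOn hT.le)

/-- The continuous functions max(q, M) and M agree almost everywhere, hence everywhere on [0, T]. -/
lemma le_of_ae_le {M : ℝ} (hT : 0 < T) {q : ℝ → ℝ} (hqc : ContinuousOn q (Icc 0 T))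
    (hq : ∀ᵐ t ∂volIoo T, q t ≤ M) : ∀ t ∈ Icc 0 T, q t ≤ M := by
  have hae : (fun t => max (q t) M) =ᵐ[volume.restrict (Icc 0 T)] fun _ => M := by
    rw [← restrict_Ioc_eq_restrict_Icc, ← restrict_Ioo_eq_restrict_Ioc]
    filter_upwards [hq] with t ht
    exact max_eq_right ht
  intro t ht
  have := Measure.eqOn_Icc_of_ae_eq volume hT.ne hae
    (hqc.sup continuousOn_const) continuousOn_const ht
  exact max_eq_right_iff.1 this

lemma sq_cellMean_le (hn : 0 < n) {k : ℕ} (hk : k < n) {f : ℝ → ℝ} (hf : MemLp f 2 (volIoo 1)) :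
    mesh n * cellMean n (k + 1) f ^ 2 ≤ cellSq n f k := by
  have hm := mesh_pos hn
  have h1 := sq_integral_abs_cell_le hn hf hk
  have h2 : (∫ s in (node n k)..(node n (k + 1)), f s) ^ 2
      ≤ (∫ s in (node n k)..(node n (k + 1)), |f s|) ^ 2 := by
    rw [← sq_abs]
    exact pow_le_pow_left₀ (abs_nonneg _)
      (intervalIntegral.abs_integral_le_integral_abs (node_mono (Nat.le_succ k))) 2
  rw [cellMean_eq, mul_pow]
  have e : mesh n * ((1 / mesh n) ^ 2 * (∫ s in (node n k)..(node n (k + 1)), f s) ^ 2)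
      = (∫ s in (node n k)..(node n (k + 1)), f s) ^ 2 / mesh n := by
    field_simp
  rw [e, div_le_iff₀ hm]
  linarith

lemma cellSq_le (hn : 0 < n) {k : ℕ} (hk : k < n) {f : ℝ → ℝ} (hf : MemLp f 2 (volIoo 1)) :
    cellSq n f k ≤ ∫ x, f x ^ 2 ∂volIoo 1 := by
  rw [← sum_cellSq hn hf]
  exact Finset.single_le_sum (f := fun k => cellSq n f k) (fun _ _ => cellSq_nonneg _)
    (Finset.mem_range.2 hk)

lemma intervalIntegrable_cellMean_sq (hT : 0 < T) (hn : 0 < n) {k : ℕ} (hk : k < n)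
    (hpt : MemLp pt 2 (volRect T 1)) {q : ℝ → ℝ}
    (h : IsPrim T q (fun t => cellMean n (k + 1) (fun x => pt (t, x)))) :
    IntervalIntegrable (fun t => cellMean n (k + 1) (fun x => pt (t, x)) ^ 2) volume 0 T := by
  rw [intervalIntegrable_iff_volIoo hT.le]
  have h1 := ((intervalIntegrable_iff_volIoo hT.le).1 h.1).aestronglyMeasurable
  refine Integrable.mono' (hpt.integrable_sq.integral_prod_left.const_mul (1 / mesh n))
    (h1.pow 2) ?_
  filter_upwards [memLp_slice hpt] with t ht
  have hm := mesh_pos hn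
  rw [Real.norm_eq_abs, abs_of_nonneg (sq_nonneg _), one_div, inv_mul_eq_div, le_div_iff₀ hm]
  have := (sq_cellMean_le hn hk ht).trans (cellSq_le hn hk ht)
  linarith

/-- Jensen's inequality on each cell. Here k counts the inner nodes, so the last cell does not enter
and may be dropped. -/
lemma integral_sum_cellMean_sq_le (hT : 0 < T) (hn : 0 < n) (hpt : MemLp pt 2 (volRect T 1)) :
    ∫ t in (0)..T, mesh n * ∑ k ∈ Finset.range n,
      (if 1 ≤ k then cellMean n k (fun x => pt (t, x)) else 0) ^ 2
      ≤ ∫ z, pt z ^ 2 ∂volRect T 1 := by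
  rw [integral_prod _ hpt.integrable_sq, ← integral_volIoo hT.le]
  refine integral_mono_of_nonneg (ae_of_all _ fun t => ?_) hpt.integrable_sq.integral_prod_left ?_
  · exact mul_nonneg (mesh_pos hn).le (Finset.sum_nonneg fun _ _ => sq_nonneg _)
  · filter_upwards [memLp_slice hpt] with t ht
    rw [← sum_cellSq hn ht, Finset.mul_sum]
    obtain ⟨m, rfl⟩ : ∃ m, n = m + 1 := ⟨n - 1, by omega⟩
    rw [Finset.sum_range_succ', Finset.sum_range_succ (cellSq _ _)]
    refine add_le_add (Finset.sum_le_sum fun k hk => ?_) ?_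
    · rw [if_pos (by omega)]
      exact sq_cellMean_le hn (by have := Finset.mem_range.1 hk; omega) ht
    · simpa using cellSq_nonneg _

end cellMeans

/-! ### A priori bounds for the scheme -/

/-- The difference quotient of the discrete unknowns on the cell with left end point `node n k`. -/
noncomputable def slope (n : ℕ) (V : ℕ → ℝ → ℝ) (k : ℕ) (t : ℝ) : ℝ :=
  if k = 0 then 0 else (V (k + 1) t - V k t) / mesh n

/-- The time derivative of `h (V (k + 1))`. -/
noncomputable def rate (n : ℕ) (b : ℝ → ℝ) (q V : ℕ → ℝ → ℝ) (k : ℕ) (t : ℝ) : ℝ :=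
  schemeRHS n b (fun j => q j t) (fun j => V j t) (k + 1)

/-- The properties of a solution of the scheme that are used in the error estimate. -/
structure SchemeBounds (n : ℕ) (T : ℝ) (h b : ℝ → ℝ) (p : ℝ × ℝ → ℝ) (v₀ : ℝ → ℝ)
    (V q : ℕ → ℝ → ℝ) (B : ℝ) : Prop where
  q_cont : ∀ k < n, ContinuousOn (q (k + 1)) (Icc 0 T)
  q_mean : ∀ k < n, ∀ᵐ t ∂volIoo T, q (k + 1) t = cellMean n (k + 1) fun x => p (t, x)
  V_cont : ∀ k < n, ContinuousOn (V (k + 1)) (Icc 0 T)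
  V_zero : ∀ k < n, V (k + 1) 0 = cellMean n (k + 1) v₀
  isPrim : ∀ k < n, IsPrim T (fun t => h (V (k + 1) t)) (rate n b q V k)
  rate_cont : ∀ k < n, ContinuousOn (rate n b q V k) (Icc 0 T)
  slope_le : ∫ t in (0)..T, mesh n * ∑ k ∈ Finset.range n, slope n V k t ^ 2 ≤ B
  rate_le : ∫ t in (0)..T, mesh n * ∑ k ∈ Finset.range n, rate n b q V k t ^ 2 ≤ B

lemma continuousOn_slope {n : ℕ} {T : ℝ} {V : ℕ → ℝ → ℝ}
    (hV : ∀ k < n, ContinuousOn (V (k + 1)) (Icc 0 T)) :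
    ∀ k < n, ContinuousOn (slope n V k) (Icc 0 T) := by
  intro k hk
  rcases Nat.eq_zero_or_pos k with rfl | h0
  · have : slope n V 0 = fun _ => 0 := by funext t; simp [slope]
    rw [this]; exact continuousOn_const
  · obtain ⟨j, rfl⟩ : ∃ j, k = j + 1 := ⟨k - 1, by omega⟩
    have : slope n V (j + 1) = fun t => (V (j + 1 + 1) t - V (j + 1) t) / mesh n := by
      funext t; simp [slope]
    rw [this]
    exact ((hV (j + 1) hk).sub (hV j (by omega))).div_const _

lemma extFlux_eq {n : ℕ} {b : ℝ → ℝ} {q V : ℕ → ℝ → ℝ} {k : ℕ} (h0 : 1 ≤ k) (hk : k < n) (t : ℝ) :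
    extFlux n b (fun j => q j t) (fun j => V j t) k
      = slope n V k t + b ((V k t + V (k + 1) t) / 2) * q k t := by
  rw [extFlux, if_pos ⟨h0, hk⟩, numFlux, slope, if_neg (by omega)]

/-- The discrete gradient of the initial means is bounded because v₀ is in H¹; the factor is 2 from
two adjacent cells times 2 from counting cells twice. -/
lemma sum_slope_zero_sq_le {n : ℕ} (hn : 0 < n) {v₀ g : ℝ → ℝ} {c : ℝ} (hg : MemLp g 2 (volIoo 1))
    (hv₀ : ∀ᵐ x ∂volIoo 1, v₀ x = c + ∫ y in (0)..x, g y) {V : ℕ → ℝ → ℝ}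
    (hV : ∀ k < n, V (k + 1) 0 = cellMean n (k + 1) v₀) :
    mesh n * ∑ k ∈ Finset.range n, slope n V k 0 ^ 2 ≤ 4 * ∫ x, g x ^ 2 ∂volIoo 1 := by
  have hm := mesh_pos hn
  have hp : IsPrim 1 (fun x => c + ∫ y in (0)..x, g y) g :=
    IsPrim.of_integral ((intervalIntegrable_iff_volIoo zero_le_one).2 (hg.integrable one_le_two)) c
  have hs := sum_cellSq_add_le hn hg
  obtain ⟨m, rfl⟩ : ∃ m, n = m + 1 := ⟨n - 1, by omega⟩
  rw [Nat.add_sub_cancel] at hs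
  have h0 : slope (m + 1) V 0 0 = 0 := by simp [slope]
  rw [Finset.sum_range_succ', h0, zero_pow two_ne_zero, add_zero, Finset.mul_sum]
  refine le_trans (Finset.sum_le_sum fun k hk => ?_) (b := ∑ k ∈ Finset.range m,
    2 * (cellSq (m + 1) g k + cellSq (m + 1) g (k + 1))) ?_
  · have hk' : k + 1 < m + 1 := by have := Finset.mem_range.1 hk; omega
    have h1 := hp.sq_cellMean_sub_cellMean_le hg hn hk'
    rw [slope, if_neg (by omega), hV (k + 1) hk', hV k (by omega), cellMean_congr hn hv₀ hk',
      cellMean_congr hn hv₀ (show k < m + 1 by omega), div_pow]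
    have e : ∀ X : ℝ, mesh (m + 1) * (X / mesh (m + 1) ^ 2) = X / mesh (m + 1) := by
      intro X; field_simp
    rw [e, div_le_iff₀ hm]
    linarith
  · rw [← Finset.mul_sum]; linarith

/-- B is chosen before n: the energy estimate needs only the initial fluxes, bounded through the
gradient of v₀ and the bound of bp, and the time derivative of p in L². The bounded fluxes then
yield the slopes, and the bounded time derivatives the rates. B is the sum of the two bounds. -/
lemma exists_schemeBounds {T c₁ C₂ Cb M : ℝ} (hT : 0 < T) (hc₁ : 0 < c₁)
    {h b : ℝ → ℝ} (hh : ContDiff ℝ 2 h) (hh₁ : ∀ s, c₁ ≤ deriv h s) (hh₂ : ∀ s, deriv h s ≤ C₂)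
    (hb : ContDiff ℝ 2 b) (hbC : ∀ s, |b s| ≤ Cb) (hbC' : ∀ s, |deriv b s| ≤ Cb)
    {p pt : ℝ × ℝ → ℝ} {P : ℝ → ℝ} (hM : ∀ᵐ z ∂volRect T 1, |p z| ≤ M)
    (hP : Integrable P (volIoo 1)) (hpt : MemLp pt 2 (volRect T 1))
    (hp : ∀ᵐ z ∂volRect T 1, p z = P z.2 + primT pt z)
    {v₀ g : ℝ → ℝ} {c : ℝ} (hg : MemLp g 2 (volIoo 1))
    (hv₀ : ∀ᵐ x ∂volIoo 1, v₀ x = c + ∫ y in (0)..x, g y) :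
    ∃ B, ∀ n, 3 ≤ n → ∀ V, IsSchemeSolution n T h b p v₀ V →
      ∃ q, SchemeBounds n T h b p v₀ V q B := by
  set L := 2 * (Cb * M) ^ 2 / c₁ + Cb ^ 2 with hL
  have hL0 : 0 ≤ L := by positivity
  -- Twice the bound 4∫g² of the initial slopes, then the contribution of b(v)p to the initial
  -- fluxes, then that of ∂ₜp.
  set B₀ := 8 * (∫ x, g x ^ 2 ∂volIoo 1) + 2 * (Cb * M) ^ 2 + ∫ z, pt z ^ 2 ∂volRect T 1 with hB₀
  have hg0 : 0 ≤ ∫ x, g x ^ 2 ∂volIoo 1 := integral_nonneg fun _ => sq_nonneg _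
  have hpt0 : 0 ≤ ∫ z, pt z ^ 2 ∂volRect T 1 := integral_nonneg fun _ => sq_nonneg _
  have hB₀0 : 0 ≤ B₀ := by positivity
  set Y := B₀ * (1 + L * T * Real.exp (L * T)) with hY
  have hY0 : 0 ≤ Y := by positivity
  set S := 2 / c₁ * (B₀ + L * (Y * T)) with hS
  have hS0 : 0 ≤ S := by positivity
  refine ⟨(2 * Y + 2 * (Cb * M) ^ 2) * T + C₂ ^ 2 * S, ?_⟩
  rintro n hn V ⟨q, hq, hV, hV0⟩
  have hn0 : 0 < n := by omega
  have hm := mesh_pos hn0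
  have mem : ∀ {k}, k < n → k + 1 ∈ Finset.Icc 1 n := fun hk => Finset.mem_Icc.2 ⟨by omega, hk⟩
  have hCb0 : 0 ≤ Cb := (abs_nonneg _).trans (hbC 0)
  have q_cont : ∀ k < n, ContinuousOn (q (k + 1)) (Icc 0 T) := fun k hk => (hq _ (mem hk)).1
  have q_mean : ∀ k < n, ∀ᵐ t ∂volIoo T, q (k + 1) t = cellMean n (k + 1) fun x => p (t, x) :=
    fun k hk => (hq _ (mem hk)).2
  have q_le : ∀ k < n, ∀ t ∈ Icc 0 T, |q (k + 1) t| ≤ M := fun k hk =>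
    le_of_ae_le hT (q_cont k hk).abs (by
      filter_upwards [q_mean k hk, ae_ae_fst hM] with t h1 h2
      rw [h1]; exact abs_cellMean_le hn0 h2 hk)
  have V_cont : ∀ k < n, ContinuousOn (V (k + 1)) (Icc 0 T) := by
    intro k hk t ht
    obtain ⟨d, hd, -⟩ := hV _ (mem hk) t ht
    exact hd.continuousWithinAt
  have V_zero : ∀ k < n, V (k + 1) 0 = cellMean n (k + 1) v₀ := fun k hk => hV0 _ (mem hk)
  have flux_cont : ∀ k ≤ n, ContinuousOn
      (fun t => extFlux n b (fun j => q j t) (fun j => V j t) k) (Icc 0 T) := by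
    intro k hk
    by_cases hk' : 1 ≤ k ∧ k < n
    · obtain ⟨j, rfl⟩ : ∃ j, k = j + 1 := ⟨k - 1, by omega⟩
      have hj : j < n := by omega
      simp only [extFlux_eq hk'.1 hk'.2]
      exact (continuousOn_slope V_cont _ hk'.2).add ((hb.continuous.comp_continuousOn
        (((V_cont j hj).add (V_cont (j + 1) hk'.2)).div_const 2)).mul (q_cont j hj))
    · simp only [extFlux, if_neg hk']
      exact continuousOn_const
  have rate_cont : ∀ k < n, ContinuousOn (rate n b q V k) (Icc 0 T) := by
    intro k hk
    have : rate n b q V k = fun t => (1 / mesh n) *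
        (extFlux n b (fun j => q j t) (fun j => V j t) (k + 1)
          - extFlux n b (fun j => q j t) (fun j => V j t) k) := by
      funext t; exact schemeRHS_eq (by omega) b _ _ hk
    rw [this]
    exact continuousOn_const.mul ((flux_cont (k + 1) hk).sub (flux_cont k hk.le))
  have hpos : ∀ s, deriv h s ≠ 0 := fun s => (hc₁.trans_le (hh₁ s)).ne'
  -- The scheme determines the derivative of `V i` uniquely since h' > 0. The index i - 1 undoes the
  -- shift in `rate`.
  set z : ℕ → ℝ → ℝ := fun i t => rate n b q V (i - 1) t / deriv h (V i t) with hz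
  have hhd : Continuous (deriv h) := hh.continuous_deriv (by norm_num)
  have z_cont : ∀ k < n, ContinuousOn (z (k + 1)) (Icc 0 T) := fun k hk =>
    (rate_cont k hk).div (hhd.comp_continuousOn (V_cont k hk)) fun t _ => hpos _
  have z_eq : ∀ k < n, ∀ t ∈ Icc 0 T, deriv h (V (k + 1) t) * z (k + 1) t = rate n b q V k t := by
    intro k _ t _
    simp only [hz, Nat.add_sub_cancel]
    rw [mul_div_cancel₀ _ (hpos _)]
  have V_deriv : ∀ k < n, ∀ t ∈ Icc 0 T,
      HasDerivWithinAt (V (k + 1)) (z (k + 1) t) (Icc 0 T) t := by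
    intro k hk t ht
    obtain ⟨d, hd, he⟩ := hV _ (mem hk) t ht
    have : d = z (k + 1) t := mul_left_cancel₀ (hpos (V (k + 1) t)) (he.trans (z_eq k hk t ht).symm)
    rwa [← this]
  have isPrim : ∀ k < n, IsPrim T (fun t => h (V (k + 1) t)) (rate n b q V k) := by
    intro k hk
    refine IsPrim.of_hasDerivWithinAt hT.le (fun t ht => ?_) (rate_cont k hk)
    rw [← z_eq k hk t ht]
    exact ((hh.differentiable (by norm_num)) _).hasDerivAt.comp_hasDerivWithinAt t
      (V_deriv k hk t ht)
  have q_prim : ∀ k, 1 ≤ k → k < n →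
      IsPrim T (q k) (fun t => cellMean n k fun x => pt (t, x)) := by
    intro k h1 hk
    obtain ⟨j, rfl⟩ : ∃ j, k = j + 1 := ⟨k - 1, by omega⟩
    exact isPrim_cellMean hT hn0 (by omega) hP (hpt.integrable one_le_two) hp
      (q_cont j (by omega)) (q_mean j (by omega))
  have bq_le : ∀ k, 1 ≤ k → k < n → ∀ t ∈ Icc 0 T,
      (b ((V k t + V (k + 1) t) / 2) * q k t) ^ 2 ≤ (Cb * M) ^ 2 := by
    intro k h1 hk t ht
    obtain ⟨j, rfl⟩ : ∃ j, k = j + 1 := ⟨k - 1, by omega⟩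
    rw [← sq_abs, abs_mul]
    exact pow_le_pow_left₀ (by positivity) (mul_le_mul (hbC _) (q_le j (by omega) t ht)
      (abs_nonneg _) hCb0) 2
  have sum_const : ∀ a : ℝ, mesh n * ∑ _k ∈ Finset.range n, a = a := by
    intro a
    rw [Finset.sum_const, Finset.card_range, nsmul_eq_mul, ← mul_assoc, mul_comm (mesh n),
      mul_mesh hn0, one_mul]
  -- Flux and slope differ by b q, of modulus at most Cb M, and both vanish for k = 0. One half
  -- serves at time 0, the other turns the flux bound into a slope bound.
  have compare : ∀ t ∈ Icc 0 T, ∀ k ∈ Finset.range n,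
      extFlux n b (fun j => q j t) (fun j => V j t) k ^ 2
        ≤ 2 * slope n V k t ^ 2 + 2 * (Cb * M) ^ 2 ∧
      slope n V k t ^ 2 ≤ 2 * extFlux n b (fun j => q j t) (fun j => V j t) k ^ 2
        + 2 * (Cb * M) ^ 2 := by
    intro t ht k hk
    have hk := Finset.mem_range.1 hk
    rcases Nat.eq_zero_or_pos k with rfl | h0
    · simp only [extFlux, slope]
      norm_num
      positivity
    · have h1 := bq_le k h0 hk t ht
      rw [extFlux_eq h0 hk]
      set x := slope n V k t
      set y := b ((V k t + V (k + 1) t) / 2) * q k t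
      constructor
      · nlinarith [sq_nonneg (x - y)]
      · nlinarith [sq_nonneg (x + 2 * y)]
  have h00 : (0 : ℝ) ∈ Icc 0 T := left_mem_Icc.2 hT.le
  have init : mesh n * (∑ k ∈ Finset.range n,
        extFlux n b (fun j => q j 0) (fun j => V j 0) k ^ 2)
      + ∫ t in (0)..T, mesh n * ∑ k ∈ Finset.range n,
        (if 1 ≤ k then cellMean n k (fun x => pt (t, x)) else 0) ^ 2 ≤ B₀ := by
    have h1 := integral_sum_cellMean_sq_le hT hn0 hpt
    have h2 := sum_slope_zero_sq_le hn0 hg hv₀ V_zero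
    have h3 := mul_le_mul_of_nonneg_left
      (Finset.sum_le_sum fun k hk => (compare 0 h00 k hk).1) hm.le
    rw [Finset.sum_add_distrib, mul_add, sum_const, ← Finset.mul_sum] at h3
    linarith
  obtain ⟨e1, e2⟩ := discrete_energy (M := M) (by omega) hT.le hc₁ hb hbC hbC' hh₁ q_prim
    (fun k h1 hk => by
      obtain ⟨j, rfl⟩ : ∃ j, k = j + 1 := ⟨k - 1, by omega⟩
      exact q_le j (by omega))
    (fun k h1 hk => by
      obtain ⟨j, rfl⟩ : ∃ j, k = j + 1 := ⟨k - 1, by omega⟩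
      exact intervalIntegrable_cellMean_sq hT hn0 (by omega) hpt (q_prim _ h1 hk))
    V_deriv z_cont z_eq init
  rw [← hL, ← hY] at e1
  rw [← hL, ← hY, ← hS] at e2
  have sum_int : ∀ f : ℕ → ℝ → ℝ, (∀ k < n, ContinuousOn (f k) (Icc 0 T)) →
      IntervalIntegrable (fun t => mesh n * ∑ k ∈ Finset.range n, f k t ^ 2) volume 0 T := by
    intro f hf
    refine ContinuousOn.intervalIntegrable ?_
    rw [uIcc_of_le hT.le]
    exact continuousOn_const.mul (continuousOn_finsetSum _ fun k hk =>
      (hf k (Finset.mem_range.1 hk)).pow 2)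
  refine ⟨q, q_cont, q_mean, V_cont, V_zero, isPrim, rate_cont, ?_, ?_⟩
  · have h1 : ∫ t in (0)..T, mesh n * ∑ k ∈ Finset.range n, slope n V k t ^ 2
        ≤ ∫ t in (0)..T, (2 * Y + 2 * (Cb * M) ^ 2) := by
      refine intervalIntegral.integral_mono_on hT.le (sum_int _ (continuousOn_slope V_cont))
        (by simp) fun t ht => ?_
      have h3 := mul_le_mul_of_nonneg_left
        (Finset.sum_le_sum fun k hk => (compare t ht k hk).2) hm.le
      rw [Finset.sum_add_distrib, mul_add, sum_const, ← Finset.mul_sum] at h3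
      linarith [e1 t ht]
    rw [intervalIntegral.integral_const, sub_zero, smul_eq_mul] at h1
    have : 0 ≤ C₂ ^ 2 * S := by positivity
    linarith
  · have h1 : ∫ t in (0)..T, mesh n * ∑ k ∈ Finset.range n, rate n b q V k t ^ 2
        ≤ ∫ t in (0)..T, C₂ ^ 2 * (mesh n * ∑ k ∈ Finset.range n, z (k + 1) t ^ 2) := by
      refine intervalIntegral.integral_mono_on hT.le (sum_int _ rate_cont)
        ((sum_int (fun k => z (k + 1)) z_cont).const_mul _) fun t ht => ?_
      rw [mul_left_comm (C₂ ^ 2)]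
      refine mul_le_mul_of_nonneg_left ?_ hm.le
      rw [Finset.mul_sum]
      refine Finset.sum_le_sum fun k hk => ?_
      rw [← z_eq k (Finset.mem_range.1 hk) t ht, mul_pow]
      exact mul_le_mul_of_nonneg_right (pow_le_pow_left₀ (hc₁.le.trans (hh₁ _)) (hh₂ _) 2)
        (sq_nonneg _)
    rw [intervalIntegral.integral_const_mul (C₂ ^ 2)] at h1
    have h2 := mul_le_mul_of_nonneg_left e2 (sq_nonneg C₂)
    have : 0 ≤ (2 * Y + 2 * (Cb * M) ^ 2) * T := by positivity
    linarith

/-! ### Properties of strong solutions -/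

/-- The properties of a strong solution that are used in the error estimate. -/
structure StrongData (T : ℝ) (h b : ℝ → ℝ) (p : ℝ × ℝ → ℝ) (v₀ : ℝ → ℝ) (v vx G : ℝ × ℝ → ℝ)
    (A : ℝ → ℝ) : Prop where
  memLp_v : MemLp v 2 (volRect T 1)
  memLp_vx : MemLp vx 2 (volRect T 1)
  memLp_G : MemLp G 2 (volRect T 1)
  h_eq : ∀ᵐ z ∂volRect T 1, h (v z) = h (v₀ z.2) + primT G z
  v_eq : ∀ᵐ z ∂volRect T 1, v z = A z.1 + primX vx z
  flux : ∀ᵐ z ∂volRect T 1, vx z + b (v z) * p z = primX G z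
  flux_one : ∀ᵐ t ∂volIoo T, primX G (t, 1) = 0

lemma lipschitz_of_deriv_le {f : ℝ → ℝ} {C : ℝ} (hf : Differentiable ℝ f)
    (hC : ∀ s, |deriv f s| ≤ C) (x y : ℝ) : |f x - f y| ≤ C * |x - y| :=
  Convex.norm_image_sub_le_of_norm_deriv_le (s := univ) (fun s _ => hf s) (fun s _ => hC s)
    convex_univ (mem_univ y) (mem_univ x)

lemma memLp_comp {α : Type*} [MeasurableSpace α] {μ : Measure α} [IsFiniteMeasure μ] {f : ℝ → ℝ}
    {C : ℝ} (hf : Differentiable ℝ f) (hC : ∀ s, |deriv f s| ≤ C) {u : α → ℝ}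
    (hu : MemLp u 2 μ) : MemLp (fun x => f (u x)) 2 μ := by
  have h1 : MemLp (fun x => f (u x) - f 0) 2 μ := by
    refine MemLp.of_le_mul (c := C) hu
      ((hf.continuous.comp_aestronglyMeasurable hu.1).sub aestronglyMeasurable_const)
      (ae_of_all _ fun x => ?_)
    have := lipschitz_of_deriv_le hf hC (u x) 0
    rwa [sub_zero (u x)] at this
  refine (h1.add (memLp_const (f 0))).ae_eq (ae_of_all _ fun x => ?_)
  simp

instance : IsProbabilityMeasure (volIoo 1) := ⟨by simp⟩

lemma integral_abs_le_norm_Lp (f : Lp ℝ 2 (volIoo 1)) : ∫ x, |f x| ∂volIoo 1 ≤ ‖f‖ := by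
  have h1 : MemLp f 1 (volIoo 1) := (Lp.memLp f).mono_exponent one_le_two
  have h2 : ∫ x, |f x| ∂volIoo 1 = (eLpNorm f 1 (volIoo 1)).toReal := by
    rw [eLpNorm_one_eq_lintegral_enorm]
    exact integral_norm_eq_lintegral_enorm h1.1
  rw [h2, Lp.norm_def]
  exact ENNReal.toReal_mono (Lp.eLpNorm_ne_top f)
    (eLpNorm_le_eLpNorm_of_exponent_le one_le_two h1.1)

lemma integral_abs_primT_le {T : ℝ} {G : ℝ × ℝ → ℝ} (hG : Integrable G (volRect T 1)) {t : ℝ}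
    (ht : t ∈ Icc 0 T) : ∫ x, |primT G (t, x)| ∂volIoo 1
      ≤ ∫ s in (0)..t, ∫ x, |G (s, x)| ∂volIoo 1 := by
  have hG' := hG.mono_measure (volRect_mono (c := 1) ht.2)
  rw [← integral_volIoo ht.1, integral_integral_swap hG'.abs]
  refine integral_mono_of_nonneg (ae_of_all _ fun x => abs_nonneg _) hG'.abs.integral_prod_right
    (ae_of_all _ fun x => ?_)
  simp only [primT]
  rw [← integral_volIoo ht.1]
  exact abs_integral_le_integral_abs

/-- Identification of the initial value. -/
lemma HasInitialValue.ae_eq {T : ℝ} (hT : 0 < T) {h : ℝ → ℝ} {C : ℝ} (hh : Differentiable ℝ h)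
    (hC : ∀ s, |deriv h s| ≤ C) {v G : ℝ × ℝ → ℝ} {v₀ P : ℝ → ℝ}
    (hi : HasInitialValue T v v₀) (hG : Integrable G (volRect T 1)) (hP : Integrable P (volIoo 1))
    (hv : ∀ᵐ z ∂volRect T 1, h (v z) = P z.2 + primT G z) :
    ∀ᵐ x ∂volIoo 1, P x = h (v₀ x) := by
  obtain ⟨w, hwc, hw, hw0⟩ := hi
  have i1 : ∀ t, Integrable (fun x => h (w t x)) (volIoo 1) := fun t =>
    (memLp_comp hh hC (Lp.memLp (w t))).integrable one_le_two
  have hC0 : 0 ≤ C := (abs_nonneg _).trans (hC 0)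
  set a : ℝ → ℝ := fun s => ∫ x, |G (s, x)| ∂volIoo 1 with ha
  have ha' : IntervalIntegrable a volume 0 T :=
    (intervalIntegrable_iff_volIoo hT.le).2 hG.abs.integral_prod_left
  set δ := ∫ x, |P x - h (w 0 x)| ∂volIoo 1 with hδ
  -- The L¹ distance δ of P and h(w(0)) is compared at almost every t with quantities continuous in
  -- t. By continuity the inequality reaches t = 0, where these quantities vanish.
  have key : ∀ t ∈ Icc 0 T, δ - ((0 + ∫ s in (0)..t, a s) + C * ‖w t - w 0‖) ≤ 0 := by
    refine le_of_ae_le hT ?_ ?_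
    · exact continuousOn_const.sub (((IsPrim.of_integral ha' 0).continuousOn hT.le).add
        (continuousOn_const.mul (hwc.sub continuousOn_const).norm))
    · filter_upwards [hw, ae_ae_fst hv, ae_mem_Ioo T] with t h1 h2 ht'
      have ht : t ∈ Icc 0 T := ⟨ht'.1.le, ht'.2.le⟩
      have i2 : Integrable (fun x => primT G (t, x)) (volIoo 1) :=
        (intervalIntegrable_iff_volIoo zero_le_one).1 (isPrim_primT_primX hG ht).1
      have i3 : Integrable (fun x => |(w t - w 0 : Lp ℝ 2 (volIoo 1)) x|) (volIoo 1) :=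
        ((Lp.memLp (w t - w 0)).integrable one_le_two).abs
      have h3 : δ ≤ ∫ x, (|primT G (t, x)| + C * |(w t - w 0 : Lp ℝ 2 (volIoo 1)) x|)
          ∂volIoo 1 := by
        refine integral_mono_ae (hP.sub (i1 0)).abs (i2.abs.add (i3.const_mul C)) ?_
        filter_upwards [h1, h2, Lp.coeFn_sub (w t) (w 0)] with x e1 e2 e3
        have e4 := lipschitz_of_deriv_le hh hC (w t x) (w 0 x)
        rw [e1] at e2
        have e5 : P x - h (w 0 x) = -primT G (t, x) + (h (w t x) - h (w 0 x)) := by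
          rw [e2]; ring
        rw [e3, Pi.sub_apply, e5]
        refine (abs_add_le _ _).trans ?_
        rw [abs_neg]
        linarith
      rw [integral_add i2.abs (i3.const_mul C), integral_const_mul] at h3
      have h4 := integral_abs_primT_le hG ht
      have h5 := mul_le_mul_of_nonneg_left (integral_abs_le_norm_Lp (w t - w 0)) hC0
      linarith
  have h0 := key 0 (left_mem_Icc.2 hT.le)
  simp only [intervalIntegral.integral_same, sub_self, norm_zero, mul_zero, add_zero,
    sub_zero] at h0
  have h1 : δ = 0 := le_antisymm h0 (integral_nonneg fun _ => abs_nonneg _)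
  have h2 := (integral_eq_zero_iff_of_nonneg (fun _ => abs_nonneg _) (hP.sub (i1 0)).abs).1 h1
  filter_upwards [h2, hw0] with x e1 e2
  have : P x - h (w 0 x) = 0 := abs_eq_zero.1 e1
  rw [← e2]; linarith

/-- Two continuous representatives on [0, 1] coincide up to the end points, so the boundary values
can be read off from the primitive. -/
lemma HasBoundaryValues.eq_zero {f G : ℝ → ℝ} {c : ℝ} (hf : HasBoundaryValues f 0 0)
    (hG : Integrable G (volIoo 1)) (h : ∀ᵐ x ∂volIoo 1, f x = c + ∫ y in (0)..x, G y) :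
    c = 0 ∧ ∫ y in (0)..1, G y = 0 := by
  obtain ⟨F, hF, hae, h0, h1⟩ := hf
  have hp := (IsPrim.of_integral ((intervalIntegrable_iff_volIoo zero_le_one).2 hG)
    c).continuousOn zero_le_one
  have he : F =ᵐ[volume.restrict (Icc 0 1)] fun x => c + ∫ y in (0)..x, G y := by
    rw [← restrict_Ioc_eq_restrict_Icc, ← restrict_Ioo_eq_restrict_Ioc]
    filter_upwards [hae, h] with x e1 e2
    rw [← e1, e2]
  have key := Measure.eqOn_Icc_of_ae_eq volume zero_ne_one he hF hp
  have k0 := key (left_mem_Icc.2 zero_le_one)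
  have k1 := key (right_mem_Icc.2 zero_le_one)
  simp only [h0, h1, intervalIntegral.integral_same, add_zero] at k0 k1
  exact ⟨k0.symm, by linarith⟩

/-- Each weak derivative gives a primitive with an unknown integration constant. The initial
condition identifies that of h(v) as h(v₀), and the boundary condition at 0 removes that of the
flux; the condition at 1 gives `flux_one`. The various weak space derivatives of v agree almost
everywhere by uniqueness. -/
lemma IsStrongSolution.exists_strongData {T : ℝ} (hT : 0 < T) {h b : ℝ → ℝ} {C Cb M : ℝ}
    (hh : Differentiable ℝ h) (hC : ∀ s, |deriv h s| ≤ C) (hb : Continuous b)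
    (hbC : ∀ s, |b s| ≤ Cb) {p : ℝ × ℝ → ℝ} (hpm : AEStronglyMeasurable p (volRect T 1))
    (hM : ∀ᵐ z ∂volRect T 1, |p z| ≤ M) {v₀ : ℝ → ℝ} {v vx : ℝ × ℝ → ℝ}
    (hv : IsStrongSolution T h b p v₀ v) (hvx : IsWeakDx T v vx) :
    ∃ G A, StrongData T h b p v₀ v vx G A := by
  obtain ⟨vx', hvx', ⟨G, hG, hGt, hGx⟩, hbdry⟩ := hv.equation
  obtain ⟨hv2, vx'', hvx'', hvx2, -⟩ := hv.memL2H2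
  have hv2' := hv2
  rw [MemL2H, volume_restrict_Q] at hv2'
  have e1 : ∀ᵐ z ∂volRect T 1, vx z = vx'' z := hvx.ae_unique hvx'' (ae_of_all _ fun _ => rfl)
  have e2 : ∀ᵐ z ∂volRect T 1, vx' z = vx z := hvx'.ae_unique hvx (ae_of_all _ fun _ => rfl)
  have mvx : MemLp vx 2 (volRect T 1) := by
    rw [MemL2H, volume_restrict_Q] at hvx2
    exact hvx2.ae_eq (e1.mono fun z hz => hz.symm)
  have mG : MemLp G 2 (volRect T 1) := by rwa [MemL2H, volume_restrict_Q] at hG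
  have mhv : MemLp (fun z => h (v z)) 2 (volRect T 1) := memLp_comp hh hC hv2'
  have mflux : MemLp (fun z => vx' z + b (v z) * p z) 2 (volRect T 1) := by
    have m1 : MemLp (fun z => b (v z) * p z) 2 (volRect T 1) := by
      refine MemLp.of_bound ((hb.comp_aestronglyMeasurable hv2'.1).mul hpm) (Cb * M) ?_
      filter_upwards [hM] with z hz
      rw [norm_mul]
      exact mul_le_mul (hbC _) hz (norm_nonneg _) ((abs_nonneg _).trans (hbC 0))
    exact (mvx.ae_eq (e2.mono fun z hz => hz.symm)).add m1
  obtain ⟨P, hP, hPe⟩ := hGt.exists_primT hT (by rwa [MemL2H, volume_restrict_Q]) hG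
  obtain ⟨A, -, hAe⟩ := hvx.exists_primX hv2 (by rwa [MemL2H, volume_restrict_Q])
  obtain ⟨R, -, hRe⟩ := hGx.exists_primX (by rwa [MemL2H, volume_restrict_Q]) hG
  have hP0 := hv.initial.ae_eq hT hh hC (mG.integrable one_le_two) hP hPe
  have hR : ∀ᵐ t ∂volIoo T, R t = 0 ∧ primX G (t, 1) = 0 := by
    filter_upwards [hbdry, ae_ae_fst hRe, integrable_slice_fst (mG.integrable one_le_two)]
      with t h1 h2 h3
    exact h1.eq_zero h3 h2
  refine ⟨G, A, hv2', mvx, mG, ?_, hAe, ?_, hR.mono fun t ht => ht.2⟩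
  · filter_upwards [hPe, ae_of_snd (a := T) hP0] with z h1 h2
    rw [h1, h2]
  · filter_upwards [hRe, ae_of_fst (c := 1) hR, e2] with z h1 h2 h3
    rw [h2.1, zero_add, h3] at h1
    exact h1

lemma primT_sub {T : ℝ} {f g : ℝ × ℝ → ℝ} (hf : Integrable f (volRect T 1))
    (hg : Integrable g (volRect T 1)) :
    ∀ᵐ z ∂volRect T 1, primT (fun z => f z - g z) z = primT f z - primT g z := by
  filter_upwards [ae_of_snd (a := T) (integrable_slice_snd hf),
    ae_of_snd (a := T) (integrable_slice_snd hg), ae_of_fst (c := 1) (ae_mem_Ioo T)]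
    with z h1 h2 h3
  have h4 : z.1 ∈ Icc 0 T := ⟨h3.1.le, h3.2.le⟩
  have hT := h4.1.trans h4.2
  exact intervalIntegral.integral_sub
    ((IsPrim.of_integral ((intervalIntegrable_iff_volIoo hT).2 h1) 0).intervalIntegrable_of_mem h4)
    ((IsPrim.of_integral ((intervalIntegrable_iff_volIoo hT).2 h2) 0).intervalIntegrable_of_mem h4)

lemma primX_sub {T : ℝ} {f g : ℝ × ℝ → ℝ} (hf : Integrable f (volRect T 1))
    (hg : Integrable g (volRect T 1)) :
    ∀ᵐ t ∂volIoo T, ∀ x ∈ Icc (0 : ℝ) 1,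
      primX (fun z => f z - g z) (t, x) = primX f (t, x) - primX g (t, x) := by
  filter_upwards [integrable_slice_fst hf, integrable_slice_fst hg] with t h1 h2 x hx
  exact intervalIntegral.integral_sub
    ((IsPrim.of_integral ((intervalIntegrable_iff_volIoo zero_le_one).2 h1)
      0).intervalIntegrable_of_mem hx)
    ((IsPrim.of_integral ((intervalIntegrable_iff_volIoo zero_le_one).2 h2)
      0).intervalIntegrable_of_mem hx)

lemma primX_sub' {T : ℝ} {f g : ℝ × ℝ → ℝ} (hf : Integrable f (volRect T 1))
    (hg : Integrable g (volRect T 1)) :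
    ∀ᵐ z ∂volRect T 1, primX (fun z => f z - g z) z = primX f z - primX g z := by
  filter_upwards [ae_of_fst (c := 1) (primX_sub hf hg), ae_of_snd (a := T) (ae_mem_Ioo 1)]
    with z h1 h2
  exact h1 z.2 ⟨h2.1.le, h2.2.le⟩

lemma mul_sq_le_of_le_deriv {f : ℝ → ℝ} {c : ℝ} (hf : Differentiable ℝ f)
    (hc : ∀ s, c ≤ deriv f s) (x y : ℝ) : c * (x - y) ^ 2 ≤ (f x - f y) * (x - y) := by
  rcases le_total y x with hxy | hxy
  · have := mul_sub_le_image_sub_of_le_deriv hf hc hxy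
    nlinarith
  · have := mul_sub_le_image_sub_of_le_deriv hf hc hxy
    nlinarith

/-- Uniqueness of strong solutions. -/
lemma StrongData.ae_eq {T : ℝ} (hT : 0 < T) {h b : ℝ → ℝ} {c₁ C Cb M : ℝ} (hc₁ : 0 < c₁)
    (hh : Differentiable ℝ h) (hc : ∀ s, c₁ ≤ deriv h s) (hC : ∀ s, |deriv h s| ≤ C)
    (hb : Differentiable ℝ b) (hbC : ∀ s, |deriv b s| ≤ Cb) {p : ℝ × ℝ → ℝ}
    (hM : ∀ᵐ z ∂volRect T 1, |p z| ≤ M) {v₀ : ℝ → ℝ} {v vx G v' vx' G' : ℝ × ℝ → ℝ} {A A' : ℝ → ℝ}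
    (hs : StrongData T h b p v₀ v vx G A) (hs' : StrongData T h b p v₀ v' vx' G' A') :
    ∀ᵐ z ∂volRect T 1, v z = v' z := by
  have iG := hs.memLp_G.integrable one_le_two
  have iG' := hs'.memLp_G.integrable one_le_two
  have ivx := hs.memLp_vx.integrable one_le_two
  have ivx' := hs'.memLp_vx.integrable one_le_two
  -- The difference of two solutions is an error system with e' = e and without consistency or
  -- initial error, so its L² norm vanishes.
  have hsys : ErrorSystem T c₁ C (Cb * M) (fun z => h (v z) - h (v' z)) (fun z => G z - G' z)
      (fun z => vx z - vx' z) (fun z => v z - v' z) (fun z => v z - v' z) (fun _ => 0)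
      (fun _ => 0) (fun t => A t - A' t) :=
    { memLp_Γ := hs.memLp_G.sub hs'.memLp_G
      memLp_η := hs.memLp_vx.sub hs'.memLp_vx
      memLp_e := hs.memLp_v.sub hs'.memLp_v
      memLp_e' := hs.memLp_v.sub hs'.memLp_v
      memLp_ρ := memLp_const 0
      memLp_E₀ := memLp_const 0
      E_eq := by
        filter_upwards [hs.h_eq, hs'.h_eq, primT_sub iG iG'] with z h1 h2 h3
        rw [h1, h2, h3]; ring
      e'_eq := by
        filter_upwards [hs.v_eq, hs'.v_eq, primX_sub' ivx ivx'] with z h1 h2 h3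
        rw [h3, h1, h2]; ring
      flux_one := by
        filter_upwards [hs.flux_one, hs'.flux_one, primX_sub iG iG'] with t h1 h2 h3
        rw [h3 1 (right_mem_Icc.2 zero_le_one), h1, h2, sub_zero]
      coercive := ae_of_all _ fun z => mul_sq_le_of_le_deriv hh hc _ _
      E_le := ae_of_all _ fun z => lipschitz_of_deriv_le hh hC _ _
      e'_sub_le := ae_of_all _ fun z => by simp
      flux_sub_le := by
        filter_upwards [hs.flux, hs'.flux, primX_sub' iG iG', hM] with z h1 h2 h3 h4
        rw [h3, ← h1, ← h2]
        have e : vx z + b (v z) * p z - (vx' z + b (v' z) * p z) - (vx z - vx' z)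
            = (b (v z) - b (v' z)) * p z := by ring
        rw [e, abs_mul, add_zero, mul_right_comm]
        exact mul_le_mul (lipschitz_of_deriv_le hb hbC _ _) h4 (abs_nonneg _)
          (mul_nonneg ((abs_nonneg _).trans (hbC 0)) (abs_nonneg _)) }
  obtain ⟨N, hN, hle⟩ := ErrorSystem.exists_integral_sq_le (T := T) C (Cb * M) hT hc₁
  have h1 := hle _ _ _ _ _ _ _ _ hsys
  have h2 : ∫ z, (v z - v' z) ^ 2 ∂volRect T 1 = 0 :=
    le_antisymm (by simpa using h1) (integral_nonneg fun _ => sq_nonneg _)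
  have h3 := (integral_eq_zero_iff_of_nonneg (fun _ => sq_nonneg _)
    hsys.memLp_e.integrable_sq).1 h2
  filter_upwards [h3] with z hz
  exact sub_eq_zero.1 (pow_eq_zero_iff two_ne_zero |>.1 hz)

/-! ### Consistency of the scheme -/

section primitive

variable {n : ℕ}

lemma integral_step_node (hn : 0 < n) (c : ℕ → ℝ) {k : ℕ} (hk : k ≤ n) :
    ∫ x in (0)..(node n k), c (cellIdx n x) = mesh n * ∑ j ∈ Finset.range k, c j := by
  have hi := (intervalIntegrable_iff_volIoo zero_le_one).2 (integrable_step hn c)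
  rw [← node_zero (n := n), ← intervalIntegral.sum_integral_adjacent_intervals, Finset.mul_sum]
  · refine Finset.sum_congr rfl fun j hj => ?_
    have e : ∫ x in (node n j)..(node n (j + 1)), c (cellIdx n x)
        = ∫ _x in (node n j)..(node n (j + 1)), c j := by
      rw [intervalIntegral.integral_of_le (node_mono (Nat.le_succ j)),
        intervalIntegral.integral_of_le (node_mono (Nat.le_succ j)),
        ← restrict_Ioo_eq_restrict_Ioc]
      refine integral_congr_ae ?_
      filter_upwards [ae_restrict_mem measurableSet_Ioo] with x hx
      rw [(cellIdx_eq_iff hn ((node_nonneg j).trans hx.1.le)).2 ⟨hx.1.le, hx.2⟩]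
    rw [e, intervalIntegral.integral_const, node_succ]
    simp
  · intro j hj
    refine hi.mono_set ?_
    rw [uIcc_of_le (node_mono (Nat.le_succ j)), uIcc_of_le zero_le_one]
    exact Icc_subset_Icc (node_nonneg j) (node_le_one hn (by omega))

/-- The primitive of a step function is piecewise linear; this supplies the interpolants of the
unknowns and of the fluxes. -/
lemma integral_step_of_mem (hn : 0 < n) (c : ℕ → ℝ) {k : ℕ} (hk : k < n) {x : ℝ}
    (hx : x ∈ Icc (node n k) (node n (k + 1))) :
    ∫ y in (0)..x, c (cellIdx n y)
      = mesh n * (∑ j ∈ Finset.range k, c j) + (x - node n k) * c k := by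
  have hp := IsPrim.of_integral
    ((intervalIntegrable_iff_volIoo zero_le_one).2 (integrable_step hn c)) 0
  have hx1 : x ∈ Icc (0 : ℝ) 1 := ⟨(node_nonneg k).trans hx.1, hx.2.trans (node_le_one hn hk)⟩
  have hk1 : node n k ∈ Icc (0 : ℝ) 1 := ⟨node_nonneg k, node_le_one hn hk.le⟩
  have h1 := intervalIntegral.integral_interval_sub_left (hp.intervalIntegrable_of_mem hx1)
    (hp.intervalIntegrable_of_mem hk1)
  have e : ∫ y in (node n k)..x, c (cellIdx n y) = ∫ _y in (node n k)..x, c k := by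
    rw [intervalIntegral.integral_of_le hx.1, intervalIntegral.integral_of_le hx.1,
      ← restrict_Ioo_eq_restrict_Ioc]
    refine integral_congr_ae ?_
    filter_upwards [ae_restrict_mem measurableSet_Ioo] with y hy
    rw [(cellIdx_eq_iff hn ((node_nonneg k).trans hy.1.le)).2 ⟨hy.1.le, hy.2.trans_le hx.2⟩]
  rw [e, integral_step_node hn c hk.le, intervalIntegral.integral_const, smul_eq_mul] at h1
  linarith

/-- Telescoping, with zero slope in the first cell. The sum including cell k stops at the value
carried by cell k. -/
lemma sum_slope (hn : 0 < n) (V : ℕ → ℝ → ℝ) (t : ℝ) (k : ℕ) :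
    mesh n * ∑ j ∈ Finset.range (k + 1), slope n V j t = V (k + 1) t - V 1 t := by
  have hm := mesh_pos hn
  induction k with
  | zero => simp [slope]
  | succ k ih =>
    rw [Finset.sum_range_succ, mul_add, ih, slope, if_neg (by omega)]
    field_simp
    ring

/-- Telescoping from the vanishing flux at the left boundary. -/
lemma sum_rate (hn : 2 ≤ n) (b : ℝ → ℝ) (q V : ℕ → ℝ → ℝ) (t : ℝ) {k : ℕ} (hk : k ≤ n) :
    mesh n * ∑ j ∈ Finset.range k, rate n b q V j t
      = extFlux n b (fun j => q j t) (fun j => V j t) k := by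
  have hm := mesh_pos (show 0 < n by omega)
  induction k with
  | zero => simp [extFlux]
  | succ k ih =>
    rw [Finset.sum_range_succ, mul_add, ih (by omega), rate, schemeRHS_eq hn b _ _ hk]
    field_simp
    ring

end primitive

/-- The distance of `p` to the mean value over the preceding cell. -/
noncomputable def meanDev (n : ℕ) (p : ℝ × ℝ → ℝ) (q : ℕ → ℝ → ℝ) (z : ℝ × ℝ) : ℝ :=
  |(if cellIdx n z.2 = 0 then 0 else 1) * p z
    - (if cellIdx n z.2 = 0 then 0 else q (cellIdx n z.2) z.1)|

/-- The consistency error of the scheme. -/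
noncomputable def consErr (n : ℕ) (b : ℝ → ℝ) (p : ℝ × ℝ → ℝ) (q V : ℕ → ℝ → ℝ) (z : ℝ × ℝ) : ℝ :=
  mesh n * |slope n V (cellIdx n z.2) z.1| + mesh n * |rate n b q V (cellIdx n z.2) z.1|
    + meanDev n p q z + (if cellIdx n z.2 = 0 then 1 else 0)

section consistency

variable {n : ℕ} {T : ℝ} {h b : ℝ → ℝ} {p : ℝ × ℝ → ℝ} {v₀ : ℝ → ℝ} {V q : ℕ → ℝ → ℝ} {B : ℝ}

lemma SchemeBounds.memLp_meanDev (hs : SchemeBounds n T h b p v₀ V q B) (hn : 0 < n)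
    (hp : MemLp p 2 (volRect T 1)) : MemLp (meanDev n p q) 2 (volRect T 1) := by
  have h1 : MemLp (fun z : ℝ × ℝ => (if cellIdx n z.2 = 0 then (0 : ℝ) else 1) * p z) 2
      (volRect T 1) := by
    refine MemLp.of_le hp (AEStronglyMeasurable.mul ?_ hp.1) (ae_of_all _ fun z => ?_)
    · exact (aestronglyMeasurable_step (c := fun k _ => if k = 0 then (0 : ℝ) else 1) hn
        fun _ _ => continuousOn_const)
    · split_ifs <;> simp
  have h2 : MemLp (fun z : ℝ × ℝ => if cellIdx n z.2 = 0 then 0 else q (cellIdx n z.2) z.1) 2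
      (volRect T 1) := by
    refine memLp_step (c := fun k t => if k = 0 then 0 else q k t) hn fun k hk => ?_
    rcases Nat.eq_zero_or_pos k with rfl | h0
    · simpa using continuousOn_const
    · obtain ⟨j, rfl⟩ : ∃ j, k = j + 1 := ⟨k - 1, by omega⟩
      simpa using hs.q_cont j (by omega)
  exact (h1.sub h2).abs

lemma SchemeBounds.memLp_slope (hs : SchemeBounds n T h b p v₀ V q B) (hn : 0 < n) :
    MemLp (fun z : ℝ × ℝ => slope n V (cellIdx n z.2) z.1) 2 (volRect T 1) :=
  memLp_step (c := slope n V) hn (continuousOn_slope hs.V_cont)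

lemma SchemeBounds.memLp_rate (hs : SchemeBounds n T h b p v₀ V q B) (hn : 0 < n) :
    MemLp (fun z : ℝ × ℝ => rate n b q V (cellIdx n z.2) z.1) 2 (volRect T 1) :=
  memLp_step (c := rate n b q V) hn hs.rate_cont

lemma memLp_firstCell (hn : 0 < n) :
    MemLp (fun z : ℝ × ℝ => if cellIdx n z.2 = 0 then (1 : ℝ) else 0) 2 (volRect T 1) :=
  memLp_step (c := fun k _ => if k = 0 then (1 : ℝ) else 0) hn fun _ _ => continuousOn_const

lemma SchemeBounds.memLp_consErr (hs : SchemeBounds n T h b p v₀ V q B) (hn : 0 < n)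
    (hp : MemLp p 2 (volRect T 1)) : MemLp (consErr n b p q V) 2 (volRect T 1) :=
  ((((hs.memLp_slope hn).abs.const_mul _).add ((hs.memLp_rate hn).abs.const_mul _)).add
    (hs.memLp_meanDev hn hp)).add (memLp_firstCell hn)

/-- The deviation of `p` from its mean values is of first order. -/
lemma SchemeBounds.integral_meanDev_sq_le (hs : SchemeBounds n T h b p v₀ V q B) (hn : 0 < n)
    (hp : MemLp p 2 (volRect T 1)) {px : ℝ × ℝ → ℝ} {P : ℝ → ℝ} (hpx : MemLp px 2 (volRect T 1))
    (hpe : ∀ᵐ z ∂volRect T 1, p z = P z.1 + primX px z) :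
    ∫ z, meanDev n p q z ^ 2 ∂volRect T 1
      ≤ 4 * mesh n ^ 2 * ∫ z, px z ^ 2 ∂volRect T 1 := by
  have hm := mesh_pos hn
  have hi := (hs.memLp_meanDev hn hp).integrable_sq
  rw [integral_prod _ hi, integral_prod _ hpx.integrable_sq, ← integral_const_mul]
  refine integral_mono_ae hi.integral_prod_left
    (hpx.integrable_sq.integral_prod_left.const_mul _) ?_
  have hq : ∀ᵐ t ∂volIoo T, ∀ k < n, q (k + 1) t = cellMean n (k + 1) fun x => p (t, x) := by
    rw [ae_all_iff]
    intro k
    by_cases hk : k < n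
    · filter_upwards [hs.q_mean k hk] with t ht _
      exact ht
    · exact ae_of_all _ fun t hk' => absurd hk' hk
  filter_upwards [hq, ae_ae_fst hpe, memLp_slice hpx, integrable_slice_fst hi] with t h1 h2 h3 h4
  have hprim : IsPrim 1 (fun x => P t + ∫ y in (0)..x, px (t, y)) (fun x => px (t, x)) :=
    IsPrim.of_integral ((intervalIntegrable_iff_volIoo zero_le_one).2 (h3.integrable one_le_two)) _
  -- On cell k ≥ 1 the deviation is taken from the mean over cell k - 1. The first cell contributes
  -- nothing here, its defect being counted separately in `consErr`.
  set c : ℕ → ℝ := fun k => if k = 0 then 0 else 2 * mesh n *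
    (cellSq n (fun x => px (t, x)) (k - 1) + cellSq n (fun x => px (t, x)) k) with hc
  have h5 : ∫ x, meanDev n p q (t, x) ^ 2 ∂volIoo 1 ≤ ∫ x, c (cellIdx n x) ∂volIoo 1 := by
    refine integral_mono_ae h4 (integrable_step hn c) ?_
    filter_upwards [h2, ae_mem_Ioo 1] with x e1 hx
    have hlt := cellIdx_lt hn hx
    have hmem := mem_Ico_cellIdx hn hx.1.le
    simp only [meanDev, hc]
    rcases Nat.eq_zero_or_pos (cellIdx n x) with h0 | h0
    · simp [h0]
    · obtain ⟨j, hj⟩ : ∃ j, cellIdx n x = j + 1 := ⟨cellIdx n x - 1, by omega⟩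
      rw [hj] at hlt hmem ⊢
      rw [if_neg (by omega), if_neg (by omega), if_neg (by omega), sq_abs, one_mul,
        Nat.add_sub_cancel, h1 j (by omega), cellMean_congr hn h2 (by omega), e1]
      exact hprim.sq_sub_cellMean_prev_le h3 hn hlt ⟨hmem.1, hmem.2.le⟩
  refine h5.trans ?_
  rw [integral_step hn c]
  have h6 := sum_cellSq_add_le hn h3
  obtain ⟨m, rfl⟩ : ∃ m, n = m + 1 := ⟨n - 1, by omega⟩
  rw [Nat.add_sub_cancel] at h6
  rw [Finset.sum_range_succ']
  simp only [hc, if_true, add_zero]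
  have e : ∑ k ∈ Finset.range m, (if k + 1 = 0 then 0 else 2 * mesh (m + 1) *
      (cellSq (m + 1) (fun x => px (t, x)) (k + 1 - 1)
        + cellSq (m + 1) (fun x => px (t, x)) (k + 1)))
      = 2 * mesh (m + 1) * ∑ k ∈ Finset.range m,
        (cellSq (m + 1) (fun x => px (t, x)) k + cellSq (m + 1) (fun x => px (t, x)) (k + 1)) := by
    rw [Finset.mul_sum]
    refine Finset.sum_congr rfl fun k _ => ?_
    rw [if_neg (by omega), Nat.add_sub_cancel]
  rw [e]
  nlinarith [mul_le_mul_of_nonneg_left h6 (show 0 ≤ 2 * mesh (m + 1) ^ 2 by positivity)]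

lemma integral_firstCell_sq (hn : 0 < n) (hT : 0 ≤ T) :
    ∫ z : ℝ × ℝ, (if cellIdx n z.2 = 0 then (1 : ℝ) else 0) ^ 2 ∂volRect T 1 = T * mesh n := by
  rw [integral_step_sq (c := fun k _ => if k = 0 then (1 : ℝ) else 0) hn hT
    fun _ _ => continuousOn_const]
  obtain ⟨m, rfl⟩ : ∃ m, n = m + 1 := ⟨n - 1, by omega⟩
  have : ∑ k ∈ Finset.range (m + 1), (if k = 0 then (1 : ℝ) else 0) ^ 2 = 1 := by
    rw [Finset.sum_range_succ']; simp
  rw [this]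
  simp

/-- The consistency error is of order one half, because of the flux in the first cell. -/
lemma SchemeBounds.integral_consErr_sq_le (hs : SchemeBounds n T h b p v₀ V q B) (hn : 0 < n)
    (hT : 0 ≤ T) (hp : MemLp p 2 (volRect T 1)) {px : ℝ × ℝ → ℝ} {P : ℝ → ℝ}
    (hpx : MemLp px 2 (volRect T 1)) (hpe : ∀ᵐ z ∂volRect T 1, p z = P z.1 + primX px z) :
    ∫ z, consErr n b p q V z ^ 2 ∂volRect T 1
      ≤ (8 * B + 16 * (∫ z, px z ^ 2 ∂volRect T 1) + 4 * T) * mesh n := by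
  have hm := mesh_pos hn
  have hm1 := mesh_le_one hn
  have i1 := (hs.memLp_slope hn).integrable_sq
  have i2 := (hs.memLp_rate hn).integrable_sq
  have i3 := (hs.memLp_meanDev hn hp).integrable_sq
  have i4 := (memLp_firstCell (T := T) hn).integrable_sq
  have h1 : ∫ z, consErr n b p q V z ^ 2 ∂volRect T 1
      ≤ ∫ z, 4 * (mesh n ^ 2 * slope n V (cellIdx n z.2) z.1 ^ 2
        + mesh n ^ 2 * rate n b q V (cellIdx n z.2) z.1 ^ 2 + meanDev n p q z ^ 2
        + (if cellIdx n z.2 = 0 then (1 : ℝ) else 0) ^ 2) ∂volRect T 1 := by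
    refine integral_mono_ae (hs.memLp_consErr hn hp).integrable_sq
      (((((i1.const_mul _).add (i2.const_mul _)).add i3).add i4).const_mul 4)
      (ae_of_all _ fun z => ?_)
    have key : ∀ w x y u : ℝ, (w + x + y + u) ^ 2 ≤ 4 * (w ^ 2 + x ^ 2 + y ^ 2 + u ^ 2) := by
      intro w x y u
      nlinarith [sq_nonneg (w - x), sq_nonneg (w - y), sq_nonneg (w - u), sq_nonneg (x - y),
        sq_nonneg (x - u), sq_nonneg (y - u)]
    refine (key _ _ _ _).trans (le_of_eq ?_)
    rw [mul_pow, mul_pow, sq_abs, sq_abs]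
  have j1 := i1.const_mul (mesh n ^ 2)
  have j2 := i2.const_mul (mesh n ^ 2)
  have j3 : Integrable (fun z => mesh n ^ 2 * slope n V (cellIdx n z.2) z.1 ^ 2
      + mesh n ^ 2 * rate n b q V (cellIdx n z.2) z.1 ^ 2) (volRect T 1) := j1.add j2
  have j4 : Integrable (fun z => mesh n ^ 2 * slope n V (cellIdx n z.2) z.1 ^ 2
      + mesh n ^ 2 * rate n b q V (cellIdx n z.2) z.1 ^ 2 + meanDev n p q z ^ 2)
      (volRect T 1) := j3.add i3
  rw [integral_const_mul, integral_add j4 i4, integral_add j3 i3, integral_add j1 j2,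
    integral_const_mul, integral_const_mul,
    integral_step_sq hn hT (continuousOn_slope hs.V_cont), integral_step_sq hn hT hs.rate_cont,
    integral_firstCell_sq hn hT] at h1
  have h2 := hs.integral_meanDev_sq_le hn hp hpx hpe
  have h3 : mesh n ^ 2 ≤ mesh n := by nlinarith
  have s1 : 0 ≤ ∫ t in (0)..T, mesh n * ∑ k ∈ Finset.range n, slope n V k t ^ 2 :=
    intervalIntegral.integral_nonneg hT fun t _ =>
      mul_nonneg hm.le (Finset.sum_nonneg fun _ _ => sq_nonneg _)
  have hB : 0 ≤ B := s1.trans hs.slope_le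
  have hpx0 : 0 ≤ ∫ z, px z ^ 2 ∂volRect T 1 := integral_nonneg fun _ => sq_nonneg _
  have h4 := mul_le_mul_of_nonneg_left hs.slope_le (sq_nonneg (mesh n))
  have h5 := mul_le_mul_of_nonneg_left hs.rate_le (sq_nonneg (mesh n))
  have h6 := mul_le_mul_of_nonneg_right h3 hB
  have h7 := mul_le_mul_of_nonneg_right h3 hpx0
  linarith

/-- The error in the initial values of the conserved quantity. -/
lemma SchemeBounds.integral_initial_sq_le (hs : SchemeBounds n T h b p v₀ V q B) (hn : 0 < n)
    {C c : ℝ} {g : ℝ → ℝ} (hh : Differentiable ℝ h) (hC : ∀ s, |deriv h s| ≤ C)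
    (hg : MemLp g 2 (volIoo 1)) (hv₀ : ∀ᵐ x ∂volIoo 1, v₀ x = c + ∫ y in (0)..x, g y) :
    MemLp (fun x => h (v₀ x) - h (V (cellIdx n x + 1) 0)) 2 (volIoo 1) ∧
    ∫ x, (h (v₀ x) - h (V (cellIdx n x + 1) 0)) ^ 2 ∂volIoo 1
      ≤ C ^ 2 * (∫ x, g x ^ 2 ∂volIoo 1) * mesh n := by
  have hm := mesh_pos hn
  have hprim : IsPrim 1 (fun x => c + ∫ y in (0)..x, g y) g :=
    IsPrim.of_integral ((intervalIntegrable_iff_volIoo zero_le_one).2 (hg.integrable one_le_two)) _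
  have hpt : ∀ᵐ x ∂volIoo 1, (h (v₀ x) - h (V (cellIdx n x + 1) 0)) ^ 2
      ≤ C ^ 2 * (mesh n * cellSq n g (cellIdx n x)) := by
    filter_upwards [hv₀, ae_mem_Ioo 1] with x h1 hx
    have hlt := cellIdx_lt hn hx
    have hmem := mem_Ico_cellIdx hn hx.1.le
    have h2 := hprim.sq_sub_cellMean_le hg hn hlt ⟨hmem.1, hmem.2.le⟩
    rw [hs.V_zero _ hlt, cellMean_congr hn hv₀ hlt, h1]
    have h3 := lipschitz_of_deriv_le hh hC (c + ∫ y in (0)..x, g y)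
      (cellMean n (cellIdx n x + 1) fun x => c + ∫ y in (0)..x, g y)
    have h4 := pow_le_pow_left₀ (abs_nonneg _) h3 2
    rw [sq_abs, mul_pow, sq_abs] at h4
    exact h4.trans (mul_le_mul_of_nonneg_left h2 (sq_nonneg C))
  have hbound : Integrable (fun x => C ^ 2 * (mesh n * cellSq n g (cellIdx n x))) (volIoo 1) :=
    ((integrable_step hn (cellSq n g)).const_mul _).const_mul _
  have hmeas : AEStronglyMeasurable (fun x => h (v₀ x) - h (V (cellIdx n x + 1) 0))
      (volIoo 1) := by
    refine AEStronglyMeasurable.sub (hh.continuous.comp_aestronglyMeasurable ?_)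
      (integrable_step hn fun k => h (V (k + 1) 0)).aestronglyMeasurable
    refine AEStronglyMeasurable.congr ?_ (hv₀.mono fun x hx => hx.symm)
    exact ((hprim.continuousOn zero_le_one).mono Ioo_subset_Icc_self).aestronglyMeasurable
      measurableSet_Ioo
  have hi : Integrable (fun x => (h (v₀ x) - h (V (cellIdx n x + 1) 0)) ^ 2) (volIoo 1) :=
    hbound.mono' (hmeas.pow 2) (hpt.mono fun x hx => by
      rw [Real.norm_eq_abs, abs_of_nonneg (sq_nonneg _)]; exact hx)
  refine ⟨(memLp_two_iff_integrable_sq hmeas).2 hi, ?_⟩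
  refine (integral_mono_ae hi hbound hpt).trans ?_
  rw [integral_const_mul, integral_const_mul, integral_step hn, sum_cellSq hn hg]
  have hg0 : 0 ≤ ∫ x, g x ^ 2 ∂volIoo 1 := integral_nonneg fun _ => sq_nonneg _
  have h1 : mesh n * mesh n ≤ mesh n := by nlinarith [mesh_le_one hn]
  nlinarith [mul_le_mul_of_nonneg_left h1 (mul_nonneg (sq_nonneg C) hg0)]

end consistency

/-! ### The error system of the scheme -/

section error

variable {n : ℕ} {T : ℝ} {h b : ℝ → ℝ} {p : ℝ × ℝ → ℝ} {v₀ : ℝ → ℝ} {V q : ℕ → ℝ → ℝ} {M B : ℝ}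

/-- The piecewise linear function obtained from the slopes attains the value `V (k + 1)` at the
right end of cell k, and hence differs from it by at most Δx times the slope inside the cell. -/
lemma primX_slope_sub (hn : 0 < n) (V : ℕ → ℝ → ℝ) {t x : ℝ} (hx : x ∈ Ioo (0 : ℝ) 1) :
    |V (cellIdx n x + 1) t
        - (V 1 t + primX (fun z => slope n V (cellIdx n z.2) z.1) (t, x))|
      ≤ mesh n * |slope n V (cellIdx n x) t| := by
  have hm := mesh_pos hn
  have hmem := mem_Ico_cellIdx hn hx.1.le
  have h1 := integral_step_of_mem hn (fun k => slope n V k t) (cellIdx_lt hn hx)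
    ⟨hmem.1, hmem.2.le⟩
  have h2 := sum_slope hn V t (cellIdx n x)
  rw [Finset.sum_range_succ] at h2
  simp only [primX]
  rw [h1]
  have e : V (cellIdx n x + 1) t - (V 1 t + (mesh n * ∑ j ∈ Finset.range (cellIdx n x),
      slope n V j t + (x - node n (cellIdx n x)) * slope n V (cellIdx n x) t))
      = (node n (cellIdx n x) + mesh n - x) * slope n V (cellIdx n x) t := by
    linear_combination -h2
  rw [node_succ] at hmem
  rw [e, abs_mul]
  refine mul_le_mul_of_nonneg_right ?_ (abs_nonneg _)
  rw [abs_of_nonneg (by linarith [hmem.2])]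
  linarith [hmem.1]

/-- On each cell this is the linear interpolation of the numerical fluxes at its two end points, the
discrete counterpart of the exact flux. -/
lemma primX_rate (hn : 2 ≤ n) (b : ℝ → ℝ) (q V : ℕ → ℝ → ℝ) {t x : ℝ} (hx : x ∈ Ioo (0 : ℝ) 1) :
    primX (fun z => rate n b q V (cellIdx n z.2) z.1) (t, x)
      = extFlux n b (fun j => q j t) (fun j => V j t) (cellIdx n x)
        + (x - node n (cellIdx n x)) * rate n b q V (cellIdx n x) t := by
  have hn0 : 0 < n := by omega
  have hmem := mem_Ico_cellIdx hn0 hx.1.le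
  have h1 := integral_step_of_mem hn0 (fun k => rate n b q V k t) (cellIdx_lt hn0 hx)
    ⟨hmem.1, hmem.2.le⟩
  rw [sum_rate hn b q V t (cellIdx_lt hn0 hx).le] at h1
  exact h1

lemma primX_rate_one (hn : 2 ≤ n) (b : ℝ → ℝ) (q V : ℕ → ℝ → ℝ) (t : ℝ) :
    primX (fun z => rate n b q V (cellIdx n z.2) z.1) (t, 1) = 0 := by
  have hn0 : 0 < n := by omega
  have h1 := integral_step_node hn0 (fun k => rate n b q V k t) le_rfl
  rw [sum_rate hn b q V t le_rfl, node_self hn0] at h1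
  exact h1.trans (if_neg (by omega))

/-- The flux error on one cell. -/
lemma abs_flux_sub_le {Cb : ℝ} (hb : Differentiable ℝ b) (hbC : ∀ s, |b s| ≤ Cb)
    (hbC' : ∀ s, |deriv b s| ≤ Cb) (hn : 2 ≤ n) {z : ℝ × ℝ} (hz : z.2 ∈ Ioo (0 : ℝ) 1) (w : ℝ)
    (hp : |p z| ≤ M) :
    |b w * p z + slope n V (cellIdx n z.2) z.1
        - primX (fun z => rate n b q V (cellIdx n z.2) z.1) z|
      ≤ (Cb * M + Cb + 1) * (|w - V (cellIdx n z.2 + 1) z.1| + consErr n b p q V z) := by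
  have hn0 : 0 < n := by omega
  have hm := mesh_pos hn0
  have hCb0 : 0 ≤ Cb := (abs_nonneg _).trans (hbC 0)
  have hM0 : 0 ≤ M := (abs_nonneg _).trans hp
  obtain ⟨t, x⟩ := z
  have hmem := mem_Ico_cellIdx hn0 hz.1.le
  have hlt := cellIdx_lt hn0 hz
  rw [primX_rate hn b q V hz]
  simp only [consErr, meanDev] at *
  rw [node_succ] at hmem
  set k := cellIdx n x
  set r := rate n b q V k t
  have hr : |(x - node n k) * r| ≤ mesh n * |r| := by
    rw [abs_mul]
    refine mul_le_mul_of_nonneg_right ?_ (abs_nonneg _)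
    rw [abs_of_nonneg (by linarith [hmem.1])]
    linarith [hmem.2]
  have a1 : 0 ≤ mesh n * |r| := by positivity
  have a2 : 0 ≤ mesh n * |slope n V k t| := by positivity
  have a3 : 0 ≤ |w - V (k + 1) t| := abs_nonneg _
  have a4 : 0 ≤ Cb * M := by positivity
  rcases Nat.eq_zero_or_pos k with h0 | h0
  -- First cell: slope and left flux are zero, nothing balances b(w)p, and the term is only bounded
  -- by Cb M. The summand 1 in `consErr` pays for it.
  · have e1 : slope n V k t = 0 := if_pos h0
    have e2 : extFlux n b (fun j => q j t) (fun j => V j t) k = 0 := if_neg (by omega)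
    rw [e2, e1, if_pos h0, if_pos h0, if_pos h0]
    simp only [add_zero, zero_add, abs_zero, mul_zero, zero_mul, sub_zero]
    have h1 : |b w * p (t, x)| ≤ Cb * M := by
      rw [abs_mul]; exact mul_le_mul (hbC w) hp (abs_nonneg _) hCb0
    have h2 := abs_sub (b w * p (t, x)) ((x - node n k) * r)
    nlinarith [mul_nonneg a4 a3, mul_nonneg a4 a1, mul_nonneg hCb0 a3, mul_nonneg hCb0 a1]
  · rw [extFlux_eq h0 hlt, if_neg h0.ne', if_neg h0.ne', if_neg h0.ne', one_mul, add_zero]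
    set s := slope n V k t with hsl
    set d := |p (t, x) - q k t|
    have es : V (k + 1) t - V k t = mesh n * s := by
      rw [hsl, slope, if_neg h0.ne']; field_simp
    -- In the other cells the slope cancels. What remains is b at w against b at the midpoint m, p
    -- against its mean over the preceding cell, and the linear part of the interpolated flux.
    set m := (V k t + V (k + 1) t) / 2 with hmdef
    have h1 : |w - m| ≤ |w - V (k + 1) t| + mesh n * |s| := by
      have e : w - m = (w - V (k + 1) t) + (mesh n * s) / 2 := by rw [← es, hmdef]; ring
      rw [e]
      refine (abs_add_le _ _).trans ?_
      rw [abs_div, abs_mul, abs_of_pos hm, abs_two]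
      linarith
    have h2 : |(b w - b m) * p (t, x)| ≤ Cb * M * (|w - V (k + 1) t| + mesh n * |s|) := by
      rw [abs_mul]
      have := mul_le_mul ((lipschitz_of_deriv_le hb hbC' w m).trans
        (mul_le_mul_of_nonneg_left h1 hCb0)) hp (abs_nonneg _) (by positivity)
      linarith
    have h3 : |b m * (p (t, x) - q k t)| ≤ Cb * d := by
      rw [abs_mul]; exact mul_le_mul_of_nonneg_right (hbC m) (abs_nonneg _)
    have e : b w * p (t, x) + s - (s + b m * q k t + (x - node n k) * r)
        = (b w - b m) * p (t, x) + b m * (p (t, x) - q k t) - (x - node n k) * r := by ring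
    rw [e]
    have h4 := abs_sub ((b w - b m) * p (t, x) + b m * (p (t, x) - q k t)) ((x - node n k) * r)
    have h5 := abs_add_le ((b w - b m) * p (t, x)) (b m * (p (t, x) - q k t))
    have a5 : 0 ≤ d := abs_nonneg _
    nlinarith [mul_nonneg a4 a3, mul_nonneg a4 a1, mul_nonneg hCb0 a3, mul_nonneg hCb0 a1,
      mul_nonneg a4 a2, mul_nonneg hCb0 a2, mul_nonneg a4 a5, mul_nonneg hCb0 a5]

/-- The error of the scheme solves an error system. -/
lemma StrongData.errorSystem {v vx G : ℝ × ℝ → ℝ} {A : ℝ → ℝ} {c₁ C Cb : ℝ}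
    (hd : StrongData T h b p v₀ v vx G A) (hs : SchemeBounds n T h b p v₀ V q B)
    (hn : 2 ≤ n) (hh : Differentiable ℝ h)
    (hc : ∀ s, c₁ ≤ deriv h s) (hC : ∀ s, |deriv h s| ≤ C)
    (hb : Differentiable ℝ b) (hbC : ∀ s, |b s| ≤ Cb) (hbC' : ∀ s, |deriv b s| ≤ Cb)
    (hp : MemLp p 2 (volRect T 1)) (hM : ∀ᵐ z ∂volRect T 1, |p z| ≤ M)
    (hE₀ : MemLp (fun x => h (v₀ x) - h (V (cellIdx n x + 1) 0)) 2 (volIoo 1)) :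
    ErrorSystem T c₁ C (Cb * M + Cb + 1)
      (fun z => h (v z) - h (V (cellIdx n z.2 + 1) z.1))
      (fun z => G z - rate n b q V (cellIdx n z.2) z.1)
      (fun z => vx z - slope n V (cellIdx n z.2) z.1)
      (fun z => v z - V (cellIdx n z.2 + 1) z.1)
      (fun z => v z - (V 1 z.1 + primX (fun z => slope n V (cellIdx n z.2) z.1) z))
      (consErr n b p q V) (fun x => h (v₀ x) - h (V (cellIdx n x + 1) 0))
      (fun t => A t - V 1 t) := by
  have hn0 : 0 < n := by omega
  have mR := hs.memLp_rate hn0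
  have mS := hs.memLp_slope hn0
  have mρ := hs.memLp_consErr hn0 hp
  have iR := mR.integrable one_le_two
  have iS := mS.integrable one_le_two
  have iG := hd.memLp_G.integrable one_le_two
  have ivx := hd.memLp_vx.integrable one_le_two
  have mV : MemLp (fun z : ℝ × ℝ => V (cellIdx n z.2 + 1) z.1) 2 (volRect T 1) :=
    memLp_step (c := fun k => V (k + 1)) hn0 hs.V_cont
  have me := hd.memLp_v.sub mV
  have hz2 := ae_of_snd (a := T) (ae_mem_Ioo 1)
  have hz1 := ae_of_fst (c := 1) (ae_mem_Ioo T)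
  have hsub : ∀ᵐ z ∂volRect T 1,
      |(v z - (V 1 z.1 + primX (fun z => slope n V (cellIdx n z.2) z.1) z))
        - (v z - V (cellIdx n z.2 + 1) z.1)| ≤ consErr n b p q V z := by
    filter_upwards [hz2] with z hz
    have h1 := primX_slope_sub hn0 V (t := z.1) hz
    rw [sub_sub_sub_cancel_left]
    refine h1.trans ?_
    have hm := mesh_pos hn0
    have a1 : 0 ≤ mesh n * |rate n b q V (cellIdx n z.2) z.1| := by positivity
    have a2 : 0 ≤ meanDev n p q z := abs_nonneg _
    have a3 : (0 : ℝ) ≤ if cellIdx n z.2 = 0 then 1 else 0 := by split_ifs <;> norm_num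
    simp only [consErr]
    linarith
  have mV1 : AEStronglyMeasurable (fun z : ℝ × ℝ => V 1 z.1) (volRect T 1) := by
    have := ((hs.V_cont 0 hn0).mono Ioo_subset_Icc_self).aestronglyMeasurable
      (μ := volume) measurableSet_Ioo
    exact AEStronglyMeasurable.comp_fst (μ := volIoo T) (ν := volIoo 1) this
  constructor
  · exact hd.memLp_G.sub mR
  · exact hd.memLp_vx.sub mS
  · exact me
  · have h1 : MemLp (fun z => (v z - (V 1 z.1
        + primX (fun z => slope n V (cellIdx n z.2) z.1) z))
        - (v z - V (cellIdx n z.2 + 1) z.1)) 2 (volRect T 1) := by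
      refine MemLp.of_le mρ ((hd.memLp_v.1.sub (mV1.add
        (aestronglyMeasurable_primX iS.aestronglyMeasurable))).sub me.1) ?_
      filter_upwards [hsub] with z hz
      exact hz.trans (le_abs_self _)
    refine (h1.add me).ae_eq (ae_of_all _ fun z => ?_)
    simp
  · exact mρ
  · exact hE₀
  · filter_upwards [hd.h_eq, primT_sub iG iR, hz1, hz2] with z h1 h2 h3 h4
    have h5 := (hs.isPrim _ (cellIdx_lt hn0 h4)).2 z.1 ⟨h3.1.le, h3.2.le⟩
    beta_reduce at h5
    rw [h2, h1, h5]
    simp only [primT]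
    ring
  · filter_upwards [hd.v_eq, primX_sub' ivx iS] with z h1 h2
    rw [h2, h1]; ring
  · filter_upwards [hd.flux_one, primX_sub iG iR] with t h1 h2
    rw [h2 1 (right_mem_Icc.2 zero_le_one), h1, primX_rate_one hn, sub_zero]
  · exact ae_of_all _ fun z => mul_sq_le_of_le_deriv hh hc _ _
  · exact ae_of_all _ fun z => lipschitz_of_deriv_le hh hC _ _
  · exact hsub
  · filter_upwards [hd.flux, primX_sub' iG iR, hM, hz2] with z h1 h2 h3 h4
    rw [h2, ← h1]
    have e : vx z + b (v z) * p z - primX (fun z => rate n b q V (cellIdx n z.2) z.1) z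
        - (vx z - slope n V (cellIdx n z.2) z.1)
        = b (v z) * p z + slope n V (cellIdx n z.2) z.1
          - primX (fun z => rate n b q V (cellIdx n z.2) z.1) z := by ring
    rw [e]
    exact abs_flux_sub_le hb hbC hbC' hn h4 (v z) h3

end error

/-! ### The error estimate -/

section estimate

variable {T : ℝ} {h b : ℝ → ℝ} {p : ℝ × ℝ → ℝ} {v₀ : ℝ → ℝ}

lemma SchemeBounds.integral_sub_rate_sq_le {n : ℕ} {V q : ℕ → ℝ → ℝ} {B : ℝ}
    (hs : SchemeBounds n T h b p v₀ V q B) (hn : 0 < n) (hT : 0 ≤ T) {G : ℝ × ℝ → ℝ}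
    (hG : MemLp G 2 (volRect T 1)) :
    ∫ z, (G z - rate n b q V (cellIdx n z.2) z.1) ^ 2 ∂volRect T 1
      ≤ 2 * (∫ z, G z ^ 2 ∂volRect T 1) + 2 * B := by
  have mR := hs.memLp_rate hn
  have h1 : ∫ z, (G z - rate n b q V (cellIdx n z.2) z.1) ^ 2 ∂volRect T 1
      ≤ ∫ z, (2 * G z ^ 2 + 2 * rate n b q V (cellIdx n z.2) z.1 ^ 2) ∂volRect T 1 := by
    refine integral_mono (hG.sub mR).integrable_sq
      ((hG.integrable_sq.const_mul 2).add (mR.integrable_sq.const_mul 2)) fun z => ?_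
    have := sq_nonneg (G z + rate n b q V (cellIdx n z.2) z.1)
    simp only
    nlinarith
  rw [integral_add (hG.integrable_sq.const_mul 2) (mR.integrable_sq.const_mul 2),
    integral_const_mul, integral_const_mul, integral_step_sq hn hT hs.rate_cont] at h1
  linarith [hs.rate_le]

lemma sq_mul_sq_le {c E e : ℝ} (hc : 0 ≤ c) (he : c * e ^ 2 ≤ E * e) :
    c ^ 2 * e ^ 2 ≤ E ^ 2 := by
  linarith [sq_nonneg (E - c * e), mul_le_mul_of_nonneg_left he hc]

/-- Combines the error system with the uniform bounds. The squared L² norms of e and ρ are at most D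
Δx and that of Γ at most R, so the products of norms in the estimates of E(t) and η are of order
(Δx)^(1/2). -/
lemma StrongData.exists_error_le {v vx G : ℝ × ℝ → ℝ} {A : ℝ → ℝ} {c₁ C₂ Cb M : ℝ}
    (hd : StrongData T h b p v₀ v vx G A) (hT : 0 < T) (hc₁ : 0 < c₁) (hh : ContDiff ℝ 2 h)
    (hc : ∀ s, c₁ ≤ deriv h s) (hC : ∀ s, deriv h s ≤ C₂) (hb : ContDiff ℝ 2 b)
    (hbC : ∀ s, |b s| ≤ Cb) (hbC' : ∀ s, |deriv b s| ≤ Cb) {pt px : ℝ × ℝ → ℝ} {P P' : ℝ → ℝ}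
    (hM : ∀ᵐ z ∂volRect T 1, |p z| ≤ M) (hp : MemLp p 2 (volRect T 1))
    (hP : Integrable P (volIoo 1)) (hpt : MemLp pt 2 (volRect T 1))
    (hpt_eq : ∀ᵐ z ∂volRect T 1, p z = P z.2 + primT pt z)
    (hpx : MemLp px 2 (volRect T 1)) (hpx_eq : ∀ᵐ z ∂volRect T 1, p z = P' z.1 + primX px z)
    {g : ℝ → ℝ} {c : ℝ} (hg : MemLp g 2 (volIoo 1))
    (hv₀ : ∀ᵐ x ∂volIoo 1, v₀ x = c + ∫ y in (0)..x, g y) :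
    ∃ C, 0 ≤ C ∧ ∀ n, 3 ≤ n → ∀ V, IsSchemeSolution n T h b p v₀ V →
      (MemLp (fun z => v z - V (cellIdx n z.2 + 1) z.1) 2 (volRect T 1) ∧
        ∀ᵐ t ∂volIoo T, ∫ x, (v (t, x) - V (cellIdx n x + 1) t) ^ 2 ∂volIoo 1 ≤ C * √(mesh n)) ∧
      MemLp (fun z => vx z - slope n V (cellIdx n z.2) z.1) 2 (volRect T 1) ∧
        ∫ z, (vx z - slope n V (cellIdx n z.2) z.1) ^ 2 ∂volRect T 1 ≤ C * √(mesh n) := by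
  have hhd : Differentiable ℝ h := hh.differentiable two_ne_zero
  have hbd : Differentiable ℝ b := hb.differentiable two_ne_zero
  have hC' : ∀ s, |deriv h s| ≤ C₂ := fun s => by
    rw [abs_of_nonneg (hc₁.le.trans (hc s))]; exact hC s
  have hC₂ : 0 ≤ C₂ := (abs_nonneg _).trans (hC' 0)
  obtain ⟨B, hB⟩ := exists_schemeBounds hT hc₁ hh hc hC hb hbC hbC' hM hP hpt hpt_eq hg hv₀
  set K := Cb * M + Cb + 1 with hK
  obtain ⟨N, hN, hNle⟩ := ErrorSystem.exists_integral_sq_le (T := T) C₂ K hT hc₁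
  -- The existence statement gives B without a sign, hence the absolute value.
  set D₁ := 8 * |B| + 16 * (∫ z, px z ^ 2 ∂volRect T 1) + 4 * T with hD₁
  set D₂ := C₂ ^ 2 * ∫ x, g x ^ 2 ∂volIoo 1 with hD₂
  have hpx0 : 0 ≤ ∫ z, px z ^ 2 ∂volRect T 1 := integral_nonneg fun _ => sq_nonneg _
  have hg0 : 0 ≤ ∫ x, g x ^ 2 ∂volIoo 1 := integral_nonneg fun _ => sq_nonneg _
  have hG0 : 0 ≤ ∫ z, G z ^ 2 ∂volRect T 1 := integral_nonneg fun _ => sq_nonneg _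
  have hD₁0 : 0 ≤ D₁ := by positivity
  have hD₂0 : 0 ≤ D₂ := by positivity
  set D := N * (D₁ + D₂) + D₁ with hD
  have hD0 : 0 ≤ D := by positivity
  set R := 2 * (∫ z, G z ^ 2 ∂volRect T 1) + 2 * |B| with hR
  have hR0 : 0 ≤ R := by positivity
  set F₁ := 2 * (√(2 * D) * √R) + 2 * K ^ 2 * D with hF₁
  set F₂ := (c₁ ^ 2)⁻¹ * (D₂ + 2 * (C₂ * √D * √R)) with hF₂
  have hF₁0 : 0 ≤ F₁ := by positivity
  have hF₂0 : 0 ≤ F₂ := by positivity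
  refine ⟨F₁ + F₂, by positivity, fun n hn V hV => ?_⟩
  obtain ⟨q, hs⟩ := hB n hn V hV
  have hn0 : 0 < n := by omega
  have hm := mesh_pos hn0
  -- Terms of first order, such as the initial error, are absorbed into the order one half.
  have hms : mesh n ≤ √(mesh n) := by
    rw [Real.le_sqrt hm.le hm.le]; nlinarith [mesh_le_one hn0]
  have hsm : 0 ≤ √(mesh n) := Real.sqrt_nonneg _
  obtain ⟨hE₀, hE₀le⟩ := hs.integral_initial_sq_le hn0 hhd hC' hg hv₀
  have hsys := hd.errorSystem hs (by omega) hhd hc hC' hbd hbC hbC' hp hM hE₀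
  have hρ : ∫ z, consErr n b p q V z ^ 2 ∂volRect T 1 ≤ D₁ * mesh n :=
    (hs.integral_consErr_sq_le hn0 hT.le hp hpx hpx_eq).trans
      (mul_le_mul_of_nonneg_right (by rw [hD₁]; linarith [le_abs_self B]) hm.le)
  have he := (hNle _ _ _ _ _ _ _ _ hsys).trans
    (mul_le_mul_of_nonneg_left (add_le_add hρ hE₀le) hN)
  have heρ := add_le_add he hρ
  have hΓ := (hs.integral_sub_rate_sq_le hn0 hT.le hd.memLp_G).trans
    (show _ ≤ R by rw [hR]; linarith [le_abs_self B])
  have e1 : N * (D₁ * mesh n + D₂ * mesh n) + D₁ * mesh n = D * mesh n := by rw [hD]; ring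
  rw [e1] at heρ
  have he' : ∫ z, (v z - V (cellIdx n z.2 + 1) z.1) ^ 2 ∂volRect T 1 ≤ D * mesh n := by
    refine he.trans ?_
    rw [← e1]
    linarith [mul_nonneg hD₁0 hm.le]
  refine ⟨⟨hsys.memLp_e, ?_⟩, hsys.memLp_η, ?_⟩
  · have hE : ∫ z, (h (v z) - h (V (cellIdx n z.2 + 1) z.1)) ^ 2 ∂volRect T 1
        ≤ C₂ ^ 2 * (D * mesh n) := by
      refine le_trans ?_ (mul_le_mul_of_nonneg_left he' (sq_nonneg C₂))
      rw [← integral_const_mul]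
      refine integral_mono_ae hsys.memLp_E.integrable_sq
        (hsys.memLp_e.integrable_sq.const_mul _) (hsys.E_le.mono fun z hz => ?_)
      have := pow_le_pow_left₀ (abs_nonneg _) hz 2
      rwa [sq_abs, mul_pow, sq_abs] at this
    have hsE := Real.sqrt_le_sqrt hE
    rw [Real.sqrt_mul (sq_nonneg _), Real.sqrt_sq hC₂, Real.sqrt_mul hD0] at hsE
    have hsΓ := Real.sqrt_le_sqrt hΓ
    have hprod := mul_le_mul hsE hsΓ (Real.sqrt_nonneg _) (by positivity)
    filter_upwards [hsys.ae_integral_E_sq_le, memLp_slice hsys.memLp_E,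
      memLp_slice hsys.memLp_e] with t h1 h2 h3
    -- Strong monotonicity of h passes from the conserved quantity back to v at fixed time.
    have h4 : ∫ x, (v (t, x) - V (cellIdx n x + 1) t) ^ 2 ∂volIoo 1
        ≤ (c₁ ^ 2)⁻¹ * ∫ x, (h (v (t, x)) - h (V (cellIdx n x + 1) t)) ^ 2 ∂volIoo 1 := by
      rw [← integral_const_mul]
      refine integral_mono h3.integrable_sq (h2.integrable_sq.const_mul _) fun x => ?_
      simp only
      rw [inv_mul_eq_div, le_div_iff₀ (by positivity), mul_comm]
      exact sq_mul_sq_le hc₁.le (mul_sq_le_of_le_deriv hhd hc _ _)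
    refine h4.trans ?_
    have h5 : (∫ x, (h (v (t, x)) - h (V (cellIdx n x + 1) t)) ^ 2 ∂volIoo 1)
        ≤ (D₂ + 2 * (C₂ * √D * √R)) * √(mesh n) := by
      have h6 := mul_le_mul_of_nonneg_left hms hD₂0
      linarith
    have h6 := mul_le_mul_of_nonneg_left h5 (show 0 ≤ (c₁ ^ 2)⁻¹ by positivity)
    have h7 := mul_nonneg hF₁0 hsm
    rw [hF₂, add_mul]
    linarith
  · refine hsys.integral_η_sq_le.trans ?_
    have hs1 := Real.sqrt_le_sqrt (mul_le_mul_of_nonneg_left heρ zero_le_two)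
    rw [← mul_assoc, Real.sqrt_mul (show 0 ≤ 2 * D by positivity)] at hs1
    have hprod := mul_le_mul hs1 (Real.sqrt_le_sqrt hΓ) (Real.sqrt_nonneg _) (by positivity)
    have h1 := mul_le_mul_of_nonneg_left heρ (show 0 ≤ 2 * K ^ 2 by positivity)
    have h2 := mul_le_mul_of_nonneg_left hms (show 0 ≤ 2 * K ^ 2 * D by positivity)
    have h3 := mul_nonneg hF₂0 hsm
    rw [add_mul, hF₁]
    linarith

end estimate

/-! ### From integrals of squares to extended norms. -/

lemma eLpNorm_two_sq {α : Type*} [MeasurableSpace α] {μ : Measure α} {f : α → ℝ}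
    (hf : MemLp f 2 μ) : eLpNorm f 2 μ ^ 2 = ENNReal.ofReal (∫ x, f x ^ 2 ∂μ) := by
  rw [ofReal_integral_eq_lintegral_ofReal hf.integrable_sq (ae_of_all _ fun _ => sq_nonneg _)]
  have := eLpNorm_nnreal_pow_eq_lintegral (f := f) (μ := μ) (p := 2) two_ne_zero
  norm_num at this
  rw [this]
  refine lintegral_congr fun x => ?_
  rw [← ofReal_norm, ← ENNReal.ofReal_pow (norm_nonneg _), Real.norm_eq_abs, sq_abs]

/-- The norm of `L^∞(0,T; H)` is controlled by the `L²` norms of the slices. -/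
lemma normLinfH_sq_le {T B : ℝ} {f : ℝ × ℝ → ℝ} (hf : MemLp f 2 (volRect T 1))
    (hB : ∀ᵐ t ∂volIoo T, ∫ x, f (t, x) ^ 2 ∂volIoo 1 ≤ B) (hB0 : 0 ≤ B) :
    normLinfH T f ^ 2 ≤ ENNReal.ofReal B := by
  have h1 : normLinfH T f ≤ ENNReal.ofReal (√B) := by
    refine essSup_le_of_ae_le _ ?_
    filter_upwards [hB, memLp_slice hf] with t h2 h3
    have h4 := eLpNorm_two_sq h3
    refine (ENNReal.pow_le_pow_left_iff two_ne_zero).1 ?_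
    rw [← ENNReal.ofReal_pow (Real.sqrt_nonneg _), Real.sq_sqrt hB0]
    exact h4.trans_le (ENNReal.ofReal_le_ofReal h2)
  refine (pow_le_pow_left₀ zero_le h1 2).trans ?_
  rw [← ENNReal.ofReal_pow (Real.sqrt_nonneg _), Real.sq_sqrt hB0]

/-- The interval (Δx, 1) may be enlarged to (0, 1), since the gradient estimate covers the first
cell as well. -/
lemma lintegral_normHΔ_sq_le {T t : ℝ} (ht : t ≤ T) (n : ℕ) {f : ℝ × ℝ → ℝ}
    (hf : MemLp f 2 (volRect T 1)) :
    ∫⁻ τ in Ioo 0 t, normHΔ n (fun x => f (τ, x)) ^ 2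
      ≤ ENNReal.ofReal (∫ z, f z ^ 2 ∂volRect T 1) := by
  have hm : 0 ≤ mesh n := by unfold mesh; positivity
  calc ∫⁻ τ in Ioo 0 t, normHΔ n (fun x => f (τ, x)) ^ 2
      ≤ ∫⁻ τ, normHΔ n (fun x => f (τ, x)) ^ 2 ∂volIoo T :=
        lintegral_mono' (volIoo_mono ht) le_rfl
    _ ≤ ∫⁻ τ, ENNReal.ofReal (∫ x, f (τ, x) ^ 2 ∂volIoo 1) ∂volIoo T := by
        refine lintegral_mono_ae ?_
        filter_upwards [memLp_slice hf] with τ h1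
        rw [← eLpNorm_two_sq h1]
        refine pow_le_pow_left₀ zero_le ?_ 2
        exact eLpNorm_mono_measure _ (Measure.restrict_mono (Ioo_subset_Ioo_left hm) le_rfl)
    _ = ENNReal.ofReal (∫ z, f z ^ 2 ∂volRect T 1) := by
        have h1 := hf.integrable_sq
        rw [← ofReal_integral_eq_lintegral_ofReal h1.integral_prod_left
          (ae_of_all _ fun _ => integral_nonneg fun _ => sq_nonneg _)]
        congr 1
        exact (integral_prod _ h1).symm

lemma normLinfH_congr {T : ℝ} {f g : ℝ × ℝ → ℝ} (hfg : ∀ᵐ z ∂volRect T 1, f z = g z) :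
    normLinfH T f = normLinfH T g := by
  refine essSup_congr_ae ?_
  filter_upwards [ae_ae_fst hfg] with t ht
  exact eLpNorm_congr_ae ht

lemma lintegral_normHΔ_congr {T t : ℝ} (ht : t ≤ T) (n : ℕ) {f g : ℝ × ℝ → ℝ}
    (hfg : ∀ᵐ z ∂volRect T 1, f z = g z) :
    ∫⁻ τ in Ioo 0 t, normHΔ n (fun x => f (τ, x)) ^ 2
      = ∫⁻ τ in Ioo 0 t, normHΔ n (fun x => g (τ, x)) ^ 2 := by
  have hm : 0 ≤ mesh n := by unfold mesh; positivity
  refine lintegral_congr_ae ?_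
  filter_upwards [ae_volIoo_mono ht (ae_ae_fst hfg)] with τ hτ
  congr 1
  exact eLpNorm_congr_ae (ae_restrict_of_ae_restrict_of_subset (Ioo_subset_Ioo_left hm) hτ)

lemma mesh_rpow_half (n : ℕ) : mesh n ^ (1 / 2 : ℝ) = √(mesh n) :=
  (Real.sqrt_eq_rpow _).symm

end FVM

/-! ### The main theorem. -/

open MeasureTheory FVM in
theorem theorem2 (T : ℝ) (hT : 0 < T) (h b : ℝ → ℝ) (hh : FVM.A1 h) (hb : FVM.A2 b)
    (p : ℝ × ℝ → ℝ) (hp₁ : FVM.MemW12H T p) (hp₂ : FVM.MemLinfLinf T p) (hp₃ : FVM.MemL2X T p)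
    (v₀ : ℝ → ℝ) (hv₀ : FVM.MemX v₀) :
    ∃ C : ℝ, 0 < C ∧
      ∀ v : ℝ × ℝ → ℝ, FVM.IsStrongSolution T h b p v₀ v →
      ∀ vx : ℝ × ℝ → ℝ, FVM.IsWeakDx T v vx →
      ∀ n : ℕ, 3 ≤ n →
      ∀ V : ℕ → ℝ → ℝ, FVM.IsSchemeSolution n T h b p v₀ V →
      ∀ t ∈ Set.Icc 0 T,
        FVM.normLinfH T (fun z => v z - FVM.approx n V z) ^ 2 +
          ∫⁻ τ in Set.Ioo 0 t,
            FVM.normHΔ n (fun x => vx (τ, x) - FVM.diffQuot n V (τ, x)) ^ 2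
        ≤ ENNReal.ofReal (C * FVM.mesh n ^ (1 / 2 : ℝ)) := by
  -- The constant precedes v, yet the estimates involve norms of the time derivative of h(v). One
  -- strong solution u is therefore fixed to define it; if there is none, the claim is empty.
  by_cases hex : ∃ v, IsStrongSolution T h b p v₀ v
  swap
  · exact ⟨1, one_pos, fun v hv => absurd ⟨v, hv⟩ hex⟩
  obtain ⟨u, hu⟩ := hex
  obtain ⟨hhc, c₁, C₂, hc₁, -, hhb⟩ := hh
  obtain ⟨hbc, c₂, Cb, hc₂, -, hbb⟩ := hb
  have hc : ∀ s, c₁ ≤ deriv h s := fun s => (hhb s).1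
  have hC : ∀ s, deriv h s ≤ C₂ := fun s => (hhb s).2.1
  have hC' : ∀ s, |deriv h s| ≤ C₂ := fun s => by
    rw [abs_of_nonneg (hc₁.le.trans (hc s))]; exact hC s
  have hbC : ∀ s, |b s| ≤ Cb := fun s => by
    rw [abs_of_nonneg (hc₂.le.trans (hbb s).1)]; exact (hbb s).2.1
  have hbC' : ∀ s, |deriv b s| ≤ Cb := fun s => (hbb s).2.2.1
  have hhd : Differentiable ℝ h := hhc.differentiable two_ne_zero
  have hbd : Differentiable ℝ b := hbc.differentiable two_ne_zero
  obtain ⟨hp, pt, hpt, hpt2⟩ := hp₁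
  obtain ⟨-, px, hpx, hpx2⟩ := hp₃
  obtain ⟨P, hP, hPe⟩ := hpt.exists_primT hT hp hpt2
  obtain ⟨P', -, hPe'⟩ := hpx.exists_primX hp hpx2
  obtain ⟨c, g, hg, hge⟩ := hv₀.exists_primitive
  simp only [MemL2H, MemLinfLinf, volume_restrict_Q] at hp hpt2 hpx2 hp₂
  obtain ⟨M, hM⟩ : ∃ M, ∀ᵐ z ∂volRect T 1, |p z| ≤ M :=
    ⟨(eLpNormEssSup p (volRect T 1)).toReal, by
      have h1 := hp₂.eLpNorm_lt_top
      rw [eLpNorm_exponent_top] at h1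
      filter_upwards [ae_le_eLpNormEssSup (f := p) (μ := volRect T 1)] with z hz
      have h2 := ENNReal.toReal_mono h1.ne hz
      simpa using h2⟩
  obtain ⟨ux, hux, -⟩ := hu.equation
  obtain ⟨G, A, hd⟩ := hu.exists_strongData hT hhd hC' hbc.continuous hbC hp.1 hM hux
  obtain ⟨D, hD0, hD⟩ := hd.exists_error_le hT hc₁ hhc hc hC hbc hbC hbC' hM hp hP hpt2 hPe
    hpx2 hPe' hg hge
  -- D for each of the two terms; the 1 makes the constant positive.
  refine ⟨2 * D + 1, by positivity, fun v hv vx hvx n hn V hV t ht => ?_⟩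
  obtain ⟨G', A', hd'⟩ := hv.exists_strongData hT hhd hC' hbc.continuous hbC hp.1 hM hvx
  -- By uniqueness any strong solution and any version of its space derivative agree almost
  -- everywhere with u and `ux`, and the norms only see classes.
  have hvu := hd'.ae_eq hT hc₁ hhd hc hC' hbd hbC' hM hd
  have hvxu := hvx.ae_unique hux hvu
  obtain ⟨⟨m₁, h₁⟩, m₂, h₂⟩ := hD n hn V hV
  have hn0 : 0 < n := by omega
  have hs : 0 ≤ √(mesh n) := Real.sqrt_nonneg _
  have e₁ : ∀ᵐ z ∂volRect T 1,
      v z - approx n V z = u z - V (cellIdx n z.2 + 1) z.1 := by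
    filter_upwards [hvu, ae_of_snd (a := T) (ae_mem_Ioo 1)] with z h3 h4
    rw [h3, approx_eq hn0 V h4.1.le h4.2]
  have e₂ : ∀ᵐ z ∂volRect T 1,
      vx z - diffQuot n V z = ux z - FVM.slope n V (cellIdx n z.2) z.1 := by
    filter_upwards [hvxu, ae_of_snd (a := T) (ae_mem_Ioo 1)] with z h3 h4
    rw [h3, diffQuot_eq hn0 V h4, FVM.slope]
  rw [normLinfH_congr e₁, lintegral_normHΔ_congr ht.2 n e₂, mesh_rpow_half]
  refine (add_le_add (normLinfH_sq_le m₁ h₁ (by positivity))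
    ((lintegral_normHΔ_sq_le ht.2 n m₂).trans (ENNReal.ofReal_le_ofReal h₂))).trans ?_
  rw [← ENNReal.ofReal_add (by positivity) (by positivity)]
  exact ENNReal.ofReal_le_ofReal (by linarith)
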